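/- Let $\Omega$ be a rectangle with side lengths $\ell_1,\ell_2>0$ and periodic boundary conditions, and for a real function $w\in L^2(\Omega)$ and $k\in\mathbb Z^2$ put $$\hat w_k=\frac1{|\Omega|}\int_\Omega w(x)\,e^{-i\xi_k\cdot x}\,dx,\qquad \xi_k=\Big(\frac{2\pi k_1}{\ell_1},\frac{2\pi k_2}{\ell_2}\Big)$$ (so $\xi_k=k$ if $\ell_1=\ell_2=2\pi$), $(-\Delta)^{s}w=\sum_k|\xi_k|^{2s}\hat w_ke^{i\xi_k\cdot x}$, $|w|_s^2=\sum_k|\xi_k|^{2s}|\hat w_k|^2$, $\|w\|_s^2=\sum_k(1+|\xi_k|^2)^s|\hat w_k|^2$, and $H^s_{per}(\Omega)=\{w:\|w\|_s<\infty\}$. Let $(\cdot,\cdot)$ and $\|\cdot\|$ be the inner product and norm of $L^2(\Omega)$. Let $1<\alpha\le2$, $\kappa>0$, $\gamma_1,\gamma_2\ge0$, $T>0$, let $F\in C^3(\mathbb R)$ be nonnegative, $C_0\in\mathbb R$ and $E(w)=\int_\Omega F(w)\,dx+C_0$. Let $u$, with $v=u_t$, solve $$u_{tt}+\kappa(-\Delta)^{\alpha/2}u+\gamma_1(-\Delta)^{\alpha/2}u_t+\gamma_2u_t+F'(u)=0\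 \text{ on }\Omega\times(0,T),\qquad u(0)=\phi_0,\ u_t(0)=\varphi_0,$$ where $u,v$ are continuous from $[0,T]$ to $L^2(\Omega)$ with values in $H^\alpha_{per}(\Omega)$, $u$ is three times differentiable in time on $(0,T)$ with values in $L^2(\Omega)$, $E(u(t))>0$ for $t\in[0,T]$, and $r(t)=\sqrt{E(u(t))}$ is of class $C^3$ on $(0,T)$. Assume that for some $m\ge\tfrac72\alpha$ and some constant $L$, for all $t\in(0,T)$, $$\|\phi_0\|_{m}+\|u\|_{m}+|r|+|r_t|+|r_{tt}|+|r_{ttt}|+\|u_t\|_{m}+\|u\|_\alpha+\|u_t\|_\alpha+\|u_{tt}\|_\alpha+\|u_{ttt}\|_{\alpha/2}\le L .$$ For an integer $K\ge1$ let $\tau=T/K$, $t_n=n\tau$. The time-discrete SAV scheme seeks $U^n,V^n\in H^\alpha_{per}(\Omega)$, $R^n\in\mathbb R$ ($0\le n\le K$) and $\tilde U^{1/2},\tilde V^{1/2}\in H^\alpha_{per}(\Omega)$, $\tilde R^{1/2}\in\mathbb R$ with $U^0=\phi_0$, $V^0=\varphi_0$, $R^0=\sqrt{E(\phi_0)}$,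 the first half step $$\frac{\tilde U^{1/2}-U^0}{\tau/2}=\tilde V^{1/2},\qquad \frac{\tilde V^{1/2}-V^0}{\tau/2}+\kappa(-\Delta)^{\alpha/2}\tilde U^{1/2}+\gamma_1(-\Delta)^{\alpha/2}\tilde V^{1/2}+\gamma_2\tilde V^{1/2}+\tilde R^{1/2}\frac{F'(U^0)}{\sqrt{E(U^0)}}=0,$$ $$\frac{\tilde R^{1/2}-R^0}{\tau/2}=\frac1{2\sqrt{E(U^0)}}\Big(F'(U^0),\frac{\tilde U^{1/2}-U^0}{\tau/2}\Big),$$ and, for $0\le n<K$, with $\tilde U^{n+1/2}=\frac{3U^n-U^{n-1}}2$ if $n\ge1$, $\delta_tX=\frac{X^{n+1}-X^n}{\tau}$, $\bar X=\frac{X^{n+1}+X^n}2$, $$\delta_tU=\bar V,\qquad \delta_tV+\kappa(-\Delta)^{\alpha/2}\bar U+\gamma_1(-\Delta)^{\alpha/2}\bar V+\gamma_2\bar V+\bar R\,\frac{F'(\tilde U^{n+1/2})}{\sqrt{E(\tilde U^{n+1/2})}}=0,\qquad \delta_tR=\frac{\big(F'(\tilde U^{n+1/2}),\delta_tU\big)}{2\sqrt{E(\tilde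 U^{n+1/2})}} .$$ Then there are constants $\tau_1^*,C,M>0$, independent of $K$, such that whenever $\tau=T/K<\tau_1^*$ the scheme has a unique solution, $E(\tilde U^{n+1/2})>0$ for $0\le n<K$, and for all $0\le n\le K$, with $e_u^n=u(t_n)-U^n$, $e_v^n=v(t_n)-V^n$, $e_r^n=r(t_n)-R^n$, $$\|e_u^n\|^2+\kappa|e_u^n|_{\alpha/2}^2+\kappa|e_u^n|_\alpha^2+\|e_v^n\|^2+|e_v^n|_{\alpha/2}^2+(e_r^n)^2\le C\tau^3,\qquad \|U^n\|_{L^\infty(\Omega)}\le M .$$ -/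

import Mathlib

open Set MeasureTheory

open scoped ENNReal

noncomputable section

namespace SAVWave

/-- The rectangle `Ω` with side lengths `ℓ₁, ℓ₂` and opposite sides identified (functions on it are the
periodic functions). Its volume is Lebesgue measure of total mass `ℓ₁ * ℓ₂`. -/
abbrev Torus (ℓ₁ ℓ₂ : ℝ) := AddCircle ℓ₁ × AddCircle ℓ₂

/-- Real-valued periodic functions in `L²(Ω)`; the inner product is `(u, w) = ∫_Ω u w dx`. -/
abbrev L2per (ℓ₁ ℓ₂ : ℝ) [Fact (0 < ℓ₁)] [Fact (0 < ℓ₂)] := Lp ℝ 2 (volume : Measure (Torus ℓ₁ ℓ₂))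

variable {ℓ₁ ℓ₂ : ℝ} [Fact (0 < ℓ₁)] [Fact (0 < ℓ₂)]

/-- Fourier coefficient
`ŵ_k = |Ω|⁻¹ ∫_Ω w(x) exp(-i (2π k₁ x₁ / ℓ₁ + 2π k₂ x₂ / ℓ₂)) dx`. -/
def fcoeff (w : L2per ℓ₁ ℓ₂) (k : ℤ × ℤ) : ℂ :=
  ((ℓ₁ * ℓ₂ : ℝ) : ℂ)⁻¹ *
    ∫ x : Torus ℓ₁ ℓ₂, (w x : ℂ) * (fourier (-k.1) x.1 * fourier (-k.2) x.2)

/-- The symbol of `-Δ`; it is `k₁² + k₂²` when `ℓ₁ = ℓ₂ = 2π`. -/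
def freqSq (ℓ₁ ℓ₂ : ℝ) (k : ℤ × ℤ) : ℝ :=
  (2 * Real.pi * k.1 / ℓ₁) ^ 2 + (2 * Real.pi * k.2 / ℓ₂) ^ 2

/-- Membership in the periodic Sobolev space `H^s_per(Ω)`. -/
def MemH (s : ℝ) (w : L2per ℓ₁ ℓ₂) : Prop :=
  Summable fun k : ℤ × ℤ => (1 + freqSq ℓ₁ ℓ₂ k) ^ s * ‖fcoeff w k‖ ^ 2

/-- The norm `‖w‖_s` of `H^s_per(Ω)` (meaningful for `w` with `MemH s w`). -/
def hNorm (s : ℝ) (w : L2per ℓ₁ ℓ₂) : ℝ :=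
  √(∑' k : ℤ × ℤ, (1 + freqSq ℓ₁ ℓ₂ k) ^ s * ‖fcoeff w k‖ ^ 2)

/-- The seminorm `|w|_s` of `H^s_per(Ω)`, `s > 0` (meaningful for `w` with `MemH s w`). -/
def hSemi (s : ℝ) (w : L2per ℓ₁ ℓ₂) : ℝ :=
  √(∑' k : ℤ × ℤ, freqSq ℓ₁ ℓ₂ k ^ s * ‖fcoeff w k‖ ^ 2)

/-- `z = (-Δ)^s w`, that is, `ẑ_k = |ξ_k|^{2s} ŵ_k` for every `k`. -/
def IsFracLap (s : ℝ) (w z : L2per ℓ₁ ℓ₂) : Prop :=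
  ∀ k : ℤ × ℤ, fcoeff z k = ((freqSq ℓ₁ ℓ₂ k ^ s : ℝ) : ℂ) * fcoeff w k

open Classical in
/-- The fractional Laplacian `(-Δ)^s w` as an element of `L²`, for `s > 0` and `w ∈ H^{2s}_per(Ω)`. -/
def fracLap (s : ℝ) (w : L2per ℓ₁ ℓ₂) : L2per ℓ₁ ℓ₂ :=
  if h : ∃ z, IsFracLap s w z then h.choose else 0

open Classical in
/-- The composition `g ∘ w` as an element of `L²` (for continuous `g` and bounded `w` it always is one). -/
def comp (g : ℝ → ℝ) (w : L2per ℓ₁ ℓ₂) : L2per ℓ₁ ℓ₂ :=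
  if h : MemLp (fun x => g (w x)) 2 (volume : Measure (Torus ℓ₁ ℓ₂)) then h.toLp _ else 0

/-- The data of the equation
`u_tt + κ (-Δ)^{α/2} u + γ₁ (-Δ)^{α/2} u_t + γ₂ u_t + F'(u) = 0`, with the shift `C₀` of the energy. -/
structure Model where
  /-- order of the fractional Laplacian -/
  α : ℝ
  /-- diffusion coefficient -/
  κ : ℝ
  /-- coefficient of the fractional damping -/
  γ₁ : ℝ
  /-- coefficient of the damping -/
  γ₂ : ℝ
  /-- shift of the nonlinear energy -/
  C₀ : ℝ
  /-- potential -/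
  F : ℝ → ℝ

/-- `E(w) = ∫_Ω F(w) dx + C₀`. -/
def Model.E (P : Model) (w : L2per ℓ₁ ℓ₂) : ℝ :=
  (∫ x : Torus ℓ₁ ℓ₂, P.F (w x)) + P.C₀

/-- `F'(w)`. -/
def Model.dF (P : Model) (w : L2per ℓ₁ ℓ₂) : L2per ℓ₁ ℓ₂ :=
  comp (deriv P.F) w

/-- The scalar auxiliary variable `r = √E(w)`. -/
def Model.sav (P : Model) (w : L2per ℓ₁ ℓ₂) : ℝ :=
  √(P.E w)

/-- `F'(w) / √E(w)`. -/
def Model.b (P : Model) (w : L2per ℓ₁ ℓ₂) : L2per ℓ₁ ℓ₂ :=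
  (1 / √(P.E w)) • P.dF w

/-- `u` solves the wave equation on `[0, T]` with `u(0) = φ₀` and `u_t(0) = φ₁`. Here `v`, `a`, `j` are
the time derivatives `u_t`, `u_tt`, `u_ttt`, taken in `L²(Ω)`. -/
structure IsSolution (P : Model) (T : ℝ) (φ₀ φ₁ : L2per ℓ₁ ℓ₂) (u v a j : ℝ → L2per ℓ₁ ℓ₂) :
    Prop where
  cont_u : ContinuousOn u (Icc 0 T)
  cont_v : ContinuousOn v (Icc 0 T)
  mem_u : ∀ t ∈ Icc 0 T, MemH P.α (u t)
  mem_v : ∀ t ∈ Icc 0 T, MemH P.α (v t)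
  deriv_u : ∀ t ∈ Ioo 0 T, HasDerivAt u (v t) t
  deriv_v : ∀ t ∈ Ioo 0 T, HasDerivAt v (a t) t
  deriv_a : ∀ t ∈ Ioo 0 T, HasDerivAt a (j t) t
  eqn : ∀ t ∈ Ioo 0 T,
    a t + P.κ • fracLap (P.α / 2) (u t) + P.γ₁ • fracLap (P.α / 2) (v t) + P.γ₂ • v t + P.dF (u t) = 0
  init_u : u 0 = φ₀
  init_v : v 0 = φ₁

/-- The regularity assumption on the solution, uniformly on `(0, T)` with the bound `L`;
`r(t) = √E(u(t))` is of class `C³` on `(0, T)`. -/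
structure RegularityBound (P : Model) (T m L : ℝ) (φ₀ : L2per ℓ₁ ℓ₂)
    (u v a j : ℝ → L2per ℓ₁ ℓ₂) : Prop where
  smooth_r : ContDiffOn ℝ 3 (fun t => P.sav (u t)) (Ioo 0 T)
  mem_init : MemH m φ₀
  mem_u : ∀ t ∈ Ioo 0 T, MemH m (u t)
  mem_v : ∀ t ∈ Ioo 0 T, MemH m (v t)
  mem_a : ∀ t ∈ Ioo 0 T, MemH P.α (a t)
  mem_j : ∀ t ∈ Ioo 0 T, MemH (P.α / 2) (j t)
  bound : ∀ t ∈ Ioo 0 T,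
    hNorm m φ₀ + hNorm m (u t)
      + |P.sav (u t)| + |iteratedDeriv 1 (fun s => P.sav (u s)) t|
      + |iteratedDeriv 2 (fun s => P.sav (u s)) t| + |iteratedDeriv 3 (fun s => P.sav (u s)) t|
      + hNorm m (v t) + hNorm P.α (u t) + hNorm P.α (v t) + hNorm P.α (a t) + hNorm (P.α / 2) (j t)
      ≤ L

/-- The unknowns of the time-discrete scheme: `Uⁿ, Vⁿ, Rⁿ` and the half-step predictors. -/
structure Discrete (ℓ₁ ℓ₂ : ℝ) [Fact (0 < ℓ₁)] [Fact (0 < ℓ₂)] where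
  /-- `Uⁿ` -/
  U : ℕ → L2per ℓ₁ ℓ₂
  /-- `Vⁿ` -/
  V : ℕ → L2per ℓ₁ ℓ₂
  /-- `Rⁿ` -/
  R : ℕ → ℝ
  /-- the predictor of `U` at time `τ/2` -/
  Uh : L2per ℓ₁ ℓ₂
  /-- the predictor of `V` at time `τ/2` -/
  Vh : L2per ℓ₁ ℓ₂
  /-- the predictor of `R` at time `τ/2` -/
  Rh : ℝ

/-- `Ũ^{n+1/2}`: the predictor for `n = 0`, the extrapolation `(3 Uⁿ - Uⁿ⁻¹) / 2` for `n ≥ 1`. -/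
def Discrete.Ut (S : Discrete ℓ₁ ℓ₂) (n : ℕ) : L2per ℓ₁ ℓ₂ :=
  if n = 0 then S.Uh else (1 / 2 : ℝ) • ((3 : ℝ) • S.U n - S.U (n - 1))

/-- The time-discrete SAV scheme with step `τ` and `K` steps; only the values with `n ≤ K` matter. -/
structure IsScheme (P : Model) (φ₀ φ₁ : L2per ℓ₁ ℓ₂) (τ : ℝ) (K : ℕ) (S : Discrete ℓ₁ ℓ₂) :
    Prop where
  mem_U : ∀ n ≤ K, MemH P.α (S.U n)
  mem_V : ∀ n ≤ K, MemH P.α (S.V n)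
  mem_Uh : MemH P.α S.Uh
  mem_Vh : MemH P.α S.Vh
  init_U : S.U 0 = φ₀
  init_V : S.V 0 = φ₁
  init_R : S.R 0 = P.sav φ₀
  half_U : (1 / (τ / 2)) • (S.Uh - S.U 0) = S.Vh
  half_V : (1 / (τ / 2)) • (S.Vh - S.V 0) + P.κ • fracLap (P.α / 2) S.Uh
    + P.γ₁ • fracLap (P.α / 2) S.Vh + P.γ₂ • S.Vh + S.Rh • P.b (S.U 0) = 0
  half_R : (S.Rh - S.R 0) / (τ / 2)
    = 1 / (2 * √(P.E (S.U 0))) * inner ℝ (P.dF (S.U 0)) ((1 / (τ / 2)) • (S.Uh - S.U 0))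
  step_U : ∀ n < K, (1 / τ) • (S.U (n + 1) - S.U n) = (1 / 2 : ℝ) • (S.V (n + 1) + S.V n)
  step_V : ∀ n < K, (1 / τ) • (S.V (n + 1) - S.V n)
    + P.κ • fracLap (P.α / 2) ((1 / 2 : ℝ) • (S.U (n + 1) + S.U n))
    + P.γ₁ • fracLap (P.α / 2) ((1 / 2 : ℝ) • (S.V (n + 1) + S.V n))
    + P.γ₂ • ((1 / 2 : ℝ) • (S.V (n + 1) + S.V n))
    + ((S.R (n + 1) + S.R n) / 2) • P.b (S.Ut n) = 0
  step_R : ∀ n < K, (S.R (n + 1) - S.R n) / τ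
    = 1 / (2 * √(P.E (S.Ut n))) * inner ℝ (P.dF (S.Ut n)) ((1 / τ) • (S.U (n + 1) - S.U n))

/-- Two families of unknowns coincide for all `n ≤ K`. -/
def Discrete.Agree (K : ℕ) (S S' : Discrete ℓ₁ ℓ₂) : Prop :=
  (∀ n ≤ K, S.U n = S'.U n ∧ S.V n = S'.V n ∧ S.R n = S'.R n) ∧
    S.Uh = S'.Uh ∧ S.Vh = S'.Vh ∧ S.Rh = S'.Rh

end SAVWave

end

set_option linter.unusedSectionVars false
set_option linter.unusedVariables false

noncomputable section

namespace SAVWave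

open Filter Topology

/-! ### Fourier analysis on the torus -/

section

/-! Everything happens on the Fourier side, with `mu` = |ξ_k|^α and `rho` = (1 + |ξ_k|²)^(α/2), so
that `rho` is the weight of H^{α/2} and `rho2` that of H^α. The error is measured by `err`, the sum
over k of rho ((1 + κ mu)|e_u|² + |e_v|²), plus e_r². It controls e_u in H^α and e_v in H^{α/2}.
Since α > 1 in dimension two, H^α embeds in L^∞, so as long as `err` is small only the values of F
on a fixed compact interval matter.

Solvability: a Crank–Nicolson step of length τ is an implicit Euler step of length τ/2 for the mean
velocity, followed by a reflection. Once the extrapolated direction b is frozen the step is linear.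
Inverting a diagonal operator with symbol at least 1 leaves one scalar equation whose coefficient is
1 plus a nonnegative multiple of (b, A⁻¹b), hence positive (`existsUnique_step`). No smallness of τ
is needed.

Consistency: write σ = √τ. Both truncation errors are O(σ³), `defectU` in H^α and `defectV` in
H^{α/2}, and this is the origin of the rate τ³ for the squared error. They are second order only in
weaker norms: `defectU` in H^{α/2}, because u_ttt lies there, and `defectV` in L². Splitting at the
frequency where σ² rho = 1 costs one factor σ⁻¹ below, while above it the H^{7α/2} bounds supply
spare powers of σ. The high frequencies of F'(u) are read off from the equation itself, and those of
u_tt from a difference quotient of v over a time σ³. In `defectV` the term γ₁(-Δ)^{α/2}v is replaced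
by a difference quotient of u, because v + γ₁(-Δ)^{α/2}u has a time derivative which the equation
expresses without any (-Δ)^{α/2} acting on v. What is left over is γ₁(-Δ)^{α/2} applied to
`defectU`, which the damping absorbs.

Stability: testing mode by mode with the means of the errors makes the stiff cross terms cancel
(`modal_energy_step`). For α ≤ 2 the H^{α/2} norm is dominated by the H¹ norm, so F'(w)/√E(w) is
Lipschitz from H^α to H^{α/2} near the exact trajectory (`exists_b_bound`). Together these give the
one-step inequality `exists_step_bound`.

Closing: that inequality requires the extrapolated state to be close to u in H^α, which follows from
smallness of the two previous errors. A two-step discrete Gronwall argument with bootstrap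
(`exists_gronwall_bootstrap`) propagates the smallness. The first predictor is only O(τ) accurate in
H^α, but its square enters multiplied by τ and so contributes τ³. -/

theorem side_pos (ℓ : ℝ) [h : Fact (0 < ℓ)] : 0 < ℓ := h.out

variable {ℓ₁ ℓ₂ : ℝ} [Fact (0 < ℓ₁)] [Fact (0 < ℓ₂)]

/-- The exponential monomial with frequency `k` on the torus. -/
def expMode (ℓ₁ ℓ₂ : ℝ) (k : ℤ × ℤ) : C(Torus ℓ₁ ℓ₂, ℂ) where
  toFun x := fourier k.1 x.1 * fourier k.2 x.2
  continuous_toFun := by fun_prop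

theorem expMode_apply (k : ℤ × ℤ) (x : Torus ℓ₁ ℓ₂) :
    expMode ℓ₁ ℓ₂ k x = fourier k.1 x.1 * fourier k.2 x.2 := rfl

theorem expMode_neg (k : ℤ × ℤ) (x : Torus ℓ₁ ℓ₂) :
    expMode ℓ₁ ℓ₂ (-k) x = starRingEnd ℂ (expMode ℓ₁ ℓ₂ k x) := by
  simp only [expMode_apply, Prod.fst_neg, Prod.snd_neg, fourier_neg, map_mul]

theorem expMode_add (k l : ℤ × ℤ) (x : Torus ℓ₁ ℓ₂) :
    expMode ℓ₁ ℓ₂ (k + l) x = expMode ℓ₁ ℓ₂ k x * expMode ℓ₁ ℓ₂ l x := by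
  simp only [expMode_apply, Prod.fst_add, Prod.snd_add, fourier_add]; ring

theorem norm_expMode_apply (k : ℤ × ℤ) (x : Torus ℓ₁ ℓ₂) : ‖expMode ℓ₁ ℓ₂ k x‖ = 1 := by
  simp only [expMode_apply, norm_mul, fourier_apply, Circle.norm_coe, mul_one]

theorem norm_expMode_le (k : ℤ × ℤ) : ‖expMode ℓ₁ ℓ₂ k‖ ≤ 1 :=
  (ContinuousMap.norm_le _ zero_le_one).2 fun x => (norm_expMode_apply k x).le


theorem area_pos (ℓ₁ ℓ₂ : ℝ) [Fact (0 < ℓ₁)] [Fact (0 < ℓ₂)] : 0 < ℓ₁ * ℓ₂ :=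
  mul_pos (side_pos ℓ₁) (side_pos ℓ₂)

theorem integral_fourier (ℓ : ℝ) [Fact (0 < ℓ)] (n : ℤ) :
    ∫ x : AddCircle ℓ, fourier n x = if n = 0 then (ℓ : ℂ) else 0 := by
  rw [AddCircle.volume_eq_smul_haarAddCircle, integral_smul_measure,
    ENNReal.toReal_ofReal (side_pos ℓ).le]
  have h := fourierCoeff_fourier (T := ℓ) n
  have h2 := congrFun h 0
  simp only [fourierCoeff, neg_zero, fourier_zero, one_smul] at h2
  rw [h2]
  by_cases hn : n = 0
  · simp [hn]
  · rw [Pi.single_eq_of_ne (fun h => hn h.symm)]; simp [hn]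

theorem integral_expMode (k : ℤ × ℤ) :
    ∫ x : Torus ℓ₁ ℓ₂, expMode ℓ₁ ℓ₂ k x = if k = 0 then ((ℓ₁ * ℓ₂ : ℝ) : ℂ) else 0 := by
  have : ∫ x : Torus ℓ₁ ℓ₂, expMode ℓ₁ ℓ₂ k x
      = (∫ x : AddCircle ℓ₁, fourier k.1 x) * ∫ x : AddCircle ℓ₂, fourier k.2 x :=
    integral_prod_mul _ _
  rw [this, integral_fourier, integral_fourier]
  by_cases h1 : k.1 = 0 <;> by_cases h2 : k.2 = 0 <;> simp [h1, h2, Prod.ext_iff]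

/-- The star subalgebra of continuous functions generated by the exponential monomials. -/
def expSubalgebra (ℓ₁ ℓ₂ : ℝ) [Fact (0 < ℓ₁)] [Fact (0 < ℓ₂)] :
    StarSubalgebra ℂ C(Torus ℓ₁ ℓ₂, ℂ) where
  toSubalgebra := Algebra.adjoin ℂ (range (expMode ℓ₁ ℓ₂))
  star_mem' := by
    change Algebra.adjoin ℂ (range (expMode ℓ₁ ℓ₂)) ≤ star (Algebra.adjoin ℂ (range (expMode ℓ₁ ℓ₂)))
    refine Algebra.adjoin_le ?_
    rintro _ ⟨n, rfl⟩
    refine Algebra.subset_adjoin ⟨-n, ?_⟩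
    ext1 x
    simp only [expMode_neg, starRingEnd_apply, ContinuousMap.star_apply]

theorem expSubalgebra_coe :
    (expSubalgebra ℓ₁ ℓ₂).toSubalgebra.toSubmodule = Submodule.span ℂ (range (expMode ℓ₁ ℓ₂)) := by
  apply Algebra.adjoin_eq_span_of_subset
  refine .trans (fun x ↦ Submonoid.closure_induction (fun _ ↦ id) ⟨0, ?_⟩ ?_) Submodule.subset_span
  · ext z
    simp [expMode_apply]
  · rintro _ _ _ _ ⟨m, rfl⟩ ⟨n, rfl⟩
    exact ⟨m + n, by ext z; simp [expMode_add]⟩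

theorem expSubalgebra_separatesPoints : (expSubalgebra ℓ₁ ℓ₂).SeparatesPoints := by
  intro x y hxy
  have hc : x.1 ≠ y.1 ∨ x.2 ≠ y.2 := by
    by_contra! h
    exact hxy (Prod.ext h.1 h.2)
  have key : ∀ k, expMode ℓ₁ ℓ₂ k x ≠ expMode ℓ₁ ℓ₂ k y →
      ∃ f ∈ (fun f : C(Torus ℓ₁ ℓ₂, ℂ) => (f : Torus ℓ₁ ℓ₂ → ℂ)) ''
        ((expSubalgebra ℓ₁ ℓ₂).toSubalgebra : Set _), f x ≠ f y :=
    fun k hk => ⟨_, ⟨expMode ℓ₁ ℓ₂ k, Algebra.subset_adjoin ⟨k, rfl⟩, rfl⟩, hk⟩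
  rcases hc with h | h
  · refine key (1, 0) ?_
    simp only [expMode_apply, fourier_zero, mul_one, fourier_one, Ne]
    exact fun h' => h (AddCircle.injective_toCircle (side_pos ℓ₁).ne' (Circle.ext h'))
  · refine key (0, 1) ?_
    simp only [expMode_apply, fourier_zero, one_mul, fourier_one, Ne]
    exact fun h' => h (AddCircle.injective_toCircle (side_pos ℓ₂).ne' (Circle.ext h'))

theorem span_expMode_closure_eq_top :
    (Submodule.span ℂ (range (expMode ℓ₁ ℓ₂))).topologicalClosure = ⊤ := by
  rw [← expSubalgebra_coe]
  exact congr_arg (Subalgebra.toSubmodule <| StarSubalgebra.toSubalgebra ·)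
    (ContinuousMap.starSubalgebra_topologicalClosure_eq_top_of_separatesPoints _
      expSubalgebra_separatesPoints)

/-- The complex Hilbert space of square integrable functions on the torus. -/
abbrev L2C (ℓ₁ ℓ₂ : ℝ) [Fact (0 < ℓ₁)] [Fact (0 < ℓ₂)] := Lp ℂ 2 (volume : Measure (Torus ℓ₁ ℓ₂))

/-- The exponential monomials as elements of `L²`. -/
def expLp (ℓ₁ ℓ₂ : ℝ) [Fact (0 < ℓ₁)] [Fact (0 < ℓ₂)] (k : ℤ × ℤ) : L2C ℓ₁ ℓ₂ :=
  ContinuousMap.toLp (E := ℂ) 2 volume ℂ (expMode ℓ₁ ℓ₂ k)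

theorem coeFn_expLp (k : ℤ × ℤ) : expLp ℓ₁ ℓ₂ k =ᵐ[volume] expMode ℓ₁ ℓ₂ k :=
  ContinuousMap.coeFn_toLp volume _

theorem inner_expLp (k l : ℤ × ℤ) :
    inner ℂ (expLp ℓ₁ ℓ₂ k) (expLp ℓ₁ ℓ₂ l) = if k = l then ((ℓ₁ * ℓ₂ : ℝ) : ℂ) else 0 := by
  have h : ∀ x, expMode ℓ₁ ℓ₂ l x * starRingEnd ℂ (expMode ℓ₁ ℓ₂ k x) = expMode ℓ₁ ℓ₂ (l - k) x := by
    intro x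
    rw [← expMode_neg, ← expMode_add, sub_eq_add_neg]
  rw [expLp, expLp, ContinuousMap.inner_toLp]
  simp only [h, integral_expMode, sub_eq_zero, eq_comm]

/-- The normalised exponential monomials. -/
def expUnit (ℓ₁ ℓ₂ : ℝ) [Fact (0 < ℓ₁)] [Fact (0 < ℓ₂)] (k : ℤ × ℤ) : L2C ℓ₁ ℓ₂ :=
  ((√(ℓ₁ * ℓ₂) : ℝ) : ℂ)⁻¹ • expLp ℓ₁ ℓ₂ k

theorem sqrt_area_ne : ((√(ℓ₁ * ℓ₂) : ℝ) : ℂ) ≠ 0 := by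
  exact_mod_cast (Real.sqrt_pos.2 (area_pos ℓ₁ ℓ₂)).ne'

theorem sqrt_area_mul_self : ((√(ℓ₁ * ℓ₂) : ℝ) : ℂ) * ((√(ℓ₁ * ℓ₂) : ℝ) : ℂ) = ((ℓ₁ * ℓ₂ : ℝ) : ℂ) := by
  rw [← Complex.ofReal_mul, Real.mul_self_sqrt (area_pos ℓ₁ ℓ₂).le]

theorem orthonormal_expUnit : Orthonormal ℂ (expUnit ℓ₁ ℓ₂) := by
  rw [orthonormal_iff_ite]
  intro k l
  have := sqrt_area_ne (ℓ₁ := ℓ₁) (ℓ₂ := ℓ₂)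
  rw [expUnit, expUnit, inner_smul_left, inner_smul_right, inner_expLp]
  split_ifs
  · rw [← sqrt_area_mul_self, map_inv₀, Complex.conj_ofReal]
    field_simp
  · simp

theorem span_expUnit : ⊤ ≤ (Submodule.span ℂ (range (expUnit ℓ₁ ℓ₂))).topologicalClosure := by
  have h1 : (Submodule.span ℂ (range (expLp ℓ₁ ℓ₂))).topologicalClosure = ⊤ := by
    have := (ContinuousMap.toLp_denseRange ℂ (volume : Measure (Torus ℓ₁ ℓ₂)) ℂ
      (p := 2) (by simp)).topologicalClosure_map_submodule span_expMode_closure_eq_top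
    simpa only [Submodule.map_span, ContinuousLinearMap.coe_coe, ← range_comp, Function.comp_def]
      using! this
  rw [← h1]
  refine Submodule.topologicalClosure_mono (Submodule.span_le.2 ?_)
  rintro _ ⟨k, rfl⟩
  have : expLp ℓ₁ ℓ₂ k = ((√(ℓ₁ * ℓ₂) : ℝ) : ℂ) • expUnit ℓ₁ ℓ₂ k := by
    rw [expUnit, smul_smul, mul_inv_cancel₀ sqrt_area_ne, one_smul]
  rw [this]
  exact Submodule.smul_mem _ _ (Submodule.subset_span ⟨k, rfl⟩)

/-- The Fourier basis of the complex `L²` space of the torus. -/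
def expBasis (ℓ₁ ℓ₂ : ℝ) [Fact (0 < ℓ₁)] [Fact (0 < ℓ₂)] : HilbertBasis (ℤ × ℤ) ℂ (L2C ℓ₁ ℓ₂) :=
  HilbertBasis.mk orthonormal_expUnit span_expUnit

theorem coe_expBasis : ⇑(expBasis ℓ₁ ℓ₂) = expUnit ℓ₁ ℓ₂ := HilbertBasis.coe_mk _ _

/-- A real square integrable function regarded as a complex one. -/
def complexify (ℓ₁ ℓ₂ : ℝ) [Fact (0 < ℓ₁)] [Fact (0 < ℓ₂)] : L2per ℓ₁ ℓ₂ →L[ℝ] L2C ℓ₁ ℓ₂ :=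
  Complex.ofRealCLM.compLpL 2 volume

theorem coeFn_complexify (w : L2per ℓ₁ ℓ₂) :
    complexify ℓ₁ ℓ₂ w =ᵐ[volume] fun x => ((w x : ℝ) : ℂ) :=
  ContinuousLinearMap.coeFn_compLpL Complex.ofRealCLM w

theorem norm_complexify (w : L2per ℓ₁ ℓ₂) : ‖complexify ℓ₁ ℓ₂ w‖ = ‖w‖ := by
  rw [Lp.norm_def, Lp.norm_def]
  congr 1
  refine eLpNorm_congr_norm_ae ?_
  filter_upwards [coeFn_complexify w] with x hx
  rw [hx, Complex.norm_real]

theorem fcoeff_eq_inner (w : L2per ℓ₁ ℓ₂) (k : ℤ × ℤ) :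
    fcoeff w k = ((ℓ₁ * ℓ₂ : ℝ) : ℂ)⁻¹ * inner ℂ (expLp ℓ₁ ℓ₂ k) (complexify ℓ₁ ℓ₂ w) := by
  rw [fcoeff, MeasureTheory.L2.inner_def]
  congr 1
  refine integral_congr_ae ?_
  filter_upwards [coeFn_complexify w, coeFn_expLp (ℓ₁ := ℓ₁) (ℓ₂ := ℓ₂) k] with x h1 h2
  rw [h1, h2, RCLike.inner_apply, ← expMode_neg]
  rfl

theorem expBasis_repr (w : L2per ℓ₁ ℓ₂) (k : ℤ × ℤ) :
    (expBasis ℓ₁ ℓ₂).repr (complexify ℓ₁ ℓ₂ w) k = ((√(ℓ₁ * ℓ₂) : ℝ) : ℂ) * fcoeff w k := by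
  rw [HilbertBasis.repr_apply_apply, coe_expBasis, expUnit, inner_smul_left, fcoeff_eq_inner,
    ← sqrt_area_mul_self, map_inv₀, Complex.conj_ofReal]
  have := sqrt_area_ne (ℓ₁ := ℓ₁) (ℓ₂ := ℓ₂)
  field_simp

/-- The Fourier coefficient as a continuous linear functional. -/
def fcoeffL (ℓ₁ ℓ₂ : ℝ) [Fact (0 < ℓ₁)] [Fact (0 < ℓ₂)] (k : ℤ × ℤ) : L2per ℓ₁ ℓ₂ →L[ℝ] ℂ :=
  ((((ℓ₁ * ℓ₂ : ℝ) : ℂ)⁻¹ • innerSL ℂ (expLp ℓ₁ ℓ₂ k)).restrictScalars ℝ).comp (complexify ℓ₁ ℓ₂)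

theorem fcoeffL_apply (w : L2per ℓ₁ ℓ₂) (k : ℤ × ℤ) : fcoeffL ℓ₁ ℓ₂ k w = fcoeff w k := by
  rw [fcoeff_eq_inner]; rfl

theorem fcoeff_add (w z : L2per ℓ₁ ℓ₂) : fcoeff (w + z) = fcoeff w + fcoeff z := by
  ext k; simp only [Pi.add_apply, ← fcoeffL_apply, map_add]

theorem fcoeff_sub (w z : L2per ℓ₁ ℓ₂) : fcoeff (w - z) = fcoeff w - fcoeff z := by
  ext k; simp only [Pi.sub_apply, ← fcoeffL_apply, map_sub]

theorem fcoeff_smul (c : ℝ) (w : L2per ℓ₁ ℓ₂) : fcoeff (c • w) = c • fcoeff w := by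
  ext k; simp only [Pi.smul_apply, ← fcoeffL_apply, map_smul]

theorem fcoeff_zero : fcoeff (0 : L2per ℓ₁ ℓ₂) = 0 := by
  ext k; simp only [Pi.zero_apply, ← fcoeffL_apply, map_zero]

/-- Parseval's identity. -/
theorem hasSum_norm_fcoeff_sq (w : L2per ℓ₁ ℓ₂) :
    HasSum (fun k => ‖fcoeff w k‖ ^ 2) (‖w‖ ^ 2 / (ℓ₁ * ℓ₂)) := by
  have h := lp.hasSum_norm (p := 2) (by norm_num) ((expBasis ℓ₁ ℓ₂).repr (complexify ℓ₁ ℓ₂ w))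
  simp only [LinearIsometryEquiv.norm_map, norm_complexify, expBasis_repr, norm_mul,
    Complex.norm_real, Real.norm_eq_abs, abs_of_nonneg (Real.sqrt_nonneg _)] at h
  norm_num at h
  have h2 := h.div_const (ℓ₁ * ℓ₂)
  refine h2.congr_fun fun k => ?_
  rw [mul_pow, Real.sq_sqrt (area_pos ℓ₁ ℓ₂).le, mul_div_cancel_left₀ _ (area_pos ℓ₁ ℓ₂).ne']

theorem fcoeff_injective : Function.Injective (fcoeff (ℓ₁ := ℓ₁) (ℓ₂ := ℓ₂)) := by
  intro w z h
  have h1 := hasSum_norm_fcoeff_sq (w - z)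
  rw [fcoeff_sub, h, sub_self] at h1
  simp only [Pi.zero_apply, norm_zero, ne_eq, OfNat.ofNat_ne_zero, not_false_eq_true, zero_pow] at h1
  have h2 := h1.unique hasSum_zero
  rw [div_eq_zero_iff] at h2
  rcases h2 with h2 | h2
  · exact sub_eq_zero.1 (norm_eq_zero.1 (pow_eq_zero_iff (two_ne_zero)|>.1 h2))
  · exact absurd h2 (area_pos ℓ₁ ℓ₂).ne'

theorem fcoeff_neg_freq (w : L2per ℓ₁ ℓ₂) (k : ℤ × ℤ) :
    fcoeff w (-k) = starRingEnd ℂ (fcoeff w k) := by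
  rw [fcoeff, fcoeff, map_mul, map_inv₀, Complex.conj_ofReal, ← integral_conj]
  congr 2
  ext x
  simp only [map_mul, Complex.conj_ofReal, Prod.fst_neg, Prod.snd_neg, fourier_neg]

/-- The Hilbert basis yields a complex function z with coefficients c. By the symmetry of c the
conjugate of z has the same coefficients, hence so does the real part. -/
theorem fcoeff_surjective (c : ℤ × ℤ → ℂ) (hc : ∀ k, c (-k) = starRingEnd ℂ (c k))
    (hs : Summable fun k => ‖c k‖ ^ 2) : ∃ w : L2per ℓ₁ ℓ₂, fcoeff w = c := by
  have hmem : Memℓp (fun k => ((√(ℓ₁ * ℓ₂) : ℝ) : ℂ) * c k) 2 := by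
    refine memℓp_gen ?_
    norm_num
    simp only [mul_pow]
    exact hs.mul_left _
  obtain ⟨z, hz⟩ := (expBasis ℓ₁ ℓ₂).repr.surjective ⟨_, hmem⟩
  have hzk : ∀ k, inner ℂ (expLp ℓ₁ ℓ₂ k) z = ((ℓ₁ * ℓ₂ : ℝ) : ℂ) * c k := by
    intro k
    have h1 : (expBasis ℓ₁ ℓ₂).repr z k = ((√(ℓ₁ * ℓ₂) : ℝ) : ℂ) * c k := by rw [hz]
    rw [HilbertBasis.repr_apply_apply, coe_expBasis, expUnit, inner_smul_left, map_inv₀,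
      Complex.conj_ofReal] at h1
    have := sqrt_area_ne (ℓ₁ := ℓ₁) (ℓ₂ := ℓ₂)
    rw [inv_mul_eq_iff_eq_mul₀ this] at h1
    rw [h1, ← mul_assoc, sqrt_area_mul_self]
  set w : L2per ℓ₁ ℓ₂ := Complex.reCLM.compLpL 2 volume z with hw
  refine ⟨w, funext fun k => ?_⟩
  have hwx : w =ᵐ[volume] fun x => (z x).re := ContinuousLinearMap.coeFn_compLpL Complex.reCLM z
  have hin : ∀ k, ∫ x, z x * expMode ℓ₁ ℓ₂ (-k) x = ((ℓ₁ * ℓ₂ : ℝ) : ℂ) * c k := by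
    intro k
    rw [← hzk k, MeasureTheory.L2.inner_def]
    refine integral_congr_ae ?_
    filter_upwards [coeFn_expLp (ℓ₁ := ℓ₁) (ℓ₂ := ℓ₂) k] with x h2
    rw [h2, RCLike.inner_apply, ← expMode_neg]
  have hint : ∀ k, Integrable (fun x => z x * expMode ℓ₁ ℓ₂ (-k) x) := by
    intro k
    have := MeasureTheory.L2.integrable_inner (𝕜 := ℂ) (expLp ℓ₁ ℓ₂ k) z
    refine this.congr ?_
    filter_upwards [coeFn_expLp (ℓ₁ := ℓ₁) (ℓ₂ := ℓ₂) k] with x h2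
    rw [h2, RCLike.inner_apply, ← expMode_neg]
  have hint' : Integrable (fun x => starRingEnd ℂ (z x) * expMode ℓ₁ ℓ₂ (-k) x) := by
    have h1 := (hint (-k))
    have h2 := (Complex.conjLIE.toContinuousLinearEquiv.toContinuousLinearMap).integrable_comp h1
    refine h2.congr (Filter.Eventually.of_forall fun x => ?_)
    change starRingEnd ℂ (z x * expMode ℓ₁ ℓ₂ (- -k) x) = _
    rw [map_mul, ← expMode_neg, neg_neg]
  have hconj : ∫ x, starRingEnd ℂ (z x) * expMode ℓ₁ ℓ₂ (-k) x = ((ℓ₁ * ℓ₂ : ℝ) : ℂ) * c k := by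
    have h1 := congrArg (starRingEnd ℂ) (hin (-k))
    rw [map_mul, Complex.conj_ofReal, hc, Complex.conj_conj, ← integral_conj] at h1
    rw [← h1]
    congr 1
    ext x
    rw [map_mul, ← expMode_neg, neg_neg]
  have harea : ((ℓ₁ * ℓ₂ : ℝ) : ℂ) ≠ 0 := by exact_mod_cast (area_pos ℓ₁ ℓ₂).ne'
  rw [fcoeff, inv_mul_eq_iff_eq_mul₀ harea]
  have h3 : ∫ x : Torus ℓ₁ ℓ₂, (w x : ℂ) * (fourier (-k.1) x.1 * fourier (-k.2) x.2)
      = ∫ x, (1 / 2 : ℂ) * (z x * expMode ℓ₁ ℓ₂ (-k) x + starRingEnd ℂ (z x) * expMode ℓ₁ ℓ₂ (-k) x) := by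
    refine integral_congr_ae ?_
    filter_upwards [hwx] with x hx
    rw [hx, ← add_mul, Complex.add_conj]
    change _ * expMode ℓ₁ ℓ₂ (-k) x = _
    push_cast
    ring
  rw [h3, integral_const_mul, integral_add (hint k) hint', hin, hconj]
  ring

/-- The Fourier series converges absolutely to a continuous function, which agrees with w almost
everywhere because the L² sum is unique. -/
theorem ae_abs_le_of_summable (w : L2per ℓ₁ ℓ₂) (hs : Summable fun k => ‖fcoeff w k‖) :
    ∀ᵐ x, |w x| ≤ ∑' k, ‖fcoeff w k‖ := by
  have h1 : HasSum (fun k => fcoeff w k • expLp ℓ₁ ℓ₂ k) (complexify ℓ₁ ℓ₂ w) := by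
    have h := (expBasis ℓ₁ ℓ₂).hasSum_repr (complexify ℓ₁ ℓ₂ w)
    convert h using 2 with k
    rw [expBasis_repr, coe_expBasis, expUnit, smul_smul, mul_right_comm, mul_inv_cancel₀ sqrt_area_ne,
      one_mul]
  have hbd : ∀ k, ‖fcoeff w k • expMode ℓ₁ ℓ₂ k‖ ≤ ‖fcoeff w k‖ := fun k => by
    rw [norm_smul]; exact mul_le_of_le_one_right (norm_nonneg _) (norm_expMode_le k)
  have hsum : Summable fun k => fcoeff w k • expMode ℓ₁ ℓ₂ k := Summable.of_norm_bounded hs hbd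
  set g : C(Torus ℓ₁ ℓ₂, ℂ) := ∑' k, fcoeff w k • expMode ℓ₁ ℓ₂ k with hg
  have h2 : HasSum (fun k => fcoeff w k • expLp ℓ₁ ℓ₂ k)
      (ContinuousMap.toLp (E := ℂ) 2 volume ℂ g) := by
    have := (ContinuousMap.toLp (E := ℂ) 2 (volume : Measure (Torus ℓ₁ ℓ₂)) ℂ).hasSum hsum.hasSum
    simpa only [map_smul] using! this
  have h3 := h1.unique h2
  have hgn : ‖g‖ ≤ ∑' k, ‖fcoeff w k‖ := tsum_of_norm_bounded hs.hasSum hbd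
  filter_upwards [coeFn_complexify w, ContinuousMap.coeFn_toLp (p := 2) (𝕜 := ℂ) volume g] with x hx1 hx2
  rw [h3, hx2] at hx1
  calc |w x| = ‖g x‖ := by rw [hx1, Complex.norm_real, Real.norm_eq_abs]
    _ ≤ ‖g‖ := g.norm_coe_le_norm x
    _ ≤ _ := hgn

instance torus_isAddRightInvariant : (volume : Measure (Torus ℓ₁ ℓ₂)).IsAddRightInvariant :=
  inferInstanceAs ((volume : Measure (AddCircle ℓ₁)).prod
    (volume : Measure (AddCircle ℓ₂))).IsAddRightInvariant

/-- Translation of a square integrable function. -/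
def translate (h : Torus ℓ₁ ℓ₂) (w : L2per ℓ₁ ℓ₂) : L2per ℓ₁ ℓ₂ :=
  Lp.compMeasurePreserving (fun x => x + h) (measurePreserving_add_right volume h) w

theorem coeFn_translate (h : Torus ℓ₁ ℓ₂) (w : L2per ℓ₁ ℓ₂) :
    translate h w =ᵐ[volume] fun x => w (x + h) :=
  Lp.coeFn_compMeasurePreserving w (measurePreserving_add_right volume h)

theorem fcoeff_translate (h : Torus ℓ₁ ℓ₂) (w : L2per ℓ₁ ℓ₂) (k : ℤ × ℤ) :
    fcoeff (translate h w) k = expMode ℓ₁ ℓ₂ k h * fcoeff w k := by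
  have h1 : ∫ x : Torus ℓ₁ ℓ₂, (translate h w x : ℂ) * (fourier (-k.1) x.1 * fourier (-k.2) x.2)
      = ∫ x : Torus ℓ₁ ℓ₂, expMode ℓ₁ ℓ₂ k h * ((w (x + h) : ℂ) * expMode ℓ₁ ℓ₂ (-k) (x + h)) := by
    refine integral_congr_ae ?_
    filter_upwards [coeFn_translate h w] with x hx
    have h2 : expMode ℓ₁ ℓ₂ (-k) (x + h) = expMode ℓ₁ ℓ₂ (-k) x * expMode ℓ₁ ℓ₂ (-k) h := by
      simp only [expMode_apply, fourier_apply, Prod.fst_add, Prod.snd_add, smul_add,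
        AddCircle.toCircle_add, Circle.coe_mul]
      ring
    have h3 : expMode ℓ₁ ℓ₂ k h * expMode ℓ₁ ℓ₂ (-k) h = 1 := by
      rw [← expMode_add]; simp [expMode_apply]
    rw [hx, h2]
    change _ * expMode ℓ₁ ℓ₂ (-k) x = _
    linear_combination (-(w (x + h) : ℂ) * expMode ℓ₁ ℓ₂ (-k) x) * h3
  rw [fcoeff, h1, integral_const_mul,
    integral_add_right_eq_self (fun x => (w x : ℂ) * expMode ℓ₁ ℓ₂ (-k) x) h, fcoeff]
  simp only [expMode_apply, Prod.fst_neg, Prod.snd_neg]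
  ring

end

/-! ### Mean value and Taylor inequalities on an open interval -/

section

section Taylor

variable {F : Type*} [NormedAddCommGroup F] [NormedSpace ℝ F]

/-- No derivative is available at the endpoints. The mean value inequality holds on [x, b] for
interior x, and continuity allows x → a. -/
theorem norm_sub_le_of_deriv_Ioo {f f' : ℝ → F} {a b C : ℝ} (hab : a ≤ b)
    (hc : ContinuousOn f (Icc a b)) (hd : ∀ t ∈ Ioo a b, HasDerivAt f (f' t) t)
    (hb : ∀ t ∈ Ioo a b, ‖f' t‖ ≤ C) : ‖f b - f a‖ ≤ C * (b - a) := by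
  rcases hab.eq_or_lt with rfl | hlt
  · simp
  have key : ∀ x ∈ Ioo a b, ‖f b - f x‖ ≤ C * (b - x) := by
    intro x hx
    refine norm_image_sub_le_of_norm_deriv_right_le_segment (f' := f')
      (hc.mono (Icc_subset_Icc hx.1.le le_rfl)) (fun t ht => ?_) (fun t ht => ?_) b
      (right_mem_Icc.2 hx.2.le)
    · exact (hd t ⟨hx.1.trans_le ht.1, ht.2⟩).hasDerivWithinAt
    · exact hb t ⟨hx.1.trans_le ht.1, ht.2⟩
  have hcl : a ∈ closure (Ioo a b) := by rw [closure_Ioo hlt.ne]; exact left_mem_Icc.2 hab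
  have : (𝓝[Ioo a b] a).NeBot := mem_closure_iff_nhdsWithin_neBot.1 hcl
  have h1 : Tendsto f (𝓝[Ioo a b] a) (𝓝 (f a)) :=
    (hc a (left_mem_Icc.2 hab)).mono_left (nhdsWithin_mono _ Ioo_subset_Icc_self)
  have h2 : Tendsto (fun x : ℝ => C * (b - x)) (𝓝[Ioo a b] a) (𝓝 (C * (b - a))) :=
    ((by fun_prop : Continuous fun x : ℝ => C * (b - x)).tendsto a).mono_left nhdsWithin_le_nhds
  exact le_of_tendsto_of_tendsto (tendsto_const_nhds.sub h1).norm h2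
    (eventually_nhdsWithin_of_forall key)

/-- Two applications of the mean value inequality, without the sharp factor 1/2. The base point t is
interior, but x may be an endpoint, where f' need not exist. -/
theorem norm_taylor_one_le {f f' f'' : ℝ → F} {a b C t x : ℝ} (hc : ContinuousOn f (Icc a b))
    (hd : ∀ t ∈ Ioo a b, HasDerivAt f (f' t) t) (hd' : ∀ t ∈ Ioo a b, HasDerivAt f' (f'' t) t)
    (hb : ∀ t ∈ Ioo a b, ‖f'' t‖ ≤ C) (ht : t ∈ Ioo a b) (hx : x ∈ Icc a b) :
    ‖f x - f t - (x - t) • f' t‖ ≤ C * (x - t) ^ 2 := by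
  have hC : 0 ≤ C := (norm_nonneg _).trans (hb t ht)
  have hf' : ∀ y ∈ Ioo a b, ‖f' y - f' t‖ ≤ C * |y - t| := by
    intro y hy
    have hsub : ∀ p q, p ∈ Ioo a b → q ∈ Ioo a b → p ≤ q → ‖f' q - f' p‖ ≤ C * (q - p) := by
      intro p q hp hq hpq
      refine norm_sub_le_of_deriv_Ioo (f' := f'') hpq (fun z hz => ?_) (fun z hz => ?_) (fun z hz => ?_)
      · exact (hd' z ⟨hp.1.trans_le hz.1, hz.2.trans_lt hq.2⟩).continuousAt.continuousWithinAt
      · exact hd' z ⟨hp.1.trans hz.1, hz.2.trans hq.2⟩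
      · exact hb z ⟨hp.1.trans hz.1, hz.2.trans hq.2⟩
    rcases le_total t y with h | h
    · rw [abs_of_nonneg (sub_nonneg.2 h)]; exact hsub t y ht hy h
    · rw [abs_of_nonpos (sub_nonpos.2 h), norm_sub_rev, neg_sub]; exact hsub y t hy ht h
  have hcg : ContinuousOn (fun y => f y - y • f' t) (Icc a b) :=
    hc.sub (by fun_prop)
  have hdg : ∀ y ∈ Ioo a b, HasDerivAt (fun y => f y - y • f' t) (f' y - f' t) y := by
    intro y hy
    simpa using (hd y hy).fun_sub ((hasDerivAt_id y).smul_const (f' t))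
  have hseg : ∀ p q, a ≤ p → q ≤ b → p ≤ q → (∀ z ∈ Ioo p q, |z - t| ≤ |x - t|) →
      ‖(f q - q • f' t) - (f p - p • f' t)‖ ≤ C * |x - t| * (q - p) := by
    intro p q hp hq hpq hz
    refine norm_sub_le_of_deriv_Ioo (f' := fun y => f' y - f' t) hpq (hcg.mono (Icc_subset_Icc hp hq)) (fun z hz' => ?_)
      (fun z hz' => ?_)
    · exact hdg z ⟨hp.trans_lt hz'.1, hz'.2.trans_le hq⟩
    · exact (hf' z ⟨hp.trans_lt hz'.1, hz'.2.trans_le hq⟩).trans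
        (mul_le_mul_of_nonneg_left (hz z hz') hC)
  have e : f x - f t - (x - t) • f' t = (f x - x • f' t) - (f t - t • f' t) := by
    rw [sub_smul]; abel
  rw [e]
  rcases le_total t x with h | h
  · refine (hseg t x ht.1.le hx.2 h fun z hz => ?_).trans_eq ?_
    · rw [abs_of_nonneg (by linarith [hz.1]), abs_of_nonneg (by linarith)]; linarith [hz.2]
    · rw [abs_of_nonneg (by linarith)]; ring
  · rw [norm_sub_rev]
    refine (hseg x t hx.1 ht.2.le h fun z hz => ?_).trans_eq ?_
    · rw [abs_of_nonpos (by linarith [hz.2]), abs_of_nonpos (by linarith)]; linarith [hz.1]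
    · rw [abs_of_nonpos (by linarith)]; ring

theorem norm_second_diff_le {f f' f'' : ℝ → F} {a b C c h : ℝ} (hc : ContinuousOn f (Icc a b))
    (hd : ∀ t ∈ Ioo a b, HasDerivAt f (f' t) t) (hd' : ∀ t ∈ Ioo a b, HasDerivAt f' (f'' t) t)
    (hb : ∀ t ∈ Ioo a b, ‖f'' t‖ ≤ C) (hcm : c ∈ Ioo a b) (h1 : c + h ∈ Icc a b)
    (h2 : c - h ∈ Icc a b) :
    ‖f (c + h) + f (c - h) - (2 : ℝ) • f c‖ ≤ 2 * C * h ^ 2 := by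
  have e1 := norm_taylor_one_le hc hd hd' hb hcm h1
  have e2 := norm_taylor_one_le hc hd hd' hb hcm h2
  have e : f (c + h) + f (c - h) - (2 : ℝ) • f c = (f (c + h) - f c - (c + h - c) • f' c)
      + (f (c - h) - f c - (c - h - c) • f' c) := by
    module
  rw [e]
  refine (norm_add_le _ _).trans ((add_le_add e1 e2).trans_eq ?_)
  ring

/-- The derivative in s of f(c+s) − f(c−s) − 2s f'(c) is a second difference of f'. Second order
consistency thus needs only that second difference, which can be bounded where f''' is not
available. -/
theorem norm_symm_diff_le {f f' : ℝ → F} {a b D c h : ℝ} (hh : 0 ≤ h) (h1 : c + h ≤ b)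
    (h2 : a ≤ c - h) (hc : ContinuousOn f (Icc a b)) (hd : ∀ t ∈ Ioo a b, HasDerivAt f (f' t) t)
    (hb : ∀ s ∈ Ioo 0 h, ‖f' (c + s) + f' (c - s) - (2 : ℝ) • f' c‖ ≤ D) :
    ‖f (c + h) - f (c - h) - (2 * h) • f' c‖ ≤ D * h := by
  have key := norm_sub_le_of_deriv_Ioo (f := fun s => f (c + s) - f (c - s) - (2 * s) • f' c)
    (f' := fun s => f' (c + s) + f' (c - s) - (2 : ℝ) • f' c) (C := D) hh ?_ ?_ hb
  · simpa using key
  · refine ContinuousOn.sub (ContinuousOn.sub ?_ ?_) (by fun_prop)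
    · exact hc.comp (by fun_prop) fun s hs => ⟨by linarith [hs.1, hs.2], by linarith [hs.2]⟩
    · exact hc.comp (by fun_prop) fun s hs => ⟨by linarith [hs.2], by linarith [hs.1, hs.2]⟩
  · intro s hs
    have d1 : HasDerivAt (fun s => f (c + s)) (f' (c + s)) s := by
      have := HasDerivAt.scomp s (hd (c + s) ⟨by linarith [hs.1, hs.2], by linarith [hs.2]⟩)
        ((hasDerivAt_id s).const_add c)
      simpa [Function.comp_def] using this
    have d2 : HasDerivAt (fun s => f (c - s)) (-f' (c - s)) s := by
      have := HasDerivAt.scomp s (hd (c - s) ⟨by linarith [hs.2], by linarith [hs.1, hs.2]⟩)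
        ((hasDerivAt_id s).const_sub c)
      simpa [Function.comp_def] using this
    have d3 : HasDerivAt (fun s : ℝ => (2 * s) • f' c) ((2 : ℝ) • f' c) s := by
      simpa using ((hasDerivAt_id s).const_mul 2).smul_const (f' c)
    simpa [sub_neg_eq_add] using (d1.fun_sub d2).fun_sub d3

end Taylor

/-! ### Weighted ℓ² bounds tested on finite sets of modes -/

variable {ι : Type*}

/-- The weighted `ℓ²` norm of `c` with weight `ω ≥ 0` is at most `C`. -/
def Bd (ω : ι → ℝ) (c : ι → ℂ) (C : ℝ) : Prop :=
  0 ≤ C ∧ (∀ k, 0 ≤ ω k) ∧ ∀ S : Finset ι, ∑ k ∈ S, ω k * ‖c k‖ ^ 2 ≤ C ^ 2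

/-- Restriction to finitely many modes, scaled by the square root of the weight. -/
def wproj (ω : ι → ℝ) (S : Finset ι) : (ι → ℂ) →ₗ[ℝ] EuclideanSpace ℂ S where
  toFun c := WithLp.toLp 2 fun k : S => √(ω k) • c k
  map_add' c d := by ext k; simp
  map_smul' r c := by ext k; simp [mul_left_comm]

theorem norm_wproj_sq {ω : ι → ℝ} (hω : ∀ k, 0 ≤ ω k) (S : Finset ι) (c : ι → ℂ) :
    ‖wproj ω S c‖ ^ 2 = ∑ k ∈ S, ω k * ‖c k‖ ^ 2 := by
  rw [EuclideanSpace.norm_sq_eq, ← Finset.sum_coe_sort S fun k => ω k * ‖c k‖ ^ 2]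
  refine Finset.sum_congr rfl fun k _ => ?_
  change ‖√(ω k) • c k‖ ^ 2 = _
  rw [norm_smul, mul_pow, Real.norm_eq_abs, sq_abs, Real.sq_sqrt (hω k)]

theorem bd_iff_wproj {ω : ι → ℝ} {c : ι → ℂ} {C : ℝ} (hω : ∀ k, 0 ≤ ω k) :
    Bd ω c C ↔ ∀ S, ‖wproj ω S c‖ ≤ C := by
  constructor
  · rintro ⟨hC, -, h⟩ S
    exact abs_le_of_sq_le_sq' ((norm_wproj_sq hω S c).trans_le (h S)) hC |>.2
  · intro h
    have hC : 0 ≤ C := (norm_nonneg _).trans (h ∅)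
    refine ⟨hC, hω, fun S => ?_⟩
    rw [← norm_wproj_sq hω]
    exact pow_le_pow_left₀ (norm_nonneg _) (h S) 2

theorem Bd.norm_le {ω : ι → ℝ} {c : ι → ℂ} {C : ℝ} (h : Bd ω c C) (S : Finset ι) :
    ‖wproj ω S c‖ ≤ C := (bd_iff_wproj h.2.1).1 h S

theorem Bd.le {ω : ι → ℝ} {c : ι → ℂ} {C D : ℝ} (h : Bd ω c C) (hCD : C ≤ D) : Bd ω c D :=
  (bd_iff_wproj h.2.1).2 fun S => (h.norm_le S).trans hCD

theorem Bd.add {ω : ι → ℝ} {c d : ι → ℂ} {C D : ℝ} (h : Bd ω c C) (h' : Bd ω d D) :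
    Bd ω (c + d) (C + D) :=
  (bd_iff_wproj h.2.1).2 fun S => by
    rw [map_add]; exact (norm_add_le _ _).trans (add_le_add (h.norm_le S) (h'.norm_le S))

theorem Bd.sub {ω : ι → ℝ} {c d : ι → ℂ} {C D : ℝ} (h : Bd ω c C) (h' : Bd ω d D) :
    Bd ω (c - d) (C + D) :=
  (bd_iff_wproj h.2.1).2 fun S => by
    rw [map_sub]; exact (norm_sub_le _ _).trans (add_le_add (h.norm_le S) (h'.norm_le S))

theorem Bd.smul {ω : ι → ℝ} {c : ι → ℂ} {C : ℝ} (r : ℝ) (h : Bd ω c C) :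
    Bd ω (r • c) (|r| * C) :=
  (bd_iff_wproj h.2.1).2 fun S => by
    rw [map_smul, norm_smul]; exact mul_le_mul_of_nonneg_left (h.norm_le S) (norm_nonneg _)

theorem Bd.neg {ω : ι → ℝ} {c : ι → ℂ} {C : ℝ} (h : Bd ω c C) : Bd ω (-c) C :=
  (bd_iff_wproj h.2.1).2 fun S => by rw [map_neg, norm_neg]; exact h.norm_le S

theorem Bd.zero {ω : ι → ℝ} (hω : ∀ k, 0 ≤ ω k) : Bd ω (0 : ι → ℂ) 0 :=
  (bd_iff_wproj hω).2 fun S => by simp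

/-- Comparison of weighted norms of two sequences, mode by mode. -/
theorem Bd.of_le {ω ω' : ι → ℝ} {c c' : ι → ℂ} {C A : ℝ} (h : Bd ω c C) (hA : 0 ≤ A)
    (hω' : ∀ k, 0 ≤ ω' k) (hle : ∀ k, ω' k * ‖c' k‖ ^ 2 ≤ A ^ 2 * (ω k * ‖c k‖ ^ 2)) :
    Bd ω' c' (A * C) := by
  refine ⟨mul_nonneg hA h.1, hω', fun S => ?_⟩
  calc _ ≤ ∑ k ∈ S, A ^ 2 * (ω k * ‖c k‖ ^ 2) := Finset.sum_le_sum fun k _ => hle k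
    _ = A ^ 2 * ∑ k ∈ S, ω k * ‖c k‖ ^ 2 := by rw [Finset.mul_sum]
    _ ≤ A ^ 2 * C ^ 2 := mul_le_mul_of_nonneg_left (h.2.2 S) (sq_nonneg _)
    _ = (A * C) ^ 2 := by ring

theorem Bd.mono_weight {ω ω' : ι → ℝ} {c : ι → ℂ} {C A : ℝ} (h : Bd ω c C) (hA : 0 ≤ A)
    (hω' : ∀ k, 0 ≤ ω' k) (hle : ∀ k, ω' k ≤ A ^ 2 * ω k) : Bd ω' c (A * C) :=
  h.of_le hA hω' fun k => by
    rw [← mul_assoc]; exact mul_le_mul_of_nonneg_right (hle k) (sq_nonneg _)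

theorem Bd.mono {ω ω' : ι → ℝ} {c : ι → ℂ} {C : ℝ} (h : Bd ω c C)
    (hω' : ∀ k, 0 ≤ ω' k) (hle : ∀ k, ω' k ≤ ω k) : Bd ω' c C := by
  simpa using h.mono_weight zero_le_one hω' (by simpa using hle)

/-- The form in which interpolation between Sobolev norms is used: a pointwise comparison of
weights, in which one summand serves the low frequencies and the other the high ones. -/
theorem Bd.interp {ω ω₁ ω₂ : ι → ℝ} {c : ι → ℂ} {C₁ C₂ A B : ℝ} (h₁ : Bd ω₁ c C₁) (h₂ : Bd ω₂ c C₂)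
    (hA : 0 ≤ A) (hB : 0 ≤ B) (hω : ∀ k, 0 ≤ ω k) (hle : ∀ k, ω k ≤ A ^ 2 * ω₁ k + B ^ 2 * ω₂ k) :
    Bd ω c (A * C₁ + B * C₂) := by
  have hA' := mul_nonneg hA h₁.1
  have hB' := mul_nonneg hB h₂.1
  refine ⟨add_nonneg hA' hB', hω, fun S => ?_⟩
  calc _ ≤ ∑ k ∈ S, (A ^ 2 * (ω₁ k * ‖c k‖ ^ 2) + B ^ 2 * (ω₂ k * ‖c k‖ ^ 2)) :=
        Finset.sum_le_sum fun k _ => by nlinarith [hle k, sq_nonneg ‖c k‖]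
    _ = A ^ 2 * (∑ k ∈ S, ω₁ k * ‖c k‖ ^ 2) + B ^ 2 * ∑ k ∈ S, ω₂ k * ‖c k‖ ^ 2 := by
        rw [Finset.sum_add_distrib, Finset.mul_sum, Finset.mul_sum]
    _ ≤ A ^ 2 * C₁ ^ 2 + B ^ 2 * C₂ ^ 2 := by
        gcongr
        · exact h₁.2.2 S
        · exact h₂.2.2 S
    _ ≤ (A * C₁ + B * C₂) ^ 2 := by nlinarith

/-- Only finite sums occur, so convergence of each single mode suffices, as in Fatou's lemma. -/
theorem Bd.of_tendsto {β : Type*} {l : Filter β} [l.NeBot] {ω : ι → ℝ} {f : β → ι → ℂ} {c : ι → ℂ}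
    {C : ℝ} (hf : ∀ k, Tendsto (fun t => f t k) l (𝓝 (c k))) (h : ∀ᶠ t in l, Bd ω (f t) C) :
    Bd ω c C := by
  obtain ⟨t₀, ht₀⟩ := h.exists
  refine ⟨ht₀.1, ht₀.2.1, fun S => ?_⟩
  have : Tendsto (fun t => ∑ k ∈ S, ω k * ‖f t k‖ ^ 2) l (𝓝 (∑ k ∈ S, ω k * ‖c k‖ ^ 2)) :=
    tendsto_finsetSum _ fun k _ => ((hf k).norm.pow 2).const_mul _
  exact le_of_tendsto this (h.mono fun t ht => ht.2.2 S)

theorem Bd.summable {ω : ι → ℝ} {c : ι → ℂ} {C : ℝ} (h : Bd ω c C) :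
    Summable fun k => ω k * ‖c k‖ ^ 2 :=
  summable_of_sum_le (fun k => mul_nonneg (h.2.1 k) (sq_nonneg _)) h.2.2

theorem Bd.tsum_le {ω : ι → ℝ} {c : ι → ℂ} {C : ℝ} (h : Bd ω c C) :
    ∑' k, ω k * ‖c k‖ ^ 2 ≤ C ^ 2 := h.summable.tsum_le_of_sum_le h.2.2

theorem bd_sqrt_tsum {ω : ι → ℝ} {c : ι → ℂ} (hω : ∀ k, 0 ≤ ω k)
    (h : Summable fun k => ω k * ‖c k‖ ^ 2) : Bd ω c (√(∑' k, ω k * ‖c k‖ ^ 2)) := by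
  have h0 : ∀ k, 0 ≤ ω k * ‖c k‖ ^ 2 := fun k => mul_nonneg (hω k) (sq_nonneg _)
  refine ⟨Real.sqrt_nonneg _, hω, fun S => ?_⟩
  rw [Real.sq_sqrt (tsum_nonneg h0)]
  exact h.sum_le_tsum S fun k _ => h0 k

section Calculus

variable {f f' f'' : ℝ → ι → ℂ} {ω : ι → ℝ} {a b C : ℝ}

theorem continuousOn_wproj {s : Set ℝ} (hc : ∀ k, ContinuousOn (fun t => f t k) s) (S : Finset ι) :
    ContinuousOn (fun t => wproj ω S (f t)) s := by
  refine (PiLp.continuous_toLp 2 _).comp_continuousOn (continuousOn_pi.2 fun k => ?_)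
  exact (hc k).const_smul (√(ω k))

theorem hasDerivAt_wproj {t : ℝ} (hd : ∀ k, HasDerivAt (fun t => f t k) (f' t k) t) (S : Finset ι) :
    HasDerivAt (fun t => wproj ω S (f t)) (wproj ω S (f' t)) t := by
  have h1 : HasDerivAt (fun t => fun k : S => √(ω k) • f t k) (fun k : S => √(ω k) • f' t k) t :=
    hasDerivAt_pi.2 fun k => (hd k).fun_const_smul (√(ω k))
  exact ((PiLp.continuousLinearEquiv 2 ℝ fun _ : S => ℂ).symm.toContinuousLinearMap.hasFDerivAt.comp_hasDerivAt
    t h1)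

/-- Each finite projection is a curve in a Euclidean space and satisfies the vector-valued
inequality with a constant independent of the set of modes. Differentiability in the weighted norm
itself is never required. The next three lemmas follow the same pattern. -/
theorem Bd.mvt (hω : ∀ k, 0 ≤ ω k) (hab : a ≤ b) (hc : ∀ k, ContinuousOn (fun t => f t k) (Icc a b))
    (hd : ∀ t ∈ Ioo a b, ∀ k, HasDerivAt (fun t => f t k) (f' t k) t)
    (hb : ∀ t ∈ Ioo a b, Bd ω (f' t) C) : Bd ω (f b - f a) (C * (b - a)) :=
  (bd_iff_wproj hω).2 fun S => by
    rw [map_sub]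
    exact norm_sub_le_of_deriv_Ioo (f := fun t => wproj ω S (f t)) (f' := fun t => wproj ω S (f' t)) hab
      (continuousOn_wproj hc S)
      (fun t ht => hasDerivAt_wproj (hd t ht) S) (fun t ht => (hb t ht).norm_le S)

theorem Bd.taylor_one (hω : ∀ k, 0 ≤ ω k) (hc : ∀ k, ContinuousOn (fun t => f t k) (Icc a b))
    (hd : ∀ t ∈ Ioo a b, ∀ k, HasDerivAt (fun t => f t k) (f' t k) t)
    (hd' : ∀ t ∈ Ioo a b, ∀ k, HasDerivAt (fun t => f' t k) (f'' t k) t)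
    (hb : ∀ t ∈ Ioo a b, Bd ω (f'' t) C) {t x : ℝ} (ht : t ∈ Ioo a b) (hx : x ∈ Icc a b) :
    Bd ω (f x - f t - (x - t) • f' t) (C * (x - t) ^ 2) :=
  (bd_iff_wproj hω).2 fun S => by
    rw [map_sub, map_sub, map_smul]
    exact norm_taylor_one_le (f := fun t => wproj ω S (f t))
      (f' := fun t => wproj ω S (f' t)) (f'' := fun t => wproj ω S (f'' t)) (continuousOn_wproj hc S) (fun t ht => hasDerivAt_wproj (hd t ht) S)
      (fun t ht => hasDerivAt_wproj (hd' t ht) S) (fun t ht => (hb t ht).norm_le S) ht hx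

theorem Bd.second_diff (hω : ∀ k, 0 ≤ ω k) (hc : ∀ k, ContinuousOn (fun t => f t k) (Icc a b))
    (hd : ∀ t ∈ Ioo a b, ∀ k, HasDerivAt (fun t => f t k) (f' t k) t)
    (hd' : ∀ t ∈ Ioo a b, ∀ k, HasDerivAt (fun t => f' t k) (f'' t k) t)
    (hb : ∀ t ∈ Ioo a b, Bd ω (f'' t) C) {c h : ℝ} (hcm : c ∈ Ioo a b) (h1 : c + h ∈ Icc a b)
    (h2 : c - h ∈ Icc a b) :
    Bd ω (f (c + h) + f (c - h) - (2 : ℝ) • f c) (2 * C * h ^ 2) :=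
  (bd_iff_wproj hω).2 fun S => by
    rw [map_sub, map_add, map_smul]
    exact norm_second_diff_le (f := fun t => wproj ω S (f t))
      (f' := fun t => wproj ω S (f' t)) (f'' := fun t => wproj ω S (f'' t)) (continuousOn_wproj hc S) (fun t ht => hasDerivAt_wproj (hd t ht) S)
      (fun t ht => hasDerivAt_wproj (hd' t ht) S) (fun t ht => (hb t ht).norm_le S) hcm h1 h2

theorem Bd.symm_diff (hω : ∀ k, 0 ≤ ω k) {c h D : ℝ} (hh : 0 ≤ h) (h1 : c + h ≤ b)
    (h2 : a ≤ c - h) (hc : ∀ k, ContinuousOn (fun t => f t k) (Icc a b))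
    (hd : ∀ t ∈ Ioo a b, ∀ k, HasDerivAt (fun t => f t k) (f' t k) t)
    (hb : ∀ s ∈ Ioo 0 h, Bd ω (f' (c + s) + f' (c - s) - (2 : ℝ) • f' c) D) :
    Bd ω (f (c + h) - f (c - h) - (2 * h) • f' c) (D * h) :=
  (bd_iff_wproj hω).2 fun S => by
    rw [map_sub, map_sub, map_smul]
    refine norm_symm_diff_le hh h1 h2 (f := fun t => wproj ω S (f t)) (f' := fun t => wproj ω S (f' t))
      (continuousOn_wproj hc S) (fun t ht => hasDerivAt_wproj (hd t ht) S) fun s hs => ?_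
    have := (hb s hs).norm_le S
    rwa [map_sub, map_add, map_smul] at this

end Calculus

end

/-! ### Symbols, the Sobolev embedding and translation differences -/

section

variable {ℓ₁ ℓ₂ : ℝ} [Fact (0 < ℓ₁)] [Fact (0 < ℓ₂)]

/-- The symbol of `(-Δ)^{α/2}`. -/
def mu (ℓ₁ ℓ₂ α : ℝ) (k : ℤ × ℤ) : ℝ := freqSq ℓ₁ ℓ₂ k ^ (α / 2)

/-- The symbol of `(1 - Δ)^{α/2}`; it is the weight of `H^{α/2}`. -/
def rho (ℓ₁ ℓ₂ α : ℝ) (k : ℤ × ℤ) : ℝ := (1 + freqSq ℓ₁ ℓ₂ k) ^ (α / 2)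

theorem freqSq_nonneg (k : ℤ × ℤ) : 0 ≤ freqSq ℓ₁ ℓ₂ k := by unfold freqSq; positivity

theorem mu_nonneg (α : ℝ) (k : ℤ × ℤ) : 0 ≤ mu ℓ₁ ℓ₂ α k := Real.rpow_nonneg (freqSq_nonneg k) _

theorem one_le_rho {α : ℝ} (hα : 1 < α) (k : ℤ × ℤ) : 1 ≤ rho ℓ₁ ℓ₂ α k :=
  Real.one_le_rpow (by linarith [freqSq_nonneg (ℓ₁ := ℓ₁) (ℓ₂ := ℓ₂) k]) (by linarith)

theorem mu_le_rho {α : ℝ} (hα : 1 < α) (k : ℤ × ℤ) : mu ℓ₁ ℓ₂ α k ≤ rho ℓ₁ ℓ₂ α k :=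
  Real.rpow_le_rpow (freqSq_nonneg k) (by linarith) (by linarith)

theorem rho_le_one_add_mu {α : ℝ} (hα : 1 < α) (hα' : α ≤ 2) (k : ℤ × ℤ) :
    rho ℓ₁ ℓ₂ α k ≤ 1 + mu ℓ₁ ℓ₂ α k := by
  have := Real.rpow_add_le_add_rpow zero_le_one (freqSq_nonneg (ℓ₁ := ℓ₁) (ℓ₂ := ℓ₂) k)
    (p := α / 2) (by linarith) (by linarith)
  simpa [rho, mu] using this

theorem rho_le_one_add_freqSq {α : ℝ} (hα' : α ≤ 2) (k : ℤ × ℤ) :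
    rho ℓ₁ ℓ₂ α k ≤ 1 + freqSq ℓ₁ ℓ₂ k := by
  have h := freqSq_nonneg (ℓ₁ := ℓ₁) (ℓ₂ := ℓ₂) k
  calc rho ℓ₁ ℓ₂ α k ≤ (1 + freqSq ℓ₁ ℓ₂ k) ^ (1 : ℝ) :=
        Real.rpow_le_rpow_of_exponent_le (by linarith) (by linarith)
    _ = _ := Real.rpow_one _

theorem rho_pow (α : ℝ) (n : ℕ) (k : ℤ × ℤ) :
    rho ℓ₁ ℓ₂ α k ^ n = (1 + freqSq ℓ₁ ℓ₂ k) ^ (α / 2 * n) := by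
  have h := freqSq_nonneg (ℓ₁ := ℓ₁) (ℓ₂ := ℓ₂) k
  rw [rho, Real.rpow_mul (by linarith), Real.rpow_natCast]

theorem rho_sq (α : ℝ) (k : ℤ × ℤ) : rho ℓ₁ ℓ₂ α k ^ 2 = (1 + freqSq ℓ₁ ℓ₂ k) ^ α := by
  rw [rho_pow]; congr 1; push_cast; ring

theorem freqSq_le_rho_sq {α : ℝ} (hα : 1 < α) (k : ℤ × ℤ) :
    freqSq ℓ₁ ℓ₂ k ≤ rho ℓ₁ ℓ₂ α k ^ 2 := by
  have h := freqSq_nonneg (ℓ₁ := ℓ₁) (ℓ₂ := ℓ₂) k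
  rw [rho_sq]
  calc freqSq ℓ₁ ℓ₂ k ≤ (1 + freqSq ℓ₁ ℓ₂ k) ^ (1 : ℝ) := by rw [Real.rpow_one]; linarith
    _ ≤ _ := Real.rpow_le_rpow_of_exponent_le (by linarith) hα.le

theorem rho_pow_seven_le {α m : ℝ} (hm : 7 * α / 2 ≤ m) (k : ℤ × ℤ) :
    rho ℓ₁ ℓ₂ α k ^ 7 ≤ (1 + freqSq ℓ₁ ℓ₂ k) ^ m := by
  have h := freqSq_nonneg (ℓ₁ := ℓ₁) (ℓ₂ := ℓ₂) k
  rw [rho_pow]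
  exact Real.rpow_le_rpow_of_exponent_le (by linarith) (by push_cast; linarith)

theorem summable_int_rpow {c α : ℝ} (hc : 0 < c) (hα : 1 < α) :
    Summable fun n : ℤ => (1 + (c * n) ^ 2 : ℝ) ^ (-(α / 2)) := by
  have h1 := (Real.summable_abs_int_rpow hα).mul_left (c ^ (-α))
  refine Summable.of_norm_bounded_eventually h1 ?_
  have : ∀ᶠ n : ℤ in cofinite, n ≠ 0 :=
    (Set.finite_singleton (0 : ℤ)).compl_mem_cofinite
  filter_upwards [this] with n hn
  have hn' : 0 < |(n : ℝ)| := by positivity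
  rw [Real.norm_of_nonneg (by positivity), ← Real.mul_rpow hc.le hn'.le]
  calc (1 + (c * n) ^ 2 : ℝ) ^ (-(α / 2)) ≤ ((c * |(n : ℝ)|) ^ 2) ^ (-(α / 2)) := by
        refine Real.rpow_le_rpow_of_nonpos (by positivity) ?_ (by linarith)
        rw [mul_pow, mul_pow, sq_abs]; linarith
    _ = _ := by
        rw [← Real.rpow_natCast, ← Real.rpow_mul (by positivity)]
        congr 1; push_cast; ring

/-- Half of the exponent −α is given to each coordinate, which leaves a product of two
one-dimensional sums with terms of order |n|^{-α}. This is where α > 1 enters. -/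
theorem summable_inv_rho_sq {α : ℝ} (hα : 1 < α) : Summable fun k => (rho ℓ₁ ℓ₂ α k ^ 2)⁻¹ := by
  have hp := Real.pi_pos
  have h1 := summable_int_rpow (c := 2 * Real.pi / ℓ₁) (div_pos (by positivity) (side_pos ℓ₁)) hα
  have h2 := summable_int_rpow (c := 2 * Real.pi / ℓ₂) (div_pos (by positivity) (side_pos ℓ₂)) hα
  have h3 := h1.mul_of_nonneg h2 (fun _ => by positivity) (fun _ => by positivity)
  refine Summable.of_nonneg_of_le (fun k => by positivity) (fun k => ?_) h3
  have hq := freqSq_nonneg (ℓ₁ := ℓ₁) (ℓ₂ := ℓ₂) k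
  have e1 : 2 * Real.pi / ℓ₁ * (k.1 : ℝ) = 2 * Real.pi * k.1 / ℓ₁ := by ring
  have e2 : 2 * Real.pi / ℓ₂ * (k.2 : ℝ) = 2 * Real.pi * k.2 / ℓ₂ := by ring
  rw [rho_sq, ← Real.rpow_neg (by linarith), e1, e2]
  set x := (2 * Real.pi * k.1 / ℓ₁) ^ 2 with hx
  set y := (2 * Real.pi * k.2 / ℓ₂) ^ 2 with hy
  have hx0 : 0 ≤ x := by positivity
  have hy0 : 0 ≤ y := by positivity
  have hq' : freqSq ℓ₁ ℓ₂ k = x + y := rfl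
  have e3 : (1 + freqSq ℓ₁ ℓ₂ k) ^ (-α)
      = (1 + freqSq ℓ₁ ℓ₂ k) ^ (-(α / 2)) * (1 + freqSq ℓ₁ ℓ₂ k) ^ (-(α / 2)) := by
    rw [← Real.rpow_add (by linarith)]; congr 1; ring
  rw [e3, hq']
  refine mul_le_mul ?_ ?_ (by positivity) (by positivity)
  · exact Real.rpow_le_rpow_of_nonpos (by linarith) (by linarith) (by linarith)
  · exact Real.rpow_le_rpow_of_nonpos (by linarith) (by linarith) (by linarith)

/-- The constant of the Sobolev embedding `H^α ⊂ L^∞`. -/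
def sobolevConst (ℓ₁ ℓ₂ α : ℝ) : ℝ := √(∑' k, (rho ℓ₁ ℓ₂ α k ^ 2)⁻¹)

theorem sobolevConst_nonneg (ℓ₁ ℓ₂ α : ℝ) : 0 ≤ sobolevConst ℓ₁ ℓ₂ α := Real.sqrt_nonneg _

/-- Cauchy–Schwarz with the weights rho⁻¹ and rho shows that the Fourier coefficients are absolutely
summable. -/
theorem Bd.ae_abs_le {α M : ℝ} (hα : 1 < α) {w : L2per ℓ₁ ℓ₂}
    (h : Bd (fun k => rho ℓ₁ ℓ₂ α k ^ 2) (fcoeff w) M) :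
    ∀ᵐ x, |w x| ≤ sobolevConst ℓ₁ ℓ₂ α * M := by
  have hr : ∀ k, 0 < rho ℓ₁ ℓ₂ α k := fun k => zero_lt_one.trans_le (one_le_rho hα k)
  have key : ∀ S : Finset (ℤ × ℤ), ∑ k ∈ S, ‖fcoeff w k‖ ≤ sobolevConst ℓ₁ ℓ₂ α * M := by
    intro S
    refine abs_le_of_sq_le_sq' ?_ (mul_nonneg (sobolevConst_nonneg _ _ _) h.1) |>.2
    calc (∑ k ∈ S, ‖fcoeff w k‖) ^ 2
        = (∑ k ∈ S, (rho ℓ₁ ℓ₂ α k)⁻¹ * (rho ℓ₁ ℓ₂ α k * ‖fcoeff w k‖)) ^ 2 := by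
          congr 1
          refine Finset.sum_congr rfl fun k _ => ?_
          rw [inv_mul_cancel_left₀ (hr k).ne']
      _ ≤ (∑ k ∈ S, (rho ℓ₁ ℓ₂ α k)⁻¹ ^ 2) * ∑ k ∈ S, (rho ℓ₁ ℓ₂ α k * ‖fcoeff w k‖) ^ 2 :=
          Finset.sum_mul_sq_le_sq_mul_sq S _ _
      _ ≤ (∑' k, (rho ℓ₁ ℓ₂ α k ^ 2)⁻¹) * M ^ 2 := by
          refine mul_le_mul ?_ ?_ (Finset.sum_nonneg fun _ _ => sq_nonneg _)
            (tsum_nonneg fun k => by positivity)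
          · simp only [inv_pow]
            exact (summable_inv_rho_sq hα).sum_le_tsum S fun k _ => by positivity
          · simp only [mul_pow]; exact h.2.2 S
      _ = (sobolevConst ℓ₁ ℓ₂ α * M) ^ 2 := by
          rw [mul_pow, sobolevConst, Real.sq_sqrt (tsum_nonneg fun k => by positivity)]
  have hs : Summable fun k => ‖fcoeff w k‖ := summable_of_sum_le (fun _ => norm_nonneg _) key
  filter_upwards [ae_abs_le_of_summable w hs] with x hx
  exact hx.trans (hs.tsum_le_of_sum_le key)

theorem Bd.norm_L2_le {w : L2per ℓ₁ ℓ₂} {C : ℝ} (h : Bd (fun _ => 1) (fcoeff w) C) :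
    ‖w‖ ≤ √(ℓ₁ * ℓ₂) * C := by
  refine abs_le_of_sq_le_sq' ?_ (mul_nonneg (Real.sqrt_nonneg _) h.1) |>.2
  have h1 := h.tsum_le
  simp only [one_mul] at h1
  rw [(hasSum_norm_fcoeff_sq w).tsum_eq, div_le_iff₀ (area_pos ℓ₁ ℓ₂)] at h1
  rw [mul_pow, Real.sq_sqrt (area_pos ℓ₁ ℓ₂).le]
  linarith

theorem bd_of_norm_L2_le {w : L2per ℓ₁ ℓ₂} {C : ℝ} (h : ‖w‖ ≤ √(ℓ₁ * ℓ₂) * C) :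
    Bd (fun _ => 1) (fcoeff w) C := by
  have hA := Real.sqrt_pos.2 (area_pos ℓ₁ ℓ₂)
  have hC : 0 ≤ C := by
    by_contra! hC
    exact absurd ((norm_nonneg w).trans h) (not_le.2 (mul_neg_of_pos_of_neg hA hC))
  refine ⟨hC, fun _ => zero_le_one, fun S => ?_⟩
  simp only [one_mul]
  have h1 := sum_le_hasSum S (fun k _ => sq_nonneg ‖fcoeff w k‖) (hasSum_norm_fcoeff_sq w)
  refine h1.trans ?_
  rw [div_le_iff₀ (area_pos ℓ₁ ℓ₂)]
  calc ‖w‖ ^ 2 ≤ (√(ℓ₁ * ℓ₂) * C) ^ 2 := pow_le_pow_left₀ (norm_nonneg _) h 2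
    _ = C ^ 2 * (ℓ₁ * ℓ₂) := by rw [mul_pow, Real.sq_sqrt (area_pos ℓ₁ ℓ₂).le]; ring

theorem norm_le_of_ae_abs_le {g a b : L2per ℓ₁ ℓ₂} {c₁ c₂ : ℝ} (h1 : 0 ≤ c₁) (h2 : 0 ≤ c₂)
    (h : ∀ᵐ x, |g x| ≤ c₁ * |a x| + c₂ * |b x|) : ‖g‖ ≤ c₁ * ‖a‖ + c₂ * ‖b‖ := by
  have h3 : ‖g‖ ≤ ‖c₁ • |a| + c₂ • |b|‖ := by
    refine Lp.norm_le_norm_of_ae_le ?_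
    filter_upwards [h, Lp.coeFn_add (c₁ • |a|) (c₂ • |b|), Lp.coeFn_smul c₁ |a|,
      Lp.coeFn_smul c₂ |b|, Lp.coeFn_abs a, Lp.coeFn_abs b] with x hx e1 e2 e3 e4 e5
    rw [e1, Pi.add_apply, e2, e3, Pi.smul_apply, Pi.smul_apply, e4, e5, smul_eq_mul, smul_eq_mul,
      Real.norm_eq_abs, Real.norm_eq_abs]
    exact hx.trans (le_abs_self _)
  refine h3.trans ((norm_add_le _ _).trans_eq ?_)
  rw [norm_smul, norm_smul, norm_abs_eq_norm, norm_abs_eq_norm, Real.norm_of_nonneg h1,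
    Real.norm_of_nonneg h2]

/-- The point of the torus with coordinates `h • e`. -/
def shift (ℓ₁ ℓ₂ : ℝ) (e : ℝ × ℝ) (h : ℝ) : Torus ℓ₁ ℓ₂ := (((h * e.1 : ℝ) : AddCircle ℓ₁), ((h * e.2 : ℝ) : AddCircle ℓ₂))

/-- The component of the frequency vector in direction `e`. -/
def freqDir (ℓ₁ ℓ₂ : ℝ) (e : ℝ × ℝ) (k : ℤ × ℤ) : ℝ :=
  2 * Real.pi * k.1 / ℓ₁ * e.1 + 2 * Real.pi * k.2 / ℓ₂ * e.2

theorem expMode_shift (e : ℝ × ℝ) (h : ℝ) (k : ℤ × ℤ) :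
    expMode ℓ₁ ℓ₂ k (shift ℓ₁ ℓ₂ e h) = Complex.exp (Complex.I * ((freqDir ℓ₁ ℓ₂ e k * h : ℝ) : ℂ)) := by
  rw [expMode_apply, shift, fourier_coe_apply, fourier_coe_apply, ← Complex.exp_add]
  congr 1
  simp only [freqDir]
  push_cast
  ring

theorem norm_translate_sub_le {e : ℝ × ℝ} {w : L2per ℓ₁ ℓ₂} {C : ℝ}
    (hw : Bd (fun k => freqDir ℓ₁ ℓ₂ e k ^ 2) (fcoeff w) C) (h : ℝ) :
    ‖translate (shift ℓ₁ ℓ₂ e h) w - w‖ ≤ √(ℓ₁ * ℓ₂) * (|h| * C) := by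
  refine Bd.norm_L2_le (hw.of_le (abs_nonneg h) (fun _ => zero_le_one) fun k => ?_)
  rw [fcoeff_sub, Pi.sub_apply, fcoeff_translate, expMode_shift, ← sub_one_mul, norm_mul, mul_pow,
    one_mul, sq_abs, ← mul_assoc]
  refine mul_le_mul_of_nonneg_right ?_ (sq_nonneg _)
  have := Real.norm_exp_I_mul_ofReal_sub_one_le (x := freqDir ℓ₁ ℓ₂ e k * h)
  calc _ ≤ ‖freqDir ℓ₁ ℓ₂ e k * h‖ ^ 2 := pow_le_pow_left₀ (norm_nonneg _) this 2
    _ = _ := by rw [Real.norm_eq_abs, sq_abs]; ring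

/-- The difference quotients are bounded in L², and each mode converges to i(ξ·e)ĝ as the shift
tends to 0, so the bound passes to the limit. -/
theorem bd_freqDir_of_norm_translate_sub_le {e : ℝ × ℝ} {g : L2per ℓ₁ ℓ₂} {C : ℝ}
    (hg : ∀ h : ℝ, ‖translate (shift ℓ₁ ℓ₂ e h) g - g‖ ≤ √(ℓ₁ * ℓ₂) * (|h| * C)) :
    Bd (fun k => freqDir ℓ₁ ℓ₂ e k ^ 2) (fcoeff g) C := by
  have h1 : ∀ h : ℝ, h ≠ 0 →
      Bd (fun _ => 1) (h⁻¹ • fcoeff (translate (shift ℓ₁ ℓ₂ e h) g - g)) C := by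
    intro h hh
    have := (bd_of_norm_L2_le (hg h)).smul h⁻¹
    rwa [abs_inv, inv_mul_cancel_left₀ (abs_pos.2 hh).ne'] at this
  have h2 : Bd (fun _ => 1) (fun k => Complex.I * (freqDir ℓ₁ ℓ₂ e k : ℂ) * fcoeff g k) C := by
    refine Bd.of_tendsto (l := 𝓝[≠] (0 : ℝ))
      (f := fun h => h⁻¹ • fcoeff (translate (shift ℓ₁ ℓ₂ e h) g - g)) (fun k => ?_)
      (eventually_nhdsWithin_of_forall h1)
    have hd : HasDerivAt (fun h : ℝ => Complex.exp (Complex.I * ((freqDir ℓ₁ ℓ₂ e k * h : ℝ) : ℂ)))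
        (Complex.I * (freqDir ℓ₁ ℓ₂ e k : ℂ)) 0 := by
      have h3 : HasDerivAt (fun h : ℝ => ((freqDir ℓ₁ ℓ₂ e k * h : ℝ) : ℂ))
          (freqDir ℓ₁ ℓ₂ e k : ℂ) 0 := by
        simpa using ((hasDerivAt_id (0 : ℝ)).const_mul (freqDir ℓ₁ ℓ₂ e k)).ofReal_comp
      simpa using (h3.const_mul Complex.I).cexp
    have h4 := (hasDerivAt_iff_tendsto_slope_zero.1 hd).mul_const (fcoeff g k)
    refine h4.congr fun h => ?_
    simp only [zero_add, Pi.smul_apply, fcoeff_sub, Pi.sub_apply, fcoeff_translate, expMode_shift,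
      mul_zero, Complex.ofReal_zero, Complex.exp_zero, Complex.real_smul]
    ring
  simpa using h2.of_le zero_le_one (ω' := fun k => freqDir ℓ₁ ℓ₂ e k ^ 2) (c' := fcoeff g)
    (fun k => sq_nonneg _) fun k => by
      rw [norm_mul, norm_mul, Complex.norm_I, Complex.norm_real, mul_pow, mul_pow, Real.norm_eq_abs,
        sq_abs]
      simp

/-- First order Sobolev regularity from a pointwise bound of all translation differences. -/
theorem bd_freqSq_of_translate {g d w : L2per ℓ₁ ℓ₂} {c₁ c₂ D W : ℝ} (h1 : 0 ≤ c₁) (h2 : 0 ≤ c₂)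
    (hD : Bd (freqSq ℓ₁ ℓ₂) (fcoeff d) D) (hW : Bd (freqSq ℓ₁ ℓ₂) (fcoeff w) W)
    (h : ∀ y : Torus ℓ₁ ℓ₂, ∀ᵐ x, |g (x + y) - g x| ≤ c₁ * |d (x + y) - d x| + c₂ * |w (x + y) - w x|) :
    Bd (freqSq ℓ₁ ℓ₂) (fcoeff g) (2 * (c₁ * D + c₂ * W)) := by
  have hdiff : ∀ y, ∀ z : L2per ℓ₁ ℓ₂,
      (translate y z - z : L2per ℓ₁ ℓ₂) =ᵐ[volume] fun x => z (x + y) - z x := by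
    intro y z
    filter_upwards [Lp.coeFn_sub (translate y z) z, coeFn_translate y z] with x e1 e2
    rw [e1, Pi.sub_apply, e2]
  have hn : ∀ y, ‖translate y g - g‖ ≤ c₁ * ‖translate y d - d‖ + c₂ * ‖translate y w - w‖ := by
    intro y
    refine norm_le_of_ae_abs_le h1 h2 ?_
    filter_upwards [h y, hdiff y g, hdiff y d, hdiff y w] with x hx e1 e2 e3
    rw [e1, e2, e3]; exact hx
  have hdir : ∀ e : ℝ × ℝ, (∀ k, freqDir ℓ₁ ℓ₂ e k ^ 2 ≤ freqSq ℓ₁ ℓ₂ k) →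
      Bd (fun k => freqDir ℓ₁ ℓ₂ e k ^ 2) (fcoeff g) (c₁ * D + c₂ * W) := by
    intro e he
    refine bd_freqDir_of_norm_translate_sub_le fun y => (hn _).trans ?_
    have b1 := norm_translate_sub_le (hD.mono (fun k => sq_nonneg _) he) y
    have b2 := norm_translate_sub_le (hW.mono (fun k => sq_nonneg _) he) y
    calc _ ≤ c₁ * (√(ℓ₁ * ℓ₂) * (|y| * D)) + c₂ * (√(ℓ₁ * ℓ₂) * (|y| * W)) :=
          add_le_add (mul_le_mul_of_nonneg_left b1 h1) (mul_le_mul_of_nonneg_left b2 h2)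
      _ = _ := by ring
  have b1 := hdir (1, 0) fun k => by simp [freqDir, freqSq]; positivity
  have b2 := hdir (0, 1) fun k => by simp [freqDir, freqSq]; positivity
  refine (b1.interp b2 zero_le_one zero_le_one freqSq_nonneg fun k => ?_).le (by linarith)
  simp [freqDir, freqSq]

end

/-! ### Pointwise bounds on the potential and the map w ↦ F'(w) in L² -/

section

variable {ℓ₁ ℓ₂ : ℝ} [Fact (0 < ℓ₁)] [Fact (0 < ℓ₂)]

/-- Lipschitz and Taylor estimates of the potential `F` and of `F'` on `[-B, B]`. -/
structure PotentialBound (F : ℝ → ℝ) (B Λ : ℝ) : Prop where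
  nonneg : 0 ≤ Λ
  abs_deriv : ∀ x ∈ Icc (-B) B, |deriv F x| ≤ Λ
  lip : ∀ x ∈ Icc (-B) B, ∀ y ∈ Icc (-B) B, |deriv F x - deriv F y| ≤ Λ * |x - y|
  taylor : ∀ x ∈ Icc (-B) B, ∀ y ∈ Icc (-B) B, |F y - F x - deriv F x * (y - x)| ≤ Λ * (y - x) ^ 2
  second_diff : ∀ x ∈ Icc (-B) B, ∀ y ∈ Icc (-B) B, ∀ z ∈ Icc (-B) B,
    |deriv F y + deriv F z - 2 * deriv F x| ≤ Λ * (|y + z - 2 * x| + (y - x) ^ 2 + (z - x) ^ 2)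
  mixed : ∀ x ∈ Icc (-B) B, ∀ y ∈ Icc (-B) B, ∀ x' ∈ Icc (-B) B, ∀ y' ∈ Icc (-B) B,
    |(deriv F x' - deriv F y') - (deriv F x - deriv F y)|
      ≤ Λ * |(x' - y') - (x - y)| + Λ * |x - y| * |y' - y|

theorem abs_sub_le_of_abs_deriv_le {g g' : ℝ → ℝ} {s : Set ℝ} {Λ : ℝ} (hs : Convex ℝ s)
    (hg : ∀ x ∈ s, HasDerivAt g (g' x) x) (h : ∀ x ∈ s, |g' x| ≤ Λ) {x y : ℝ} (hx : x ∈ s)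
    (hy : y ∈ s) : |g x - g y| ≤ Λ * |x - y| :=
  hs.norm_image_sub_le_of_norm_hasDerivWithin_le (fun z hz => (hg z hz).hasDerivWithinAt) h hy hx

theorem abs_taylor_le_of_lip {g g' : ℝ → ℝ} {B Λ : ℝ} (hΛ : 0 ≤ Λ)
    (hg : ∀ x, HasDerivAt g (g' x) x)
    (h : ∀ x ∈ Icc (-B) B, ∀ y ∈ Icc (-B) B, |g' x - g' y| ≤ Λ * |x - y|) {x y : ℝ}
    (hx : x ∈ Icc (-B) B) (hy : y ∈ Icc (-B) B) : |g y - g x - g' x * (y - x)| ≤ Λ * (y - x) ^ 2 := by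
  have key := abs_sub_le_of_abs_deriv_le (g := fun z => g z - g' x * z) (g' := fun z => g' z - g' x)
    (s := uIcc x y) (Λ := Λ * |y - x|) (convex_uIcc x y) (fun z _ => ?_) (fun z hz => ?_)
    (right_mem_uIcc) (left_mem_uIcc)
  · rw [mul_assoc, ← sq, sq_abs] at key
    convert key using 2
    ring
  · simpa using (hg z).fun_sub ((hasDerivAt_id z).const_mul (g' x))
  · have hzI : z ∈ Icc (-B) B := (ordConnected_Icc.uIcc_subset hx hy) hz
    refine (h z hzI x hx).trans (mul_le_mul_of_nonneg_left ?_ hΛ)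
    exact abs_sub_left_of_mem_uIcc hz

theorem exists_potentialBound {F : ℝ → ℝ} (hF : ContDiff ℝ 3 F) (B : ℝ) :
    ∃ Λ, PotentialBound F B Λ := by
  have c1 : ContDiff ℝ 2 (deriv F) := hF.iterate_deriv' 2 1
  have c2 : ContDiff ℝ 1 (deriv (deriv F)) := hF.iterate_deriv' 1 2
  have c3 : ContDiff ℝ 0 (deriv (deriv (deriv F))) := hF.iterate_deriv' 0 3
  have d0 : ∀ x, HasDerivAt F (deriv F x) x := fun x => (hF.differentiable (by norm_num) x).hasDerivAt
  have d1 : ∀ x, HasDerivAt (deriv F) (deriv (deriv F) x) x :=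
    fun x => (c1.differentiable (by norm_num) x).hasDerivAt
  have d2 : ∀ x, HasDerivAt (deriv (deriv F)) (deriv (deriv (deriv F)) x) x :=
    fun x => (c2.differentiable (by norm_num) x).hasDerivAt
  -- The mixed estimate evaluates F' at y' + (x − y), which may leave [−B, B] but stays within [−3B,
  -- 3B].
  have hbd : ∀ g : ℝ → ℝ, Continuous g → ∃ Λ, ∀ x ∈ Icc (-(3 * B)) (3 * B), |g x| ≤ Λ :=
    fun g hg => isCompact_Icc.exists_bound_of_continuousOn hg.continuousOn
  obtain ⟨Λ₁, h1⟩ := hbd _ c1.continuous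
  obtain ⟨Λ₂, h2⟩ := hbd _ c2.continuous
  obtain ⟨Λ₃, h3⟩ := hbd _ c3.continuous
  set Λ := |Λ₁| + |Λ₂| + |Λ₃| with hΛ
  have hΛ0 : 0 ≤ Λ := by positivity
  replace h1 : ∀ x ∈ Icc (-(3 * B)) (3 * B), |deriv F x| ≤ Λ := fun x hx =>
    (h1 x hx).trans (by linarith [le_abs_self Λ₁, abs_nonneg Λ₂, abs_nonneg Λ₃])
  replace h2 : ∀ x ∈ Icc (-(3 * B)) (3 * B), |deriv (deriv F) x| ≤ Λ := fun x hx =>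
    (h2 x hx).trans (by linarith [le_abs_self Λ₂, abs_nonneg Λ₁, abs_nonneg Λ₃])
  replace h3 : ∀ x ∈ Icc (-(3 * B)) (3 * B), |deriv (deriv (deriv F)) x| ≤ Λ := fun x hx =>
    (h3 x hx).trans (by linarith [le_abs_self Λ₃, abs_nonneg Λ₂, abs_nonneg Λ₁])
  have hsub : Icc (-B) B ⊆ Icc (-(3 * B)) (3 * B) := fun x hx => by
    have : 0 ≤ B := by linarith [hx.1, hx.2]
    exact ⟨by linarith [hx.1], by linarith [hx.2]⟩
  have l1 : ∀ x ∈ Icc (-(3 * B)) (3 * B), ∀ y ∈ Icc (-(3 * B)) (3 * B),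
      |deriv F x - deriv F y| ≤ Λ * |x - y| := fun x hx y hy =>
    abs_sub_le_of_abs_deriv_le (convex_Icc _ _) (fun z _ => d1 z) h2 hx hy
  have l2 : ∀ x ∈ Icc (-(3 * B)) (3 * B), ∀ y ∈ Icc (-(3 * B)) (3 * B),
      |deriv (deriv F) x - deriv (deriv F) y| ≤ Λ * |x - y| := fun x hx y hy =>
    abs_sub_le_of_abs_deriv_le (convex_Icc _ _) (fun z _ => d2 z) h3 hx hy
  refine ⟨Λ, hΛ0, fun x hx => h1 x (hsub hx), fun x hx y hy => l1 x (hsub hx) y (hsub hy),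
    fun x hx y hy => abs_taylor_le_of_lip hΛ0 d0 l1 (hsub hx) (hsub hy), fun x hx y hy z hz => ?_,
    fun x hx y hy x' hx' y' hy' => ?_⟩
  · have t1 := abs_taylor_le_of_lip hΛ0 d1 l2 (hsub hx) (hsub hy)
    have t2 := abs_taylor_le_of_lip hΛ0 d1 l2 (hsub hx) (hsub hz)
    have t3 : |deriv (deriv F) x * (y + z - 2 * x)| ≤ Λ * |y + z - 2 * x| := by
      rw [abs_mul]; exact mul_le_mul_of_nonneg_right (h2 x (hsub hx)) (abs_nonneg _)
    have e : deriv F y + deriv F z - 2 * deriv F x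
        = (deriv F y - deriv F x - deriv (deriv F) x * (y - x))
          + (deriv F z - deriv F x - deriv (deriv F) x * (z - x))
          + deriv (deriv F) x * (y + z - 2 * x) := by ring
    rw [e]
    refine (abs_add_three _ _ _).trans ?_
    linarith
  · have hxy : y' + (x - y) ∈ Icc (-(3 * B)) (3 * B) :=
      ⟨by linarith [hx.1, hy.2, hy'.1], by linarith [hx.2, hy.1, hy'.2]⟩
    have s1 := l1 x' (hsub hx') _ hxy
    -- For a fixed increment x − y, the increment of F' is a function of its base point with
    -- derivative at most Λ|x − y|.
    have s2 := abs_sub_le_of_abs_deriv_le (g := fun s => deriv F (s + (x - y)) - deriv F s)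
      (g' := fun s => deriv (deriv F) (s + (x - y)) - deriv (deriv F) s) (s := Icc (-B) B)
      (Λ := Λ * |x - y|) (convex_Icc _ _) (fun z _ => ?_) (fun z hz => ?_) hy' hy
    · have e : (deriv F x' - deriv F y') - (deriv F x - deriv F y)
          = (deriv F x' - deriv F (y' + (x - y)))
            + ((deriv F (y' + (x - y)) - deriv F y') - (deriv F (y + (x - y)) - deriv F y)) := by
        rw [add_sub_cancel]; ring
      rw [e]
      refine (abs_add_le _ _).trans (add_le_add (s1.trans_eq ?_) s2)
      congr 2; ring
    · exact ((d1 _).comp_add_const z (x - y)).fun_sub (d1 z)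
    · have := l2 (z + (x - y)) ⟨by linarith [hx.1, hy.2, hz.1], by linarith [hx.2, hy.1, hz.2]⟩ z (hsub hz)
      simpa using this

section Superposition

variable {P : Model}

theorem coeFn_dF (hF : ContDiff ℝ 3 P.F) {w : L2per ℓ₁ ℓ₂} {B : ℝ} (hw : ∀ᵐ x, |w x| ≤ B) :
    P.dF w =ᵐ[volume] fun x => deriv P.F (w x) := by
  have c1 : ContDiff ℝ 2 (deriv P.F) := hF.iterate_deriv' 2 1
  obtain ⟨Λ, hΛ⟩ := exists_potentialBound hF B
  have hm : MemLp (fun x => deriv P.F (w x)) 2 (volume : Measure (Torus ℓ₁ ℓ₂)) := by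
    refine MemLp.of_bound (c1.continuous.comp_aestronglyMeasurable (Lp.aestronglyMeasurable w)) Λ ?_
    filter_upwards [hw] with x hx
    exact hΛ.abs_deriv _ (abs_le.1 hx)
  rw [Model.dF, comp, dif_pos hm]
  exact hm.coeFn_toLp

theorem norm_dF_le (hF : ContDiff ℝ 3 P.F) (B : ℝ) :
    ∃ C, 0 ≤ C ∧ ∀ w : L2per ℓ₁ ℓ₂, (∀ᵐ x, |w x| ≤ B) → ‖P.dF w‖ ≤ C := by
  obtain ⟨Λ, hΛ⟩ := exists_potentialBound hF B
  have hn := hΛ.nonneg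
  refine ⟨_, ?_, fun w hw => Lp.norm_le_of_ae_bound (C := Λ) hn ?_⟩
  · positivity
  · filter_upwards [hw, coeFn_dF hF hw] with x hx e
    rw [e]
    exact hΛ.abs_deriv _ (abs_le.1 hx)

theorem PotentialBound.norm_dF_sub_le {B Λ : ℝ} (hΛ : PotentialBound P.F B Λ) (hF : ContDiff ℝ 3 P.F)
    {w w' : L2per ℓ₁ ℓ₂} (hw : ∀ᵐ x, |w x| ≤ B) (hw' : ∀ᵐ x, |w' x| ≤ B) :
    ‖P.dF w - P.dF w'‖ ≤ Λ * ‖w - w'‖ := by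
  have := norm_le_of_ae_abs_le (g := P.dF w - P.dF w') (a := w - w') (b := 0) hΛ.nonneg le_rfl
    (by
      filter_upwards [hw, hw', coeFn_dF hF hw, coeFn_dF hF hw', Lp.coeFn_sub w w',
        Lp.coeFn_sub (P.dF w) (P.dF w')] with x h1 h2 e1 e2 e3 e4
      rw [e4, e3, Pi.sub_apply, Pi.sub_apply, e1, e2, zero_mul, add_zero]
      exact hΛ.lip _ (abs_le.1 h1) _ (abs_le.1 h2))
  simpa using this

/-- In the quadratic terms one factor is measured in L^∞ by D and the other in L². -/
theorem PotentialBound.norm_second_diff_dF_le {B Λ D : ℝ} (hΛ : PotentialBound P.F B Λ)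
    (hF : ContDiff ℝ 3 P.F) {w y z : L2per ℓ₁ ℓ₂} (hw : ∀ᵐ x, |w x| ≤ B) (hy : ∀ᵐ x, |y x| ≤ B)
    (hz : ∀ᵐ x, |z x| ≤ B) (hD : 0 ≤ D) (hyw : ∀ᵐ x, |(y - w) x| ≤ D) (hzw : ∀ᵐ x, |(z - w) x| ≤ D) :
    ‖P.dF y + P.dF z - (2 : ℝ) • P.dF w‖
      ≤ Λ * ‖y + z - (2 : ℝ) • w‖ + Λ * D * (‖y - w‖ + ‖z - w‖) := by
  have h0 := hΛ.nonneg
  have h1 : ‖P.dF y + P.dF z - (2 : ℝ) • P.dF w‖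
      ≤ Λ * ‖y + z - (2 : ℝ) • w‖ + Λ * D * ‖(|y - w| + |z - w|)‖ := by
    refine norm_le_of_ae_abs_le h0 (by positivity) ?_
    filter_upwards [hw, hy, hz, hyw, hzw, coeFn_dF hF hw, coeFn_dF hF hy, coeFn_dF hF hz,
      Lp.coeFn_sub (P.dF y + P.dF z) ((2 : ℝ) • P.dF w), Lp.coeFn_add (P.dF y) (P.dF z),
      Lp.coeFn_smul (2 : ℝ) (P.dF w), Lp.coeFn_sub (y + z) ((2 : ℝ) • w), Lp.coeFn_add y z,
      Lp.coeFn_smul (2 : ℝ) w, Lp.coeFn_add |y - w| |z - w|, Lp.coeFn_abs (y - w),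
      Lp.coeFn_abs (z - w), Lp.coeFn_sub y w, Lp.coeFn_sub z w]
      with x a1 a2 a3 a4 a5 e1 e2 e3 e4 e5 e6 e7 e8 e9 e10 e11 e12 e13 e14
    rw [e4, Pi.sub_apply, e5, e6, Pi.add_apply, Pi.smul_apply, e1, e2, e3, e7, Pi.sub_apply, e8, e9,
      Pi.add_apply, Pi.smul_apply, e10, Pi.add_apply, e11, e12, smul_eq_mul, smul_eq_mul,
      abs_of_nonneg (by positivity : 0 ≤ |(y - w) x| + |(z - w) x|)]
    have := hΛ.second_diff _ (abs_le.1 a1) _ (abs_le.1 a2) _ (abs_le.1 a3)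
    rw [e13, Pi.sub_apply] at a4 ⊢
    rw [e14, Pi.sub_apply] at a5 ⊢
    have b1 : (y x - w x) ^ 2 ≤ D * |y x - w x| := by
      rw [← sq_abs, sq]; exact mul_le_mul_of_nonneg_right a4 (abs_nonneg _)
    have b2 : (z x - w x) ^ 2 ≤ D * |z x - w x| := by
      rw [← sq_abs, sq]; exact mul_le_mul_of_nonneg_right a5 (abs_nonneg _)
    nlinarith
  refine h1.trans (add_le_add le_rfl (mul_le_mul_of_nonneg_left ?_ (by positivity)))
  refine (norm_add_le _ _).trans ?_
  rw [norm_abs_eq_norm, norm_abs_eq_norm]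

theorem PotentialBound.energy_taylor {B Λ : ℝ} (hΛ : PotentialBound P.F B Λ) (hF : ContDiff ℝ 3 P.F)
    {w y : L2per ℓ₁ ℓ₂} (hw : ∀ᵐ x, |w x| ≤ B) (hy : ∀ᵐ x, |y x| ≤ B) :
    |P.E y - P.E w - inner ℝ (P.dF w) (y - w)| ≤ Λ * ‖y - w‖ ^ 2 := by
  have hint : ∀ z : L2per ℓ₁ ℓ₂, (∀ᵐ x, |z x| ≤ B) → Integrable (fun x => P.F (z x)) := by
    intro z hz
    obtain ⟨c, hc⟩ := isCompact_Icc.exists_bound_of_continuousOn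
      (hF.continuous.continuousOn (s := Icc (-B) B))
    refine Integrable.of_bound
      (hF.continuous.comp_aestronglyMeasurable (Lp.aestronglyMeasurable z)) c ?_
    filter_upwards [hz] with x hx
    exact hc _ (abs_le.1 hx)
  have hi := MeasureTheory.L2.integrable_inner (𝕜 := ℝ) (P.dF w) (y - w)
  have e : P.E y - P.E w - inner ℝ (P.dF w) (y - w)
      = ∫ x, (P.F (y x) - P.F (w x) - inner ℝ (P.dF w x) ((y - w) x)) := by
    rw [integral_sub (f := fun x => P.F (y x) - P.F (w x)) ((hint y hy).sub (hint w hw)) hi,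
      integral_sub (hint y hy) (hint w hw),
      MeasureTheory.L2.inner_def, Model.E, Model.E]
    ring
  have e2 : ‖y - w‖ ^ 2 = ∫ x, ((y - w) x) ^ 2 := by
    rw [← real_inner_self_eq_norm_sq, MeasureTheory.L2.inner_def]
    refine integral_congr_ae (Eventually.of_forall fun x => ?_)
    simp [sq]
  have hi2 : Integrable fun x => ((y - w) x) ^ 2 := (Lp.memLp (y - w)).integrable_sq
  rw [e, e2, ← integral_const_mul, ← Real.norm_eq_abs]
  refine norm_integral_le_of_norm_le (hi2.const_mul _) ?_
  filter_upwards [hw, hy, coeFn_dF hF hw, Lp.coeFn_sub y w] with x h1 h2 e3 e4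
  rw [e3, e4, Pi.sub_apply, Real.norm_eq_abs]
  have := hΛ.taylor _ (abs_le.1 h1) _ (abs_le.1 h2)
  simpa [mul_comm] using this

end Superposition

end

/-! ### Lipschitz bounds of F' and F'/√E from H^α to H^{α/2} -/

section

variable {ℓ₁ ℓ₂ : ℝ} [Fact (0 < ℓ₁)] [Fact (0 < ℓ₂)]

/-- The weight of `H^α`. -/
def rho2 (ℓ₁ ℓ₂ α : ℝ) (k : ℤ × ℤ) : ℝ := rho ℓ₁ ℓ₂ α k ^ 2

theorem rho_nonneg {α : ℝ} (hα : 1 < α) (k : ℤ × ℤ) : 0 ≤ rho ℓ₁ ℓ₂ α k :=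
  zero_le_one.trans (one_le_rho hα k)

theorem rho_le_rho2 {α : ℝ} (hα : 1 < α) (k : ℤ × ℤ) : rho ℓ₁ ℓ₂ α k ≤ rho2 ℓ₁ ℓ₂ α k := by
  have := one_le_rho (ℓ₁ := ℓ₁) (ℓ₂ := ℓ₂) hα k
  rw [rho2]; nlinarith

theorem rho2_nonneg (α : ℝ) (k : ℤ × ℤ) : 0 ≤ rho2 ℓ₁ ℓ₂ α k := sq_nonneg _

theorem Bd.rho_of_rho2 {α C : ℝ} (hα : 1 < α) {c : ℤ × ℤ → ℂ} (h : Bd (rho2 ℓ₁ ℓ₂ α) c C) :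
    Bd (rho ℓ₁ ℓ₂ α) c C := h.mono (rho_nonneg hα) (rho_le_rho2 hα)

theorem Bd.one_of_rho {α C : ℝ} (hα : 1 < α) {c : ℤ × ℤ → ℂ} (h : Bd (rho ℓ₁ ℓ₂ α) c C) :
    Bd (fun _ => 1) c C := h.mono (fun _ => zero_le_one) (one_le_rho hα)

theorem Bd.freqSq_of_rho2 {α C : ℝ} (hα : 1 < α) {c : ℤ × ℤ → ℂ} (h : Bd (rho2 ℓ₁ ℓ₂ α) c C) :
    Bd (freqSq ℓ₁ ℓ₂) c C := h.mono freqSq_nonneg (freqSq_le_rho_sq hα)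

theorem Bd.rho_of_one_of_freqSq {α C D : ℝ} (hα : 1 < α) (hα' : α ≤ 2) {c : ℤ × ℤ → ℂ}
    (h : Bd (fun _ => 1) c C) (h' : Bd (freqSq ℓ₁ ℓ₂) c D) : Bd (rho ℓ₁ ℓ₂ α) c (C + D) := by
  simpa using h.interp h' zero_le_one zero_le_one (rho_nonneg hα)
    fun k => by simpa using rho_le_one_add_freqSq hα' k

theorem ae_translate {p : Torus ℓ₁ ℓ₂ → Prop} (h : ∀ᵐ x, p x) (y : Torus ℓ₁ ℓ₂) :
    ∀ᵐ x, p (x + y) :=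
  (measurePreserving_add_right volume y).quasiMeasurePreserving.ae h

/-- For α ≤ 2 the weight `rho` is at most 1 + |ξ|², so bounds in L² and in the H¹ seminorm suffice.
The latter come from pointwise bounds on translation differences, which replace the chain rule.
Since α > 1, H^α lies in both L^∞ and H¹. -/
theorem exists_dF_bound {P : Model} (hF : ContDiff ℝ 3 P.F) {α : ℝ} (hα : 1 < α) (hα' : α ≤ 2)
    {M : ℝ} (hM : 0 ≤ M) :
    ∃ C, 0 ≤ C ∧ ∀ w : L2per ℓ₁ ℓ₂, Bd (rho2 ℓ₁ ℓ₂ α) (fcoeff w) M →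
      Bd (rho ℓ₁ ℓ₂ α) (fcoeff (P.dF w)) C ∧
      ∀ w' : L2per ℓ₁ ℓ₂, Bd (rho2 ℓ₁ ℓ₂ α) (fcoeff w') M →
        ∀ D, Bd (rho2 ℓ₁ ℓ₂ α) (fcoeff (w - w')) D →
          Bd (rho ℓ₁ ℓ₂ α) (fcoeff (P.dF w - P.dF w')) (C * D) ∧ |P.E w - P.E w'| ≤ C * D := by
  set cS := sobolevConst ℓ₁ ℓ₂ α with hcS
  have hcS0 : 0 ≤ cS := sobolevConst_nonneg _ _ _
  obtain ⟨Λ, hΛ⟩ := exists_potentialBound hF (cS * M)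
  obtain ⟨C₀, hC₀, hdF⟩ := norm_dF_le (ℓ₁ := ℓ₁) (ℓ₂ := ℓ₂) hF (cS * M)
  have hn := hΛ.nonneg
  set A := √(ℓ₁ * ℓ₂) with hA
  have hA0 : 0 < A := Real.sqrt_pos.2 (area_pos ℓ₁ ℓ₂)
  set C₁ := C₀ / A + 2 * (Λ * M + 0 * 0) with hC₁
  set C₂ := Λ + 2 * (Λ + Λ * cS * M) with hC₂
  set C₃ := C₀ * A + Λ * A ^ 2 * (2 * M) with hC₃
  have p1 : 0 ≤ C₁ := by positivity
  have p2 : 0 ≤ C₂ := by positivity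
  have p3 : 0 ≤ C₃ := by positivity
  refine ⟨C₁ + C₂ + C₃, by positivity, fun w hw => ⟨?_, fun w' hw' D hD => ⟨?_, ?_⟩⟩⟩
  · have hwB := hw.ae_abs_le hα
    have b1 : Bd (fun _ => 1) (fcoeff (P.dF w)) (C₀ / A) := by
      refine bd_of_norm_L2_le ((hdF w hwB).trans_eq ?_)
      rw [mul_div_cancel₀ _ hA0.ne']
    have b2 : Bd (freqSq ℓ₁ ℓ₂) (fcoeff (P.dF w)) (2 * (Λ * M + 0 * 0)) := by
      refine bd_freqSq_of_translate hn le_rfl (hw.freqSq_of_rho2 hα)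
        (d := w) (w := 0) (by rw [fcoeff_zero]; exact Bd.zero freqSq_nonneg) fun y => ?_
      filter_upwards [hwB, ae_translate hwB y, coeFn_dF hF hwB, ae_translate (coeFn_dF hF hwB) y]
        with x h1 h2 e1 e2
      rw [e1, e2, zero_mul, add_zero]
      exact hΛ.lip _ (abs_le.1 h2) _ (abs_le.1 h1)
    exact (b1.rho_of_one_of_freqSq hα hα' b2).le (by linarith)
  · have hwB := hw.ae_abs_le hα
    have hwB' := hw'.ae_abs_le hα
    have hDB := hD.ae_abs_le hα
    have b1 : Bd (fun _ => 1) (fcoeff (P.dF w - P.dF w')) (Λ * D) := by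
      refine bd_of_norm_L2_le ((hΛ.norm_dF_sub_le hF hwB hwB').trans ?_)
      have := ((hD.rho_of_rho2 hα).one_of_rho hα).norm_L2_le
      calc _ ≤ Λ * (A * D) := mul_le_mul_of_nonneg_left this hn
        _ = _ := by ring
    -- The mixed estimate produces translation differences of w − w', and those of w' multiplied by
    -- |w − w'|. The last factor is taken in L^∞, where the Sobolev embedding bounds it by cS * D.
    have b2 : Bd (freqSq ℓ₁ ℓ₂) (fcoeff (P.dF w - P.dF w')) (2 * (Λ * D + Λ * (cS * D) * M)) := by
      refine bd_freqSq_of_translate hn (mul_nonneg hn (mul_nonneg hcS0 hD.1))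
        (hD.freqSq_of_rho2 hα) (hw'.freqSq_of_rho2 hα) fun y => ?_
      have eg : ∀ᵐ x, (P.dF w - P.dF w') x = deriv P.F (w x) - deriv P.F (w' x) := by
        filter_upwards [coeFn_dF hF hwB, coeFn_dF hF hwB', Lp.coeFn_sub (P.dF w) (P.dF w')]
          with x e1 e2 e3
        rw [e3, Pi.sub_apply, e1, e2]
      filter_upwards [hwB, ae_translate hwB y, hwB', ae_translate hwB' y, hDB, eg, ae_translate eg y,
        Lp.coeFn_sub w w', ae_translate (Lp.coeFn_sub w w') y] with x h1 h2 h3 h4 h5 e1 e2 e3 e4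
      rw [e3, Pi.sub_apply] at h5
      rw [e1, e2, e3, e4, Pi.sub_apply, Pi.sub_apply]
      refine (hΛ.mixed _ (abs_le.1 h1) _ (abs_le.1 h3) _ (abs_le.1 h2) _ (abs_le.1 h4)).trans ?_
      gcongr
    refine (b1.rho_of_one_of_freqSq hα hα' b2).le ?_
    have : Λ * D + 2 * (Λ * D + Λ * (cS * D) * M) = C₂ * D := by rw [hC₂]; ring
    rw [this]
    exact mul_le_mul_of_nonneg_right (by linarith) hD.1
  · have hwB := hw.ae_abs_le hα
    have hwB' := hw'.ae_abs_le hα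
    have h1 := hΛ.energy_taylor hF hwB' hwB
    have h2 := ((hD.rho_of_rho2 hα).one_of_rho hα).norm_L2_le
    have hsum : ‖w - w'‖ ≤ A * (2 * M) := by
      have := (((hw.sub hw').rho_of_rho2 hα).one_of_rho hα)
      rw [← fcoeff_sub] at this
      exact this.norm_L2_le.trans_eq (by ring)
    have h3 : |inner ℝ (P.dF w') (w - w')| ≤ C₀ * ‖w - w'‖ :=
      (abs_real_inner_le_norm _ _).trans (mul_le_mul_of_nonneg_right (hdF w' hwB') (norm_nonneg _))
    have hD0 := hD.1
    have h4 : |P.E w - P.E w'| ≤ (C₀ + Λ * (A * (2 * M))) * ‖w - w'‖ := by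
      have e : P.E w - P.E w' = (P.E w - P.E w' - inner ℝ (P.dF w') (w - w'))
        + inner ℝ (P.dF w') (w - w') := by ring
      rw [e]
      refine (abs_add_le _ _).trans ((add_le_add h1 h3).trans ?_)
      nlinarith [mul_le_mul_of_nonneg_left hsum (mul_nonneg hn (norm_nonneg (w - w')))]
    refine h4.trans ?_
    calc _ ≤ (C₀ + Λ * (A * (2 * M))) * (A * D) := mul_le_mul_of_nonneg_left h2 (by positivity)
      _ = C₃ * D := by rw [hC₃]; ring
      _ ≤ _ := mul_le_mul_of_nonneg_right (by linarith) hD0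

/-- Membership in the set of admissible states: bounded in `H^α`, with energy bounded from below. -/
structure Admissible (P : Model) (M c₀ : ℝ) (w : L2per ℓ₁ ℓ₂) : Prop where
  bd : Bd (rho2 ℓ₁ ℓ₂ P.α) (fcoeff w) M
  energy : c₀ ≤ P.E w

theorem abs_inv_sqrt_sub_le {x y c : ℝ} (hc : 0 < c) (hx : c ≤ x) (hy : c ≤ y) :
    |1 / √x - 1 / √y| ≤ (1 / (c * √c)) * |x - y| := by
  have hsc := Real.sqrt_pos.2 hc
  have hsx : √c ≤ √x := Real.sqrt_le_sqrt hx
  have hsy : √c ≤ √y := Real.sqrt_le_sqrt hy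
  have hx0 : 0 < √x := hsc.trans_le hsx
  have hy0 : 0 < √y := hsc.trans_le hsy
  have ex := Real.sq_sqrt (hc.le.trans hx)
  have ey := Real.sq_sqrt (hc.le.trans hy)
  have ec := Real.sq_sqrt hc.le
  have e : 1 / √x - 1 / √y = (y - x) / (√x * √y * (√x + √y)) := by
    rw [← ex, ← ey, Real.sqrt_sq hx0.le, Real.sqrt_sq hy0.le]
    field_simp
    ring
  rw [e, abs_div, abs_sub_comm, abs_of_pos (by positivity : 0 < √x * √y * (√x + √y)), div_eq_mul_inv,
    mul_comm, ← one_div]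
  refine mul_le_mul_of_nonneg_right (one_div_le_one_div_of_le (by positivity) ?_) (abs_nonneg _)
  calc c * √c = √c * √c * √c := by rw [Real.mul_self_sqrt hc.le]
    _ ≤ √x * √y * (√x + √y) := by
      refine mul_le_mul (mul_le_mul hsx hsy hsc.le hx0.le) (by linarith) hsc.le (by positivity)

/-- The lower bound c₀ on the energy keeps 1/√E bounded and Lipschitz. The rest is the product rule
for differences. -/
theorem exists_b_bound {P : Model} (hF : ContDiff ℝ 3 P.F) (hα : 1 < P.α) (hα' : P.α ≤ 2)
    {M c₀ : ℝ} (hM : 0 ≤ M) (hc₀ : 0 < c₀) :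
    ∃ C, 0 ≤ C ∧ ∀ w : L2per ℓ₁ ℓ₂, Admissible P M c₀ w →
      Bd (rho ℓ₁ ℓ₂ P.α) (fcoeff (P.b w)) C ∧
      ∀ w' : L2per ℓ₁ ℓ₂, Admissible P M c₀ w' →
        ∀ D, Bd (rho2 ℓ₁ ℓ₂ P.α) (fcoeff (w - w')) D →
          Bd (rho ℓ₁ ℓ₂ P.α) (fcoeff (P.b w - P.b w')) (C * D) := by
  obtain ⟨C, hC, h⟩ := exists_dF_bound (ℓ₁ := ℓ₁) (ℓ₂ := ℓ₂) hF hα hα' hM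
  have hs := Real.sqrt_pos.2 hc₀
  have hinv : ∀ w : L2per ℓ₁ ℓ₂, Admissible P M c₀ w → |1 / √(P.E w)| ≤ 1 / √c₀ := fun w hw => by
    rw [abs_of_nonneg (by positivity)]
    exact one_div_le_one_div_of_le hs (Real.sqrt_le_sqrt hw.energy)
  set C' := 1 / √c₀ * C + 1 / (c₀ * √c₀) * C * C with hC'
  have q1 : 0 ≤ 1 / √c₀ * C := by positivity
  have q2 : 0 ≤ 1 / (c₀ * √c₀) * C * C := by positivity
  refine ⟨C', by positivity, fun w hw => ⟨?_, fun w' hw' D hD => ?_⟩⟩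
  · rw [Model.b, fcoeff_smul]
    refine ((h w hw.bd).1.smul _).le ?_
    calc _ ≤ 1 / √c₀ * C := mul_le_mul_of_nonneg_right (hinv w hw) hC
      _ ≤ _ := by linarith
  · obtain ⟨h1, h2⟩ := (h w hw.bd).2 w' hw'.bd D hD
    have e : P.b w - P.b w' = (1 / √(P.E w)) • (P.dF w - P.dF w')
        + (1 / √(P.E w) - 1 / √(P.E w')) • P.dF w' := by
      simp only [Model.b]; module
    rw [e, fcoeff_add, fcoeff_smul, fcoeff_smul]
    refine ((h1.smul _).add ((h w' hw'.bd).1.smul _)).le ?_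
    have h3 := abs_inv_sqrt_sub_le hc₀ hw.energy hw'.energy
    have hD0 := hD.1
    calc _ ≤ 1 / √c₀ * (C * D) + (1 / (c₀ * √c₀) * (C * D)) * C := by
          refine add_le_add (mul_le_mul_of_nonneg_right (hinv w hw) (by positivity))
            (mul_le_mul_of_nonneg_right (h3.trans (mul_le_mul_of_nonneg_left h2 (by positivity))) hC)
      _ = C' * D := by rw [hC']; ring

end

/-! ### Unique solvability of one implicit step -/

section

variable {ℓ₁ ℓ₂ : ℝ} [Fact (0 < ℓ₁)] [Fact (0 < ℓ₂)]

theorem memH_iff {α : ℝ} {w : L2per ℓ₁ ℓ₂} :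
    MemH α w ↔ Summable fun k => rho2 ℓ₁ ℓ₂ α k * ‖fcoeff w k‖ ^ 2 := by
  simp only [MemH, rho2, rho_sq]

theorem Bd.memH {α C : ℝ} {w : L2per ℓ₁ ℓ₂} (h : Bd (rho2 ℓ₁ ℓ₂ α) (fcoeff w) C) : MemH α w :=
  memH_iff.2 h.summable

theorem MemH.exists_bd {α : ℝ} {w : L2per ℓ₁ ℓ₂} (h : MemH α w) :
    ∃ C, Bd (rho2 ℓ₁ ℓ₂ α) (fcoeff w) C :=
  ⟨_, bd_sqrt_tsum (rho2_nonneg α) (memH_iff.1 h)⟩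

theorem MemH.add {α : ℝ} {w z : L2per ℓ₁ ℓ₂} (hw : MemH α w) (hz : MemH α z) : MemH α (w + z) := by
  obtain ⟨C, hC⟩ := hw.exists_bd
  obtain ⟨D, hD⟩ := hz.exists_bd
  exact Bd.memH (C := C + D) (by rw [fcoeff_add]; exact hC.add hD)

theorem MemH.sub {α : ℝ} {w z : L2per ℓ₁ ℓ₂} (hw : MemH α w) (hz : MemH α z) : MemH α (w - z) := by
  obtain ⟨C, hC⟩ := hw.exists_bd
  obtain ⟨D, hD⟩ := hz.exists_bd
  exact Bd.memH (C := C + D) (by rw [fcoeff_sub]; exact hC.sub hD)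

theorem MemH.smul {α : ℝ} {w : L2per ℓ₁ ℓ₂} (c : ℝ) (hw : MemH α w) : MemH α (c • w) := by
  obtain ⟨C, hC⟩ := hw.exists_bd
  exact Bd.memH (C := |c| * C) (by rw [fcoeff_smul]; exact hC.smul c)

theorem freqSq_neg (k : ℤ × ℤ) : freqSq ℓ₁ ℓ₂ (-k) = freqSq ℓ₁ ℓ₂ k := by
  simp only [freqSq, Prod.fst_neg, Prod.snd_neg, Int.cast_neg]; ring

theorem mu_neg (α : ℝ) (k : ℤ × ℤ) : mu ℓ₁ ℓ₂ α (-k) = mu ℓ₁ ℓ₂ α k := by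
  rw [mu, mu, freqSq_neg]

theorem fcoeff_fracLap {α : ℝ} (hα : 1 < α) {w : L2per ℓ₁ ℓ₂} (hw : MemH α w) (k : ℤ × ℤ) :
    fcoeff (fracLap (α / 2) w) k = (mu ℓ₁ ℓ₂ α k : ℂ) * fcoeff w k := by
  have hex : ∃ z, IsFracLap (α / 2) w z := by
    obtain ⟨z, hz⟩ := fcoeff_surjective (ℓ₁ := ℓ₁) (ℓ₂ := ℓ₂) (fun k => (mu ℓ₁ ℓ₂ α k : ℂ) * fcoeff w k)
      (fun k => by rw [mu_neg, fcoeff_neg_freq, map_mul, Complex.conj_ofReal])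
      (by
        refine Summable.of_nonneg_of_le (fun k => sq_nonneg _) (fun k => ?_) (memH_iff.1 hw)
        rw [norm_mul, mul_pow, Complex.norm_real, Real.norm_of_nonneg (mu_nonneg _ _)]
        exact mul_le_mul_of_nonneg_right
          (pow_le_pow_left₀ (mu_nonneg _ _) (mu_le_rho hα k) 2) (sq_nonneg _))
    exact ⟨z, fun k => congrFun hz k⟩
  rw [fracLap, dif_pos hex]
  exact hex.choose_spec k

/-- By polarization it suffices that ‖w − z‖ ≤ ‖w + z‖, and Parseval reduces this to (1 − d)² ≤ (1 +
d)² in each mode. -/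
theorem inner_nonneg_of_mul {w z : L2per ℓ₁ ℓ₂} {d : ℤ × ℤ → ℝ} (hd : ∀ k, 0 ≤ d k)
    (h : ∀ k, fcoeff z k = (d k : ℂ) * fcoeff w k) : 0 ≤ inner ℝ w z := by
  have h1 := hasSum_norm_fcoeff_sq (w + z)
  have h2 := hasSum_norm_fcoeff_sq (w - z)
  have h3 : ‖w - z‖ ^ 2 / (ℓ₁ * ℓ₂) ≤ ‖w + z‖ ^ 2 / (ℓ₁ * ℓ₂) := by
    refine hasSum_le (fun k => ?_) h2 h1
    have e1 : fcoeff w k + d k * fcoeff w k = ((1 + d k : ℝ) : ℂ) * fcoeff w k := by push_cast; ring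
    have e2 : fcoeff w k - d k * fcoeff w k = ((1 - d k : ℝ) : ℂ) * fcoeff w k := by push_cast; ring
    rw [fcoeff_add, fcoeff_sub, Pi.add_apply, Pi.sub_apply, h, e1, e2, norm_mul, norm_mul, mul_pow,
      mul_pow, Complex.norm_real, Complex.norm_real, Real.norm_eq_abs, Real.norm_eq_abs, sq_abs, sq_abs]
    exact mul_le_mul_of_nonneg_right (by nlinarith [hd k]) (sq_nonneg _)
  rw [div_le_div_iff_of_pos_right (area_pos ℓ₁ ℓ₂), norm_sub_sq_real, norm_add_sq_real] at h3
  linarith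

/-- The equations of one implicit Euler step of length `h` from `(U, V, R)` to `(U + hX, X, Rt)`
with the nonlinear direction `b` frozen. -/
structure StepEq (P : Model) (h : ℝ) (U V b : L2per ℓ₁ ℓ₂) (R : ℝ) (X : L2per ℓ₁ ℓ₂) (Rt : ℝ) :
    Prop where
  mem : MemH P.α X
  eqn : (1 / h) • (X - V) + P.κ • fracLap (P.α / 2) (U + h • X) + P.γ₁ • fracLap (P.α / 2) X
    + P.γ₂ • X + Rt • b = 0
  eqr : Rt = R + h / 2 * inner ℝ b X

/-- The symbol of the operator inverted in one implicit Euler step. -/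
def stepSymbol (ℓ₁ ℓ₂ : ℝ) (P : Model) (h : ℝ) (k : ℤ × ℤ) : ℝ :=
  1 + h * P.γ₂ + (h * P.γ₁ + h ^ 2 * P.κ) * mu ℓ₁ ℓ₂ P.α k

/-- The sign conditions on the coefficients of the equation. -/
structure Model.Valid (P : Model) : Prop where
  hα : 1 < P.α
  hα' : P.α ≤ 2
  hκ : 0 < P.κ
  hγ₁ : 0 ≤ P.γ₁
  hγ₂ : 0 ≤ P.γ₂

variable {P : Model}

theorem stepSymbol_ge (hP : P.Valid) {h : ℝ} (hh : 0 < h) (k : ℤ × ℤ) :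
    1 + h ^ 2 * P.κ * mu ℓ₁ ℓ₂ P.α k ≤ stepSymbol ℓ₁ ℓ₂ P h k := by
  have h1 := mul_nonneg hh.le hP.hγ₂
  have h2 := mul_nonneg (mul_nonneg hh.le hP.hγ₁) (mu_nonneg (ℓ₁ := ℓ₁) (ℓ₂ := ℓ₂) P.α k)
  rw [stepSymbol]; nlinarith

theorem one_le_stepSymbol (hP : P.Valid) {h : ℝ} (hh : 0 < h) (k : ℤ × ℤ) :
    1 ≤ stepSymbol ℓ₁ ℓ₂ P h k := by
  have h1 := stepSymbol_ge (ℓ₁ := ℓ₁) (ℓ₂ := ℓ₂) hP hh k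
  have h2 : 0 ≤ h ^ 2 * P.κ * mu ℓ₁ ℓ₂ P.α k :=
    mul_nonneg (mul_nonneg (sq_nonneg _) hP.hκ.le) (mu_nonneg _ _)
  linarith

theorem stepEq_mode (hP : P.Valid) {h : ℝ} (hh : 0 < h) {U V b X : L2per ℓ₁ ℓ₂} {Rt : ℝ}
    (hU : MemH P.α U) (hX : MemH P.α X) :
    (1 / h) • (X - V) + P.κ • fracLap (P.α / 2) (U + h • X) + P.γ₁ • fracLap (P.α / 2) X
      + P.γ₂ • X + Rt • b = 0 ↔
    ∀ k, (stepSymbol ℓ₁ ℓ₂ P h k : ℂ) * fcoeff X k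
      = fcoeff (V - (h * P.κ) • fracLap (P.α / 2) U) k - h * Rt * fcoeff b k := by
  have hh' : (h : ℂ) ≠ 0 := by exact_mod_cast hh.ne'
  rw [← fcoeff_injective.eq_iff, funext_iff]
  refine forall_congr' fun k => ?_
  simp only [fcoeff_zero, fcoeff_add, fcoeff_sub, fcoeff_smul, Pi.add_apply, Pi.sub_apply,
    Pi.smul_apply, Pi.zero_apply, fcoeff_fracLap hP.hα (hU.add (hX.smul h)), fcoeff_fracLap hP.hα hX,
    fcoeff_fracLap hP.hα hU, Complex.real_smul, stepSymbol]
  push_cast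
  rw [← sub_eq_zero (b := _ - _), ← mul_right_inj' (b := _ + _) hh', mul_zero]
  refine Eq.congr_left ?_
  field_simp
  ring

theorem exists_resolvent (hP : P.Valid) {h : ℝ} (hh : 0 < h) (g : L2per ℓ₁ ℓ₂) :
    ∃ z : L2per ℓ₁ ℓ₂, MemH P.α z ∧ ∀ k, fcoeff z k = ((stepSymbol ℓ₁ ℓ₂ P h k)⁻¹ : ℝ) * fcoeff g k := by
  have h1 := fun k => one_le_stepSymbol (ℓ₁ := ℓ₁) (ℓ₂ := ℓ₂) hP hh k
  have hpos : ∀ k, 0 < stepSymbol ℓ₁ ℓ₂ P h k := fun k => zero_lt_one.trans_le (h1 k)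
  have hg : Summable fun k => ‖fcoeff g k‖ ^ 2 := (hasSum_norm_fcoeff_sq g).summable
  have hκ := hP.hκ
  -- Chosen so that C (1 + h²κ mu) ≥ 1 + mu ≥ rho. Inverting the symbol thus maps L² into H^α, with
  -- a constant that depends on h.
  set C := 1 + 1 / (h ^ 2 * P.κ) with hC
  have hC1 : 1 ≤ C := by rw [hC]; have : 0 < 1 / (h ^ 2 * P.κ) := by positivity
                         linarith
  have hle : ∀ k, rho ℓ₁ ℓ₂ P.α k * (stepSymbol ℓ₁ ℓ₂ P h k)⁻¹ ≤ C := by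
    intro k
    rw [← div_eq_mul_inv, div_le_iff₀ (hpos k)]
    refine (rho_le_one_add_mu hP.hα hP.hα' k).trans ?_
    refine le_trans ?_ (mul_le_mul_of_nonneg_left (stepSymbol_ge hP hh k) (by linarith))
    have hm := mu_nonneg (ℓ₁ := ℓ₁) (ℓ₂ := ℓ₂) P.α k
    have e : C * (1 + h ^ 2 * P.κ * mu ℓ₁ ℓ₂ P.α k)
        = C + h ^ 2 * P.κ * mu ℓ₁ ℓ₂ P.α k + mu ℓ₁ ℓ₂ P.α k := by
      rw [hC]; field_simp; ring
    have : 0 ≤ h ^ 2 * P.κ * mu ℓ₁ ℓ₂ P.α k := by positivity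
    rw [e]; linarith
  have hsum : Summable fun k => rho2 ℓ₁ ℓ₂ P.α k
      * ‖(((stepSymbol ℓ₁ ℓ₂ P h k)⁻¹ : ℝ) : ℂ) * fcoeff g k‖ ^ 2 := by
    refine Summable.of_nonneg_of_le (fun k => mul_nonneg (rho2_nonneg _ _) (sq_nonneg _)) (fun k => ?_)
      (hg.mul_left (C ^ 2))
    rw [norm_mul, mul_pow, Complex.norm_real, Real.norm_of_nonneg (inv_nonneg.2 (hpos k).le), rho2,
      ← mul_assoc, ← mul_pow]
    exact mul_le_mul_of_nonneg_right (pow_le_pow_left₀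
      (mul_nonneg (rho_nonneg hP.hα k) (inv_nonneg.2 (hpos k).le)) (hle k) 2) (sq_nonneg _)
  obtain ⟨z, hz⟩ := fcoeff_surjective (ℓ₁ := ℓ₁) (ℓ₂ := ℓ₂)
    (fun k => (((stepSymbol ℓ₁ ℓ₂ P h k)⁻¹ : ℝ) : ℂ) * fcoeff g k)
    (fun k => by
      rw [fcoeff_neg_freq, map_mul, Complex.conj_ofReal, stepSymbol, stepSymbol, mu_neg])
    (by
      refine Summable.of_nonneg_of_le (fun k => sq_nonneg _) (fun k => ?_) hsum
      have : 1 ≤ rho2 ℓ₁ ℓ₂ P.α k := (one_le_rho hP.hα k).trans (rho_le_rho2 hP.hα k)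
      exact le_mul_of_one_le_left (sq_nonneg _) this)
  refine ⟨z, memH_iff.2 ?_, fun k => congrFun hz k⟩
  rw [hz]; exact hsum

/-- The unknown scalar is a rank-one perturbation. Applying the resolvent gives X = p − h Rt q, with
p from the data and q from b. The scalar equation for Rt then has coefficient 1 + (h²/2)(b, q),
which is positive because the resolvent is a nonnegative operator. -/
theorem existsUnique_step (hP : P.Valid) {h : ℝ} (hh : 0 < h) {U V : L2per ℓ₁ ℓ₂} (b : L2per ℓ₁ ℓ₂)
    (R : ℝ) (hU : MemH P.α U) :
    ∃ X Rt, StepEq P h U V b R X Rt ∧ ∀ X' Rt', StepEq P h U V b R X' Rt' → X' = X ∧ Rt' = Rt := by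
  obtain ⟨p, hp, hpk⟩ := exists_resolvent hP hh (V - (h * P.κ) • fracLap (P.α / 2) U)
  obtain ⟨q, hq, hqk⟩ := exists_resolvent hP hh b
  have hpos : ∀ k, 0 < stepSymbol ℓ₁ ℓ₂ P h k :=
    fun k => zero_lt_one.trans_le (one_le_stepSymbol hP hh k)
  have hbq : 0 ≤ inner ℝ b q := inner_nonneg_of_mul (fun k => inv_nonneg.2 (hpos k).le) hqk
  have hden : 0 < 1 + h ^ 2 / 2 * inner ℝ b q := by positivity
  have key : ∀ X Rt, MemH P.α X → ((1 / h) • (X - V) + P.κ • fracLap (P.α / 2) (U + h • X)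
      + P.γ₁ • fracLap (P.α / 2) X + P.γ₂ • X + Rt • b = 0 ↔ X = p - (h * Rt) • q) := by
    intro X Rt hX
    rw [stepEq_mode hP hh hU hX, ← fcoeff_injective.eq_iff, funext_iff]
    refine forall_congr' fun k => ?_
    have hne : ((stepSymbol ℓ₁ ℓ₂ P h k : ℝ) : ℂ) ≠ 0 := by exact_mod_cast (hpos k).ne'
    rw [fcoeff_sub p, fcoeff_smul (h * Rt), Pi.sub_apply, Pi.smul_apply, hpk, hqk, Complex.real_smul,
      ← mul_right_inj' (b := fcoeff X k) hne]
    refine Eq.congr_right ?_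
    push_cast
    field_simp
  have keyR : ∀ Rt, Rt = R + h / 2 * inner ℝ b (p - (h * Rt) • q) ↔
      Rt = (R + h / 2 * inner ℝ b p) / (1 + h ^ 2 / 2 * inner ℝ b q) := by
    intro Rt
    rw [eq_div_iff hden.ne', inner_sub_right, inner_smul_right]
    constructor <;> intro h <;> linarith
  set Rt := (R + h / 2 * inner ℝ b p) / (1 + h ^ 2 / 2 * inner ℝ b q) with hRt
  have hm : MemH P.α (p - (h * Rt) • q) := hp.sub (hq.smul _)
  refine ⟨p - (h * Rt) • q, Rt, ⟨hm, (key _ _ hm).2 rfl, (keyR _).2 hRt⟩, fun X' Rt' hs => ?_⟩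
  have h1 := (key _ _ hs.mem).1 hs.eqn
  have h2 : Rt' = Rt := (keyR Rt').1 (by rw [← h1]; exact hs.eqr)
  exact ⟨by rw [h1, h2], h2⟩

end

/-! ### Existence and uniqueness of the scheme -/

section

variable {ℓ₁ ℓ₂ : ℝ} [Fact (0 < ℓ₁)] [Fact (0 < ℓ₂)] {P : Model}

theorem inner_b (w X : L2per ℓ₁ ℓ₂) :
    inner ℝ (P.b w) X = 1 / √(P.E w) * inner ℝ (P.dF w) X := by
  rw [Model.b, real_inner_smul_left]

theorem half_step_iff {τ : ℝ} (hτ : 0 < τ) {U V w Uh Vh : L2per ℓ₁ ℓ₂} {R Rh : ℝ}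
    (hV : MemH P.α Vh) :
    ((1 / (τ / 2)) • (Uh - U) = Vh ∧
      (1 / (τ / 2)) • (Vh - V) + P.κ • fracLap (P.α / 2) Uh + P.γ₁ • fracLap (P.α / 2) Vh
        + P.γ₂ • Vh + Rh • P.b w = 0 ∧
      (Rh - R) / (τ / 2) = 1 / (2 * √(P.E w)) * inner ℝ (P.dF w) ((1 / (τ / 2)) • (Uh - U))) ↔
    Uh = U + (τ / 2) • Vh ∧ StepEq P (τ / 2) U V (P.b w) R Vh Rh := by
  have hh : τ / 2 ≠ 0 := by positivity
  have e1 : (1 / (τ / 2)) • (Uh - U) = Vh ↔ Uh = U + (τ / 2) • Vh := by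
    rw [one_div, inv_smul_eq_iff₀ hh, sub_eq_iff_eq_add']
  have e2 : ((Rh - R) / (τ / 2) = 1 / (2 * √(P.E w)) * inner ℝ (P.dF w) Vh) ↔
      Rh = R + τ / 2 / 2 * inner ℝ (P.b w) Vh := by
    rw [inner_b, div_eq_iff hh, sub_eq_iff_eq_add']
    refine Eq.congr_right ?_
    ring
  constructor
  · rintro ⟨h1, h2, h3⟩
    rw [h1] at h3
    have h4 := e1.1 h1
    exact ⟨h4, hV, by rw [← h4]; exact h2, e2.1 h3⟩
  · rintro ⟨h1, h2⟩
    have h4 := e1.2 h1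
    refine ⟨h4, ?_, ?_⟩
    · rw [h1]; exact h2.eqn
    · rw [h4]; exact e2.2 h2.eqr

/-- The midpoint step is an implicit Euler step of half the length for the means X = (V' + V)/2 and
(R' + R)/2. The new values are recovered by the reflections V' = 2X − V and R' = 2Rt − R. -/
theorem full_step_iff {τ : ℝ} (hτ : 0 < τ) {U V w U' V' : L2per ℓ₁ ℓ₂} {R R' : ℝ}
    (hX : MemH P.α ((1 / 2 : ℝ) • (V' + V))) :
    ((1 / τ) • (U' - U) = (1 / 2 : ℝ) • (V' + V) ∧
      (1 / τ) • (V' - V) + P.κ • fracLap (P.α / 2) ((1 / 2 : ℝ) • (U' + U))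
        + P.γ₁ • fracLap (P.α / 2) ((1 / 2 : ℝ) • (V' + V)) + P.γ₂ • ((1 / 2 : ℝ) • (V' + V))
        + ((R' + R) / 2) • P.b w = 0 ∧
      (R' - R) / τ = 1 / (2 * √(P.E w)) * inner ℝ (P.dF w) ((1 / τ) • (U' - U))) ↔
    U' = U + τ • ((1 / 2 : ℝ) • (V' + V)) ∧
      StepEq P (τ / 2) U V (P.b w) R ((1 / 2 : ℝ) • (V' + V)) ((R' + R) / 2) := by
  have hτ' := hτ.ne'
  set X := (1 / 2 : ℝ) • (V' + V) with hXd
  have e1 : (1 / τ) • (U' - U) = X ↔ U' = U + τ • X := by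
    rw [one_div, inv_smul_eq_iff₀ hτ', sub_eq_iff_eq_add']
  have e2 : ((R' - R) / τ = 1 / (2 * √(P.E w)) * inner ℝ (P.dF w) X) ↔
      (R' + R) / 2 = R + τ / 2 / 2 * inner ℝ (P.b w) X := by
    rw [inner_b, div_eq_iff hτ']
    constructor <;> intro h <;> ring_nf at h ⊢ <;> linarith
  have e3 : (1 / (τ / 2)) • (X - V) = (1 / τ) • (V' - V) := by
    rw [hXd]
    have : (1 / (τ / 2)) = 2 * (1 / τ) := by field_simp
    rw [this]
    module
  have e4 : U' = U + τ • X → (1 / 2 : ℝ) • (U' + U) = U + (τ / 2) • X := by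
    intro h; rw [h]; module
  constructor
  · rintro ⟨h1, h2, h3⟩
    rw [h1] at h3
    have h4 := e1.1 h1
    exact ⟨h4, hX, by rw [e3, ← e4 h4]; exact h2, e2.1 h3⟩
  · rintro ⟨h1, h2⟩
    have h4 := e1.2 h1
    refine ⟨h4, ?_, ?_⟩
    · rw [e4 h1, ← e3]; exact h2.eqn
    · rw [h4]; exact e2.2 h2.eqr

section Scheme

variable {φ₀ φ₁ : L2per ℓ₁ ℓ₂} {τ : ℝ} {K : ℕ}

theorem IsScheme.half {S : Discrete ℓ₁ ℓ₂} (hS : IsScheme P φ₀ φ₁ τ K S) (hτ : 0 < τ) :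
    S.Uh = S.U 0 + (τ / 2) • S.Vh ∧
      StepEq P (τ / 2) (S.U 0) (S.V 0) (P.b (S.U 0)) (S.R 0) S.Vh S.Rh :=
  (half_step_iff hτ hS.mem_Vh).1 ⟨hS.half_U, hS.half_V, hS.half_R⟩

theorem IsScheme.mem_mid {S : Discrete ℓ₁ ℓ₂} (hS : IsScheme P φ₀ φ₁ τ K S) {n : ℕ} (hn : n < K) :
    MemH P.α ((1 / 2 : ℝ) • (S.V (n + 1) + S.V n)) :=
  ((hS.mem_V _ hn).add (hS.mem_V _ hn.le)).smul _

theorem IsScheme.step {S : Discrete ℓ₁ ℓ₂} (hS : IsScheme P φ₀ φ₁ τ K S) (hτ : 0 < τ) {n : ℕ}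
    (hn : n < K) : S.U (n + 1) = S.U n + τ • ((1 / 2 : ℝ) • (S.V (n + 1) + S.V n)) ∧
      StepEq P (τ / 2) (S.U n) (S.V n) (P.b (S.Ut n)) (S.R n)
        ((1 / 2 : ℝ) • (S.V (n + 1) + S.V n)) ((S.R (n + 1) + S.R n) / 2) :=
  (full_step_iff hτ (hS.mem_mid hn)).1 ⟨hS.step_U n hn, hS.step_V n hn, hS.step_R n hn⟩

theorem IsScheme.agree (hP : P.Valid) (hτ : 0 < τ) {S S' : Discrete ℓ₁ ℓ₂}
    (hS : IsScheme P φ₀ φ₁ τ K S) (hS' : IsScheme P φ₀ φ₁ τ K S') : S.Agree K S' := by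
  have hτ2 : 0 < τ / 2 := by positivity
  have h0 : S.Uh = S'.Uh ∧ S.Vh = S'.Vh ∧ S.Rh = S'.Rh := by
    obtain ⟨a1, a2⟩ := hS.half hτ
    obtain ⟨b1, b2⟩ := hS'.half hτ
    have eU : S'.U 0 = S.U 0 := by rw [hS.init_U, hS'.init_U]
    have eV : S'.V 0 = S.V 0 := by rw [hS.init_V, hS'.init_V]
    have eR : S'.R 0 = S.R 0 := by rw [hS.init_R, hS'.init_R]
    rw [eU, eV, eR] at b2
    obtain ⟨X, Rt, -, huniq⟩ := existsUnique_step hP hτ2 (V := S.V 0) (P.b (S.U 0)) (S.R 0)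
      (hS.mem_U 0 (Nat.zero_le _))
    obtain ⟨c1, c2⟩ := huniq _ _ a2
    obtain ⟨d1, d2⟩ := huniq _ _ b2
    have hV : S.Vh = S'.Vh := c1.trans d1.symm
    exact ⟨by rw [a1, b1, eU, hV], hV, c2.trans d2.symm⟩
  have key : ∀ n ≤ K, S.U n = S'.U n ∧ S.V n = S'.V n ∧ S.R n = S'.R n := by
    intro n
    induction n using Nat.strong_induction_on with
    | _ n ih =>
      intro hn
      rcases n with _ | n
      · exact ⟨by rw [hS.init_U, hS'.init_U], by rw [hS.init_V, hS'.init_V],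
          by rw [hS.init_R, hS'.init_R]⟩
      · obtain ⟨i1, i2, i3⟩ := ih n (Nat.lt_succ_self n) (Nat.le_of_succ_le hn)
        have eUt : S'.Ut n = S.Ut n := by
          rcases Nat.eq_zero_or_pos n with rfl | hpos
          · simp [Discrete.Ut, h0.1]
          · have := (ih (n - 1) (by omega) (by omega)).1
            simp only [Discrete.Ut, if_neg hpos.ne', i1, this]
        obtain ⟨a1, a2⟩ := hS.step hτ hn
        obtain ⟨b1, b2⟩ := hS'.step hτ hn
        rw [← i1, ← i2, ← i3, eUt] at b2
        rw [← i1, ← i2] at b1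
        obtain ⟨X, Rt, -, huniq⟩ := existsUnique_step hP hτ2 (V := S.V n) (P.b (S.Ut n)) (S.R n)
          (hS.mem_U n (Nat.le_of_succ_le hn))
        obtain ⟨c1, c2⟩ := huniq _ _ a2
        obtain ⟨d1, d2⟩ := huniq _ _ b2
        have eX := c1.trans d1.symm
        refine ⟨by rw [a1, b1, eX], ?_, by linarith⟩
        have := smul_right_injective (L2per ℓ₁ ℓ₂) (one_div_ne_zero (two_ne_zero' ℝ)) eX
        exact add_right_cancel this
  exact ⟨key, h0⟩

/-- The unknowns at one time level together with the extrapolated state for the next step. -/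
structure SchemeState (ℓ₁ ℓ₂ : ℝ) [Fact (0 < ℓ₁)] [Fact (0 < ℓ₂)] where
  U : L2per ℓ₁ ℓ₂
  V : L2per ℓ₁ ℓ₂
  R : ℝ
  W : L2per ℓ₁ ℓ₂

/-- Positivity of the energy plays no role here. Where E ≤ 0, the conventions for √ and 1/0 make b
vanish, and the step remains uniquely solvable. Positivity along the scheme is proved afterwards
from the error bound. -/
theorem exists_isScheme (hP : P.Valid) (hτ : 0 < τ) (K : ℕ) (h0 : MemH P.α φ₀) (h1 : MemH P.α φ₁) :
    ∃ S : Discrete ℓ₁ ℓ₂, IsScheme P φ₀ φ₁ τ K S := by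
  have hτ2 : 0 < τ / 2 := by positivity
  have hex : ∀ (U V b : L2per ℓ₁ ℓ₂) (R : ℝ), ∃ X Rt, MemH P.α U → StepEq P (τ / 2) U V b R X Rt := by
    intro U V b R
    by_cases hU : MemH P.α U
    · obtain ⟨X, Rt, h, -⟩ := existsUnique_step hP hτ2 (V := V) b R hU
      exact ⟨X, Rt, fun _ => h⟩
    · exact ⟨0, 0, fun h => absurd h hU⟩
  choose X Rt hXR using hex
  set Vh := X φ₀ φ₁ (P.b φ₀) (P.sav φ₀) with hVh
  set Rh := Rt φ₀ φ₁ (P.b φ₀) (P.sav φ₀) with hRh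
  have hhalf := hXR φ₀ φ₁ (P.b φ₀) (P.sav φ₀) h0
  set next : SchemeState ℓ₁ ℓ₂ → SchemeState ℓ₁ ℓ₂ := fun s =>
    { U := s.U + τ • X s.U s.V (P.b s.W) s.R
      V := (2 : ℝ) • X s.U s.V (P.b s.W) s.R - s.V
      R := 2 * Rt s.U s.V (P.b s.W) s.R - s.R
      W := (1 / 2 : ℝ) • ((3 : ℝ) • (s.U + τ • X s.U s.V (P.b s.W) s.R) - s.U) } with hnext
  -- Carrying `W` in the state turns the two-step scheme into a one-step recursion. Its initial
  -- value is the half-step predictor, and `next` supplies the extrapolation afterwards.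
  set st : ℕ → SchemeState ℓ₁ ℓ₂ := fun n =>
    Nat.rec ⟨φ₀, φ₁, P.sav φ₀, φ₀ + (τ / 2) • Vh⟩ (fun _ s => next s) n with hst
  have hst0 : st 0 = ⟨φ₀, φ₁, P.sav φ₀, φ₀ + (τ / 2) • Vh⟩ := rfl
  have hsts : ∀ n, st (n + 1) = next (st n) := fun n => rfl
  have hmem : ∀ n, MemH P.α (st n).U ∧ MemH P.α (st n).V := by
    intro n
    induction n with
    | zero => exact ⟨h0, h1⟩
    | succ n ih =>
      have hm := (hXR (st n).U (st n).V (P.b (st n).W) (st n).R ih.1).mem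
      rw [hsts]
      exact ⟨ih.1.add (hm.smul _), (hm.smul _).sub ih.2⟩
  set S : Discrete ℓ₁ ℓ₂ :=
    { U := fun n => (st n).U, V := fun n => (st n).V, R := fun n => (st n).R,
      Uh := φ₀ + (τ / 2) • Vh, Vh := Vh, Rh := Rh } with hSdef
  have hUt : ∀ n, S.Ut n = (st n).W := by
    intro n
    rcases n with _ | n
    · rfl
    · simp only [Discrete.Ut, if_neg n.succ_ne_zero, Nat.add_sub_cancel, hSdef, hsts]
      rfl
  obtain ⟨q1, q2, q3⟩ := (half_step_iff (V := φ₁) (w := φ₀) (R := P.sav φ₀) hτ hhalf.mem).2 ⟨rfl, hhalf⟩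
  have hstep : ∀ n, ((1 / τ) • (S.U (n + 1) - S.U n) = (1 / 2 : ℝ) • (S.V (n + 1) + S.V n) ∧
      (1 / τ) • (S.V (n + 1) - S.V n)
        + P.κ • fracLap (P.α / 2) ((1 / 2 : ℝ) • (S.U (n + 1) + S.U n))
        + P.γ₁ • fracLap (P.α / 2) ((1 / 2 : ℝ) • (S.V (n + 1) + S.V n))
        + P.γ₂ • ((1 / 2 : ℝ) • (S.V (n + 1) + S.V n))
        + ((S.R (n + 1) + S.R n) / 2) • P.b (S.Ut n) = 0 ∧
      (S.R (n + 1) - S.R n) / τ = 1 / (2 * √(P.E (S.Ut n)))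
        * inner ℝ (P.dF (S.Ut n)) ((1 / τ) • (S.U (n + 1) - S.U n))) := by
    intro n
    have hs := hXR (st n).U (st n).V (P.b (st n).W) (st n).R (hmem n).1
    have eX : (1 / 2 : ℝ) • (S.V (n + 1) + S.V n) = X (st n).U (st n).V (P.b (st n).W) (st n).R := by
      change (1 / 2 : ℝ) • (((2 : ℝ) • X (st n).U (st n).V (P.b (st n).W) (st n).R - (st n).V)
        + (st n).V) = _
      module
    have eR : (S.R (n + 1) + S.R n) / 2 = Rt (st n).U (st n).V (P.b (st n).W) (st n).R := by
      change ((2 * Rt (st n).U (st n).V (P.b (st n).W) (st n).R - (st n).R) + (st n).R) / 2 = _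
      ring
    refine (full_step_iff hτ (by rw [eX]; exact hs.mem)).2 ?_
    rw [eX, eR, hUt]
    exact ⟨rfl, hs⟩
  exact ⟨S, fun n _ => (hmem n).1, fun n _ => (hmem n).2, h0.add (hhalf.mem.smul _), hhalf.mem, rfl,
    rfl, rfl, q1, q2, q3, fun n _ => (hstep n).1, fun n _ => (hstep n).2.1, fun n _ => (hstep n).2.2⟩

end Scheme

end

/-! ### Bounds and derivatives along the exact solution -/

section

variable {ℓ₁ ℓ₂ : ℝ} [Fact (0 < ℓ₁)] [Fact (0 < ℓ₂)] {P : Model}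

/-- The weight of `H^{7α/2}`. -/
def rho7 (ℓ₁ ℓ₂ α : ℝ) (k : ℤ × ℤ) : ℝ := rho ℓ₁ ℓ₂ α k ^ 7

theorem rho7_nonneg {α : ℝ} (hα : 1 < α) (k : ℤ × ℤ) : 0 ≤ rho7 ℓ₁ ℓ₂ α k :=
  pow_nonneg (rho_nonneg hα k) _

theorem Bd.rho2_of_rho7 {α C : ℝ} (hα : 1 < α) {c : ℤ × ℤ → ℂ} (h : Bd (rho7 ℓ₁ ℓ₂ α) c C) :
    Bd (rho2 ℓ₁ ℓ₂ α) c C :=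
  h.mono (rho2_nonneg α) fun k => pow_le_pow_right₀ (one_le_rho hα k) (by norm_num)

theorem MemH.bd_hNorm {s : ℝ} {w : L2per ℓ₁ ℓ₂} (h : MemH s w) :
    Bd (fun k => (1 + freqSq ℓ₁ ℓ₂ k) ^ s) (fcoeff w) (hNorm s w) :=
  bd_sqrt_tsum (fun k => Real.rpow_nonneg (by linarith [freqSq_nonneg (ℓ₁ := ℓ₁) (ℓ₂ := ℓ₂) k]) _) h

/-- A smooth solution of the equation together with all assumptions on the data. -/
structure ExactData (P : Model) (T m L : ℝ) (φ₀ φ₁ : L2per ℓ₁ ℓ₂) (u v a j : ℝ → L2per ℓ₁ ℓ₂) :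
    Prop where
  valid : P.Valid
  smooth : ContDiff ℝ 3 P.F
  hT : 0 < T
  hm : 7 * P.α / 2 ≤ m
  sol : IsSolution P T φ₀ φ₁ u v a j
  energy : ∀ t ∈ Icc 0 T, 0 < P.E (u t)
  reg : RegularityBound P T m L φ₀ u v a j

variable {T m L : ℝ} {φ₀ φ₁ : L2per ℓ₁ ℓ₂} {u v a j : ℝ → L2per ℓ₁ ℓ₂}

theorem hasDerivAt_fcoeff {f : ℝ → L2per ℓ₁ ℓ₂} {f' : L2per ℓ₁ ℓ₂} {t : ℝ} (h : HasDerivAt f f' t)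
    (k : ℤ × ℤ) : HasDerivAt (fun s => fcoeff (f s) k) (fcoeff f' k) t := by
  simp only [← fcoeffL_apply]
  exact (fcoeffL ℓ₁ ℓ₂ k).hasFDerivAt.comp_hasDerivAt t h

theorem continuousOn_fcoeff {f : ℝ → L2per ℓ₁ ℓ₂} {s : Set ℝ} (h : ContinuousOn f s) (k : ℤ × ℤ) :
    ContinuousOn (fun s => fcoeff (f s) k) s := by
  simp only [← fcoeffL_apply]
  exact (fcoeffL ℓ₁ ℓ₂ k).continuous.comp_continuousOn h

theorem nhdsWithin_Ioo_neBot {T t : ℝ} (hT : 0 < T) (ht : t ∈ Icc 0 T) : (𝓝[Ioo 0 T] t).NeBot :=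
  mem_closure_iff_nhdsWithin_neBot.1 (by rwa [closure_Ioo hT.ne])

theorem bd_Icc_of_Ioo {f : ℝ → L2per ℓ₁ ℓ₂} {ω : ℤ × ℤ → ℝ} {T C : ℝ} (hT : 0 < T)
    (hf : ContinuousOn f (Icc 0 T)) (h : ∀ t ∈ Ioo 0 T, Bd ω (fcoeff (f t)) C) {t : ℝ}
    (ht : t ∈ Icc 0 T) : Bd ω (fcoeff (f t)) C := by
  have := nhdsWithin_Ioo_neBot hT ht
  exact Bd.of_tendsto (l := 𝓝[Ioo 0 T] t) (f := fun s => fcoeff (f s))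
    (fun k => (continuousOn_fcoeff hf k t ht).mono_left (nhdsWithin_mono _ Ioo_subset_Icc_self))
    (eventually_nhdsWithin_of_forall h)

namespace ExactData

theorem bounds_Ioo (D : ExactData P T m L φ₀ φ₁ u v a j) {t : ℝ} (ht : t ∈ Ioo 0 T) :
    Bd (rho7 ℓ₁ ℓ₂ P.α) (fcoeff (u t)) L ∧ Bd (rho7 ℓ₁ ℓ₂ P.α) (fcoeff (v t)) L ∧
    Bd (rho2 ℓ₁ ℓ₂ P.α) (fcoeff (a t)) L ∧ Bd (rho ℓ₁ ℓ₂ P.α) (fcoeff (j t)) L ∧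
    |P.sav (u t)| ≤ L ∧ |iteratedDeriv 2 (fun s => P.sav (u s)) t| ≤ L ∧
    |iteratedDeriv 3 (fun s => P.sav (u s)) t| ≤ L := by
  have hb := D.reg.bound t ht
  have hn : ∀ s (w : L2per ℓ₁ ℓ₂), 0 ≤ hNorm s w := fun s w => Real.sqrt_nonneg _
  have n1 := hn m φ₀
  have n2 := hn m (u t)
  have n3 := hn m (v t)
  have n4 := hn P.α (u t)
  have n5 := hn P.α (v t)
  have n6 := hn P.α (a t)
  have n7 := hn (P.α / 2) (j t)
  have m0 := abs_nonneg (P.sav (u t))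
  have m1 := abs_nonneg (iteratedDeriv 1 (fun s => P.sav (u s)) t)
  have m2 := abs_nonneg (iteratedDeriv 2 (fun s => P.sav (u s)) t)
  have m3 := abs_nonneg (iteratedDeriv 3 (fun s => P.sav (u s)) t)
  refine ⟨?_, ?_, ?_, ?_, by linarith, by linarith, by linarith⟩
  · exact ((D.reg.mem_u t ht).bd_hNorm.mono (rho7_nonneg D.valid.hα) (rho_pow_seven_le D.hm)).le
      (by linarith)
  · exact ((D.reg.mem_v t ht).bd_hNorm.mono (rho7_nonneg D.valid.hα) (rho_pow_seven_le D.hm)).le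
      (by linarith)
  · exact ((D.reg.mem_a t ht).bd_hNorm.mono (rho2_nonneg P.α) fun k => (rho_sq P.α k).le).le
      (by linarith)
  · exact ((D.reg.mem_j t ht).bd_hNorm.mono (rho_nonneg D.valid.hα) fun k => le_rfl).le
      (by linarith)

variable (D : ExactData P T m L φ₀ φ₁ u v a j)
include D

theorem mid_mem : T / 2 ∈ Ioo 0 T := ⟨by linarith [D.hT], by linarith [D.hT]⟩

theorem L_nonneg : 0 ≤ L := (D.bounds_Ioo D.mid_mem).1.1

theorem bd_u {t : ℝ} (ht : t ∈ Icc 0 T) : Bd (rho7 ℓ₁ ℓ₂ P.α) (fcoeff (u t)) L :=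
  bd_Icc_of_Ioo D.hT D.sol.cont_u (fun _ hs => (D.bounds_Ioo hs).1) ht

theorem bd_v {t : ℝ} (ht : t ∈ Icc 0 T) : Bd (rho7 ℓ₁ ℓ₂ P.α) (fcoeff (v t)) L :=
  bd_Icc_of_Ioo D.hT D.sol.cont_v (fun _ hs => (D.bounds_Ioo hs).2.1) ht

theorem bd2_u {t : ℝ} (ht : t ∈ Icc 0 T) : Bd (rho2 ℓ₁ ℓ₂ P.α) (fcoeff (u t)) L :=
  (D.bd_u ht).rho2_of_rho7 D.valid.hα

theorem bd_a {t : ℝ} (ht : t ∈ Ioo 0 T) : Bd (rho2 ℓ₁ ℓ₂ P.α) (fcoeff (a t)) L :=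
  (D.bounds_Ioo ht).2.2.1

theorem bd_j {t : ℝ} (ht : t ∈ Ioo 0 T) : Bd (rho ℓ₁ ℓ₂ P.α) (fcoeff (j t)) L :=
  (D.bounds_Ioo ht).2.2.2.1

theorem deriv_u {t : ℝ} (ht : t ∈ Ioo 0 T) (k : ℤ × ℤ) :
    HasDerivAt (fun s => fcoeff (u s) k) (fcoeff (v t) k) t := hasDerivAt_fcoeff (D.sol.deriv_u t ht) k

theorem deriv_v {t : ℝ} (ht : t ∈ Ioo 0 T) (k : ℤ × ℤ) :
    HasDerivAt (fun s => fcoeff (v s) k) (fcoeff (a t) k) t := hasDerivAt_fcoeff (D.sol.deriv_v t ht) k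

theorem deriv_a {t : ℝ} (ht : t ∈ Ioo 0 T) (k : ℤ × ℤ) :
    HasDerivAt (fun s => fcoeff (a s) k) (fcoeff (j t) k) t := hasDerivAt_fcoeff (D.sol.deriv_a t ht) k

theorem cont_u (k : ℤ × ℤ) : ContinuousOn (fun s => fcoeff (u s) k) (Icc 0 T) :=
  continuousOn_fcoeff D.sol.cont_u k

theorem cont_v (k : ℤ × ℤ) : ContinuousOn (fun s => fcoeff (v s) k) (Icc 0 T) :=
  continuousOn_fcoeff D.sol.cont_v k

theorem ae_abs_u_le {t : ℝ} (ht : t ∈ Icc 0 T) :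
    ∀ᵐ x, |u t x| ≤ sobolevConst ℓ₁ ℓ₂ P.α * L := (D.bd2_u ht).ae_abs_le D.valid.hα

/-- The uniform L^∞ bound coming from H^α makes the Taylor estimate of E applicable, so continuity
of u in L² suffices. -/
theorem continuousOn_energy : ContinuousOn (fun t => P.E (u t)) (Icc 0 T) := by
  obtain ⟨Λ, hΛ⟩ := exists_potentialBound D.smooth (sobolevConst ℓ₁ ℓ₂ P.α * L)
  intro t ht
  have h1 : ∀ s ∈ Icc 0 T, |P.E (u s) - P.E (u t)|
      ≤ Λ * ‖u s - u t‖ ^ 2 + ‖P.dF (u t)‖ * ‖u s - u t‖ := by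
    intro s hs
    have := hΛ.energy_taylor D.smooth (D.ae_abs_u_le ht) (D.ae_abs_u_le hs)
    have h2 := abs_real_inner_le_norm (P.dF (u t)) (u s - u t)
    have e : P.E (u s) - P.E (u t) = (P.E (u s) - P.E (u t) - inner ℝ (P.dF (u t)) (u s - u t))
        + inner ℝ (P.dF (u t)) (u s - u t) := by ring
    rw [e]
    exact (abs_add_le _ _).trans (add_le_add this h2)
  have h2 : Tendsto (fun s => u s - u t) (𝓝[Icc 0 T] t) (𝓝 (u t - u t)) :=
    (D.sol.cont_u t ht).sub tendsto_const_nhds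
  have h3 : Tendsto (fun s => Λ * ‖u s - u t‖ ^ 2 + ‖P.dF (u t)‖ * ‖u s - u t‖) (𝓝[Icc 0 T] t) (𝓝 0) := by
    have := ((h2.norm.pow 2).const_mul Λ).add (h2.norm.const_mul ‖P.dF (u t)‖)
    simpa using this
  refine tendsto_iff_norm_sub_tendsto_zero.2 (squeeze_zero' ?_ ?_ h3)
  · exact Eventually.of_forall fun s => norm_nonneg _
  · exact eventually_nhdsWithin_of_forall h1

theorem exists_energy_lower : ∃ c₀, 0 < c₀ ∧ ∀ t ∈ Icc 0 T, c₀ ≤ P.E (u t) := by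
  obtain ⟨t₀, ht₀, h⟩ := isCompact_Icc.exists_isMinOn (nonempty_Icc.2 D.hT.le) D.continuousOn_energy
  exact ⟨P.E (u t₀), D.energy t₀ ht₀, fun t ht => h ht⟩

theorem continuousOn_sav : ContinuousOn (fun t => P.sav (u t)) (Icc 0 T) :=
  D.continuousOn_energy.sqrt

theorem deriv_sav {t : ℝ} (ht : t ∈ Ioo 0 T) {i : ℕ} (hi : i < 3) :
    HasDerivAt (iteratedDeriv i fun s => P.sav (u s)) (iteratedDeriv (i + 1) (fun s => P.sav (u s)) t) t := by
  have h1 : DifferentiableOn ℝ (iteratedDeriv i fun s => P.sav (u s)) (Ioo 0 T) :=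
    (D.reg.smooth_r.differentiableOn_iteratedDerivWithin (by exact_mod_cast hi)
      isOpen_Ioo.uniqueDiffOn).congr fun x hx => (iteratedDerivWithin_of_isOpen isOpen_Ioo hx).symm
  rw [iteratedDeriv_succ]
  exact (h1.differentiableAt (Ioo_mem_nhds ht.1 ht.2)).hasDerivAt

theorem hasDerivAt_energy {t : ℝ} (ht : t ∈ Ioo 0 T) :
    HasDerivAt (fun s => P.E (u s)) (inner ℝ (P.dF (u t)) (v t)) t := by
  obtain ⟨Λ, hΛ⟩ := exists_potentialBound D.smooth (sobolevConst ℓ₁ ℓ₂ P.α * L)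
  have hd := D.sol.deriv_u t ht
  have h1 : HasDerivAt (fun s => inner ℝ (P.dF (u t)) (u s)) (inner ℝ (P.dF (u t)) (v t)) t :=
    (innerSL ℝ (P.dF (u t))).hasFDerivAt.comp_hasDerivAt t hd
  have h2 : HasDerivAt (fun s => P.E (u s) - P.E (u t) - inner ℝ (P.dF (u t)) (u s - u t)) 0 t := by
    rw [hasDerivAt_iff_isLittleO]
    -- Differentiability of u in L² makes the quadratic Taylor remainder of E of order (s − t)².
    -- Hence E is differentiable along u, although it is not assumed differentiable on L².
    have h3 : (fun s => ‖u s - u t‖ ^ 2) =o[𝓝 t] fun s => s - t := by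
      have b1 : (fun s => ‖u s - u t‖) =O[𝓝 t] fun s => s - t := hd.isBigO_sub.norm_left
      have b2 : (fun s => ‖u s - u t‖ ^ 2) =O[𝓝 t] fun s => (s - t) ^ 2 := b1.pow 2
      refine b2.trans_isLittleO ?_
      have b3 : Tendsto (fun s : ℝ => s - t) (𝓝 t) (𝓝 0) := by
        have : Tendsto (fun s : ℝ => s - t) (𝓝 t) (𝓝 (t - t)) := tendsto_id.sub_const t
        rwa [sub_self] at this
      have := (Asymptotics.isLittleO_one_iff ℝ).2 b3
      simpa [sq] using this.mul_isBigO (Asymptotics.isBigO_refl (fun s : ℝ => s - t) (𝓝 t))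
    refine Asymptotics.IsBigO.trans_isLittleO ?_ h3
    refine Asymptotics.IsBigO.of_bound Λ ?_
    filter_upwards [Ioo_mem_nhds ht.1 ht.2] with s hs
    have := hΛ.energy_taylor D.smooth (D.ae_abs_u_le (Ioo_subset_Icc_self ht))
      (D.ae_abs_u_le (Ioo_subset_Icc_self hs))
    simpa using this
  have h4 := h2.fun_add h1
  rw [zero_add] at h4
  have h5 := h4.add_const (P.E (u t) - inner ℝ (P.dF (u t)) (u t))
  refine h5.congr_of_eventuallyEq (Eventually.of_forall fun s => ?_)
  simp only [inner_sub_right]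
  ring

theorem deriv_sav_eq {t : ℝ} (ht : t ∈ Ioo 0 T) :
    iteratedDeriv 1 (fun s => P.sav (u s)) t = 1 / 2 * inner ℝ (P.b (u t)) (v t) := by
  have h1 := (D.hasDerivAt_energy ht).sqrt (D.energy t (Ioo_subset_Icc_self ht)).ne'
  rw [iteratedDeriv_one]
  refine h1.deriv.trans ?_
  rw [inner_b]
  ring

theorem sav_smul_b {t : ℝ} (ht : t ∈ Icc 0 T) : P.sav (u t) • P.b (u t) = P.dF (u t) := by
  have := (Real.sqrt_pos.2 (D.energy t ht)).ne'
  rw [Model.b, Model.sav, smul_smul, mul_one_div_cancel this, one_smul]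

theorem eqn_mode {t : ℝ} (ht : t ∈ Ioo 0 T) (k : ℤ × ℤ) :
    fcoeff (a t) k + P.κ * (mu ℓ₁ ℓ₂ P.α k * fcoeff (u t) k) + P.γ₁ * (mu ℓ₁ ℓ₂ P.α k * fcoeff (v t) k)
      + P.γ₂ * fcoeff (v t) k + fcoeff (P.dF (u t)) k = 0 := by
  have h := congrArg (fun w => fcoeff w k) (D.sol.eqn t ht)
  simpa only [fcoeff_add, fcoeff_smul, fcoeff_zero, Pi.add_apply, Pi.smul_apply, Pi.zero_apply,
    Complex.real_smul, fcoeff_fracLap D.valid.hα (D.sol.mem_u t (Ioo_subset_Icc_self ht)),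
    fcoeff_fracLap D.valid.hα (D.sol.mem_v t (Ioo_subset_Icc_self ht))] using h

end ExactData

end

/-! ### Frequency splitting and the truncation error of u_t = v -/

section

variable {ℓ₁ ℓ₂ : ℝ} [Fact (0 < ℓ₁)] [Fact (0 < ℓ₂)] {P : Model}

/-- `c` is the midpoint of a step of length `2h = σ²` inside `[0, T]`. -/
structure MidPoint (T h σ c : ℝ) : Prop where
  pos : 0 < σ
  small : σ ≤ 1 / 2
  hh : 2 * h = σ ^ 2
  lo : 0 ≤ c - h
  hi : c + h ≤ T

namespace MidPoint

variable {T h σ c : ℝ} (H : MidPoint T h σ c)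
include H

theorem h_pos : 0 < h := by have := H.hh; have := H.pos; nlinarith
theorem c_mem : c ∈ Ioo 0 T := ⟨by linarith [H.h_pos, H.lo], by linarith [H.h_pos, H.hi]⟩
theorem right_mem : c + h ∈ Icc 0 T := ⟨by linarith [H.h_pos, H.lo], H.hi⟩
theorem left_mem : c - h ∈ Icc 0 T := ⟨H.lo, by linarith [H.h_pos, H.hi]⟩

theorem add_mem {s : ℝ} (hs : s ∈ Ioo 0 h) : c + s ∈ Ioo 0 T :=
  ⟨by linarith [H.c_mem.1, hs.1], by linarith [H.hi, hs.2]⟩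
theorem sub_mem {s : ℝ} (hs : s ∈ Ioo 0 h) : c - s ∈ Ioo 0 T :=
  ⟨by linarith [H.lo, hs.2], by linarith [H.c_mem.2, hs.1]⟩

end MidPoint

/-- The part of the weight `rho` at frequencies above `σ⁻²`. -/
def rhoHi (ℓ₁ ℓ₂ α σ : ℝ) (k : ℤ × ℤ) : ℝ :=
  if 1 < σ ^ 2 * rho ℓ₁ ℓ₂ α k then rho ℓ₁ ℓ₂ α k else 0

theorem rhoHi_nonneg {α : ℝ} (hα : 1 < α) (σ : ℝ) (k : ℤ × ℤ) : 0 ≤ rhoHi ℓ₁ ℓ₂ α σ k := by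
  rw [rhoHi]; split_ifs
  · exact rho_nonneg hα k
  · exact le_rfl

theorem rhoHi_le {α : ℝ} (hα : 1 < α) (σ : ℝ) (k : ℤ × ℤ) :
    rhoHi ℓ₁ ℓ₂ α σ k ≤ rho ℓ₁ ℓ₂ α k := by
  rw [rhoHi]; split_ifs
  · exact le_rfl
  · exact rho_nonneg hα k

/-- Below the cut-off, passing from L² to H^{α/2} costs only a factor σ⁻¹ in the norm. -/
theorem rho_le_add_rhoHi {α σ : ℝ} (hσ : 0 < σ) (k : ℤ × ℤ) :
    rho ℓ₁ ℓ₂ α k ≤ (σ⁻¹) ^ 2 * 1 + 1 ^ 2 * rhoHi ℓ₁ ℓ₂ α σ k := by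
  rw [rhoHi]; split_ifs with h
  · have : 0 ≤ σ⁻¹ ^ 2 := by positivity
    linarith
  · rw [not_lt] at h
    rw [inv_pow, mul_one, mul_zero, add_zero, ← one_div, le_div_iff₀ (by positivity)]
    linarith

/-- Above the cut-off σ² rho exceeds 1 and may be inserted n times. Each extra power of `rho`
available in the regularity buys one factor σ in the norm. -/
theorem rhoHi_mul_pow_le {α σ : ℝ} (hα : 1 < α) (n : ℕ) (k : ℤ × ℤ) :
    rhoHi ℓ₁ ℓ₂ α σ k ≤ (σ ^ n) ^ 2 * rho ℓ₁ ℓ₂ α k ^ (n + 1) := by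
  have h0 := rho_nonneg (ℓ₁ := ℓ₁) (ℓ₂ := ℓ₂) hα k
  rw [rhoHi]; split_ifs with h
  · calc rho ℓ₁ ℓ₂ α k = rho ℓ₁ ℓ₂ α k * 1 ^ n := by rw [one_pow, mul_one]
      _ ≤ rho ℓ₁ ℓ₂ α k * (σ ^ 2 * rho ℓ₁ ℓ₂ α k) ^ n := by gcongr
      _ = _ := by ring
  · positivity

/-- Multiplication of a sequence by the symbol of `(-Δ)^{α/2}`. -/
def muMul (ℓ₁ ℓ₂ α : ℝ) (c : ℤ × ℤ → ℂ) (k : ℤ × ℤ) : ℂ := (mu ℓ₁ ℓ₂ α k : ℂ) * c k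

theorem norm_muMul_sq {α : ℝ} (c : ℤ × ℤ → ℂ) (k : ℤ × ℤ) :
    ‖muMul ℓ₁ ℓ₂ α c k‖ ^ 2 = mu ℓ₁ ℓ₂ α k ^ 2 * ‖c k‖ ^ 2 := by
  rw [muMul, norm_mul, mul_pow, Complex.norm_real, Real.norm_eq_abs, sq_abs]

theorem Bd.muMul {α C : ℝ} (hα : 1 < α) {c : ℤ × ℤ → ℂ} (h : Bd (rho2 ℓ₁ ℓ₂ α) c C) :
    Bd (fun _ => 1) (muMul ℓ₁ ℓ₂ α c) C := by
  simpa using h.of_le zero_le_one (fun _ => zero_le_one) fun k => by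
    rw [norm_muMul_sq, one_mul, one_pow, one_mul]
    exact mul_le_mul_of_nonneg_right (pow_le_pow_left₀ (mu_nonneg _ _) (mu_le_rho hα k) 2) (sq_nonneg _)

theorem Bd.hi {α C σ : ℝ} (hα : 1 < α) (hσ : 0 ≤ σ) {c : ℤ × ℤ → ℂ} (h : Bd (rho7 ℓ₁ ℓ₂ α) c C) :
    Bd (rhoHi ℓ₁ ℓ₂ α σ) c (σ ^ 6 * C) :=
  h.mono_weight (by positivity) (rhoHi_nonneg hα σ) fun k => rhoHi_mul_pow_le hα 6 k

theorem Bd.muMul_rho {α C : ℝ} (hα : 1 < α) {c : ℤ × ℤ → ℂ} (h : Bd (rho7 ℓ₁ ℓ₂ α) c C) :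
    Bd (rho ℓ₁ ℓ₂ α) (SAVWave.muMul ℓ₁ ℓ₂ α c) C := by
  simpa using h.of_le zero_le_one (rho_nonneg hα) (c' := SAVWave.muMul ℓ₁ ℓ₂ α c) fun k => by
    rw [norm_muMul_sq, one_pow, one_mul, ← mul_assoc]
    refine mul_le_mul_of_nonneg_right ?_ (sq_nonneg _)
    calc rho ℓ₁ ℓ₂ α k * mu ℓ₁ ℓ₂ α k ^ 2 ≤ rho ℓ₁ ℓ₂ α k * rho ℓ₁ ℓ₂ α k ^ 2 :=
          mul_le_mul_of_nonneg_left (pow_le_pow_left₀ (mu_nonneg _ _) (mu_le_rho hα k) 2)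
            (rho_nonneg hα k)
      _ = rho ℓ₁ ℓ₂ α k ^ 3 := by ring
      _ ≤ rho ℓ₁ ℓ₂ α k ^ 7 := pow_le_pow_right₀ (one_le_rho hα k) (by norm_num)

theorem Bd.muMul_hi {α C σ : ℝ} (hα : 1 < α) (hσ : 0 ≤ σ) {c : ℤ × ℤ → ℂ}
    (h : Bd (rho7 ℓ₁ ℓ₂ α) c C) :
    Bd (rhoHi ℓ₁ ℓ₂ α σ) (SAVWave.muMul ℓ₁ ℓ₂ α c) (σ ^ 4 * C) :=
  h.of_le (by positivity) (rhoHi_nonneg hα σ) fun k => by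
    rw [norm_muMul_sq, ← mul_assoc, ← mul_assoc]
    refine mul_le_mul_of_nonneg_right ?_ (sq_nonneg _)
    have h1 := rhoHi_mul_pow_le (ℓ₁ := ℓ₁) (ℓ₂ := ℓ₂) (σ := σ) hα 4 k
    have h2 := rho_nonneg (ℓ₁ := ℓ₁) (ℓ₂ := ℓ₂) hα k
    calc rhoHi ℓ₁ ℓ₂ α σ k * mu ℓ₁ ℓ₂ α k ^ 2
        ≤ ((σ ^ 4) ^ 2 * rho ℓ₁ ℓ₂ α k ^ 5) * rho ℓ₁ ℓ₂ α k ^ 2 :=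
          mul_le_mul h1 (pow_le_pow_left₀ (mu_nonneg _ _) (mu_le_rho hα k) 2) (sq_nonneg _)
            (by positivity)
      _ = _ := by rw [rho7]; ring

variable {T m L : ℝ} {φ₀ φ₁ : L2per ℓ₁ ℓ₂} {u v a j : ℝ → L2per ℓ₁ ℓ₂}

/-- The truncation error of the equation `u_t = v`. -/
def defectU (u v : ℝ → L2per ℓ₁ ℓ₂) (h c : ℝ) : ℤ × ℤ → ℂ :=
  (1 / (2 * h)) • (fcoeff (u (c + h)) - fcoeff (u (c - h)))
    - (1 / 2 : ℝ) • (fcoeff (v (c + h)) + fcoeff (v (c - h)))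

/-- The truncation error of the second equation, with `γ₁ (-Δ)^{α/2} v` replaced by the
difference quotient of `γ₁ (-Δ)^{α/2} u`. -/
def defectV (P : Model) (u v : ℝ → L2per ℓ₁ ℓ₂) (h c : ℝ) : ℤ × ℤ → ℂ :=
  (1 / (2 * h)) • (fcoeff (v (c + h)) - fcoeff (v (c - h)))
    + (P.γ₁ / (2 * h)) • muMul ℓ₁ ℓ₂ P.α (fcoeff (u (c + h)) - fcoeff (u (c - h)))
    + (P.κ / 2) • muMul ℓ₁ ℓ₂ P.α (fcoeff (u (c + h)) + fcoeff (u (c - h)))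
    + (P.γ₂ / 2) • (fcoeff (v (c + h)) + fcoeff (v (c - h)))
    + ((P.sav (u (c + h)) + P.sav (u (c - h))) / 2) • fcoeff (P.b (u c))

namespace ExactData

variable (D : ExactData P T m L φ₀ φ₁ u v a j) {h σ c : ℝ}
include D

theorem bd_diff_u {p q : ℝ} (hp : 0 ≤ p) (hpq : p ≤ q) (hq : q ≤ T) :
    Bd (rho7 ℓ₁ ℓ₂ P.α) (fcoeff (u q) - fcoeff (u p)) (L * (q - p)) :=
  Bd.mvt (f := fun t => fcoeff (u t)) (f' := fun t => fcoeff (v t)) (rho7_nonneg D.valid.hα) hpq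
    (fun k => (D.cont_u k).mono (Icc_subset_Icc hp hq))
    (fun t ht k => D.deriv_u ⟨hp.trans_lt ht.1, ht.2.trans_le hq⟩ k)
    fun t ht => D.bd_v ⟨hp.trans ht.1.le, ht.2.le.trans hq⟩

theorem bd_second_diff_u {s : ℝ} (hc : c ∈ Ioo 0 T) (h1 : c + s ∈ Icc 0 T) (h2 : c - s ∈ Icc 0 T) :
    Bd (rho2 ℓ₁ ℓ₂ P.α) (fcoeff (u (c + s)) + fcoeff (u (c - s)) - (2 : ℝ) • fcoeff (u c))
      (2 * L * s ^ 2) :=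
  Bd.second_diff (f := fun t => fcoeff (u t)) (f' := fun t => fcoeff (v t))
    (f'' := fun t => fcoeff (a t)) (rho2_nonneg P.α) D.cont_u (fun t ht k => D.deriv_u ht k)
    (fun t ht k => D.deriv_v ht k) (fun t ht => D.bd_a ht) hc h1 h2

theorem bd_second_diff_v {s : ℝ} (hc : c ∈ Ioo 0 T) (h1 : c + s ∈ Icc 0 T) (h2 : c - s ∈ Icc 0 T) :
    Bd (rho ℓ₁ ℓ₂ P.α) (fcoeff (v (c + s)) + fcoeff (v (c - s)) - (2 : ℝ) • fcoeff (v c))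
      (2 * L * s ^ 2) :=
  Bd.second_diff (f := fun t => fcoeff (v t)) (f' := fun t => fcoeff (a t))
    (f'' := fun t => fcoeff (j t)) (rho_nonneg D.valid.hα) D.cont_v (fun t ht k => D.deriv_v ht k)
    (fun t ht k => D.deriv_a ht k) (fun t ht => D.bd_j ht) hc h1 h2

theorem bd_symm_diff_u (H : MidPoint T h σ c) :
    Bd (rho ℓ₁ ℓ₂ P.α) (fcoeff (u (c + h)) - fcoeff (u (c - h)) - (2 * h) • fcoeff (v c))
      (2 * L * h ^ 2 * h) :=
  Bd.symm_diff (f := fun t => fcoeff (u t)) (f' := fun t => fcoeff (v t)) (rho_nonneg D.valid.hα)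
    H.h_pos.le H.hi H.lo D.cont_u (fun t ht k => D.deriv_u ht k) fun s hs =>
    (D.bd_second_diff_v H.c_mem (Ioo_subset_Icc_self (H.add_mem hs))
      (Ioo_subset_Icc_self (H.sub_mem hs))).le (by
        have := D.L_nonneg
        exact mul_le_mul_of_nonneg_left (pow_le_pow_left₀ hs.1.le hs.2.le 2) (by positivity))

/-- The defect is O(h²) = O(σ⁴) in H^{α/2}, because u_ttt is bounded there, and O(1) in H^{7α/2}.
Interpolating to H^α loses one factor σ. -/
theorem bd_defectU (H : MidPoint T h σ c) :
    Bd (rho2 ℓ₁ ℓ₂ P.α) (defectU u v h c) (3 * L * σ ^ 3) := by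
  have hh := H.h_pos
  have hσ := H.pos
  have hL := D.L_nonneg
  have b1 : Bd (rho ℓ₁ ℓ₂ P.α) (defectU u v h c) (2 * L * h ^ 2) := by
    have e : defectU u v h c
        = (1 / (2 * h)) • (fcoeff (u (c + h)) - fcoeff (u (c - h)) - (2 * h) • fcoeff (v c))
          - (1 / 2 : ℝ) • (fcoeff (v (c + h)) + fcoeff (v (c - h)) - (2 : ℝ) • fcoeff (v c)) := by
      have h2 : 1 / (2 * h) * (2 * h) = 1 := by field_simp
      rw [defectU, smul_sub (1 / (2 * h)) _ ((2 * h) • _), smul_smul, h2]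
      module
    rw [e]
    refine (((D.bd_symm_diff_u H).smul _).sub
      ((D.bd_second_diff_v H.c_mem H.right_mem H.left_mem).smul _)).le (le_of_eq ?_)
    rw [abs_of_pos (by positivity), abs_of_pos (by norm_num)]
    field_simp
    ring
  have b2 : Bd (rho7 ℓ₁ ℓ₂ P.α) (defectU u v h c) (2 * L) := by
    refine (((D.bd_diff_u H.lo (by linarith) H.hi).smul _).sub
      (((D.bd_v H.right_mem).add (D.bd_v H.left_mem)).smul _)).le (le_of_eq ?_)
    rw [abs_of_pos (by positivity), abs_of_pos (by norm_num)]
    field_simp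
    ring
  -- The weight inequality is x² ≤ σ⁻² x + σ¹⁰ x⁷ with x = rho. The first summand suffices when σ² x
  -- ≤ 1 and the second when σ² x ≥ 1.
  have h3 := b1.interp b2 (A := σ⁻¹) (B := σ ^ 5) (by positivity) (by positivity)
    (rho2_nonneg (ℓ₁ := ℓ₁) (ℓ₂ := ℓ₂) P.α) fun k => ?_
  · refine h3.le ?_
    have e : h = σ ^ 2 / 2 := by linarith [H.hh]
    have e2 : σ⁻¹ * (2 * L * h ^ 2) = L / 2 * σ ^ 3 := by rw [e]; field_simp
    have h4 : σ ^ 5 ≤ σ ^ 3 := pow_le_pow_of_le_one hσ.le (by linarith [H.small]) (by norm_num)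
    rw [e2]
    have : σ ^ 5 * (2 * L) ≤ 2 * L * σ ^ 3 := by nlinarith
    have : 0 ≤ L * σ ^ 3 := by positivity
    linarith
  · have hr := rho_nonneg (ℓ₁ := ℓ₁) (ℓ₂ := ℓ₂) D.valid.hα k
    rw [rho2, rho7]
    set x := rho ℓ₁ ℓ₂ P.α k
    rcases le_total (σ ^ 2 * x) 1 with hx | hx
    · have : x ^ 2 ≤ σ⁻¹ ^ 2 * x := by
        rw [inv_pow, ← div_eq_inv_mul, le_div_iff₀ (by positivity)]
        nlinarith
      have h5 : 0 ≤ (σ ^ 5) ^ 2 * x ^ 7 := by positivity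
      linarith
    · have : x ^ 2 * 1 ^ 5 ≤ x ^ 2 * (σ ^ 2 * x) ^ 5 := by gcongr
      have h5 : 0 ≤ σ⁻¹ ^ 2 * x := by positivity
      have e : x ^ 2 * (σ ^ 2 * x) ^ 5 = (σ ^ 5) ^ 2 * x ^ 7 := by ring
      linarith

theorem abs_sav_le {t : ℝ} (ht : t ∈ Icc 0 T) : |P.sav (u t)| ≤ L := by
  have := nhdsWithin_Ioo_neBot D.hT ht
  exact le_of_tendsto (((D.continuousOn_sav t ht).mono_left
    (nhdsWithin_mono _ Ioo_subset_Icc_self)).norm)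
    (eventually_nhdsWithin_of_forall fun s hs => (D.bounds_Ioo hs).2.2.2.2.1)

theorem abs_mean_sav_sub_le (H : MidPoint T h σ c) :
    |(P.sav (u (c + h)) + P.sav (u (c - h))) / 2 - P.sav (u c)| ≤ L * h ^ 2 := by
  have h1 := norm_second_diff_le (f := fun t => P.sav (u t)) D.continuousOn_sav
    (fun t ht => D.deriv_sav ht (i := 0) (by norm_num))
    (fun t ht => D.deriv_sav ht (i := 1) (by norm_num))
    (fun t ht => (D.bounds_Ioo ht).2.2.2.2.2.1) H.c_mem H.right_mem H.left_mem
  rw [Real.norm_eq_abs, smul_eq_mul] at h1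
  have e : (P.sav (u (c + h)) + P.sav (u (c - h))) / 2 - P.sav (u c)
      = (P.sav (u (c + h)) + P.sav (u (c - h)) - 2 * P.sav (u c)) / 2 := by ring
  rw [e, abs_div, abs_two]
  linarith

theorem abs_symm_diff_sav_le (H : MidPoint T h σ c) :
    |P.sav (u (c + h)) - P.sav (u (c - h)) - 2 * h * iteratedDeriv 1 (fun s => P.sav (u s)) c|
      ≤ 2 * L * h ^ 2 * h := by
  have hL := D.L_nonneg
  have h1 := norm_symm_diff_le (f := fun t => P.sav (u t)) (D := 2 * L * h ^ 2) H.h_pos.le H.hi H.lo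
    D.continuousOn_sav (fun t ht => D.deriv_sav ht (i := 0) (by norm_num)) (fun s hs => ?_)
  · exact h1
  · have h2 := norm_second_diff_le (f := iteratedDeriv 1 fun t => P.sav (u t)) (a := c - s) (b := c + s)
      (C := L) (c := c) (h := s)
      (fun t ht => (D.deriv_sav (i := 1) ?_ (by norm_num)).continuousAt.continuousWithinAt)
      (fun t ht => D.deriv_sav (i := 1) ?_ (by norm_num))
      (fun t ht => D.deriv_sav (i := 2) ?_ (by norm_num))
      (fun t ht => (D.bounds_Ioo ?_).2.2.2.2.2.2) ⟨by linarith [hs.1], by linarith [hs.1]⟩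
      (right_mem_Icc.2 (by linarith [hs.1])) (left_mem_Icc.2 (by linarith [hs.1]))
    · exact h2.trans (mul_le_mul_of_nonneg_left (pow_le_pow_left₀ hs.1.le hs.2.le 2) (by positivity))
    all_goals
      have q1 := (H.add_mem hs).2
      have q2 := (H.sub_mem hs).1
      exact ⟨by linarith [ht.1], by linarith [ht.2]⟩

end ExactData

end

/-! ### Truncation errors of the second and third equations -/

section

variable {ℓ₁ ℓ₂ : ℝ} [Fact (0 < ℓ₁)] [Fact (0 < ℓ₂)] {P : Model}
variable {T m L : ℝ} {φ₀ φ₁ : L2per ℓ₁ ℓ₂} {u v a j : ℝ → L2per ℓ₁ ℓ₂}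

namespace ExactData

variable (D : ExactData P T m L φ₀ φ₁ u v a j) {h σ c : ℝ}
include D

theorem exists_bd_second_diff_dF : ∃ C, 0 ≤ C ∧ ∀ c s : ℝ, c ∈ Ioo 0 T → 0 ≤ s → c + s ∈ Icc 0 T →
    c - s ∈ Icc 0 T → Bd (fun _ => 1)
      (fcoeff (P.dF (u (c + s))) + fcoeff (P.dF (u (c - s))) - (2 : ℝ) • fcoeff (P.dF (u c)))
      (C * s ^ 2) := by
  set cS := sobolevConst ℓ₁ ℓ₂ P.α with hcS
  have hcS0 : 0 ≤ cS := sobolevConst_nonneg _ _ _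
  obtain ⟨Λ, hΛ⟩ := exists_potentialBound D.smooth (cS * L)
  have hn := hΛ.nonneg
  have hL := D.L_nonneg
  refine ⟨Λ * (2 * L) + Λ * cS * L * (2 * L), by positivity, fun c s hc hs h1 h2 => ?_⟩
  have hcI := Ioo_subset_Icc_self hc
  set A := √(ℓ₁ * ℓ₂) with hA
  have hA0 : 0 ≤ A := Real.sqrt_nonneg _
  have hα := D.valid.hα
  have d1 : Bd (rho2 ℓ₁ ℓ₂ P.α) (fcoeff (u (c + s) - u c)) (L * s) := by
    rw [fcoeff_sub]
    exact ((D.bd_diff_u hc.1.le (by linarith) h1.2).rho2_of_rho7 hα).le (le_of_eq (by ring))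
  have d2 : Bd (rho2 ℓ₁ ℓ₂ P.α) (fcoeff (u (c - s) - u c)) (L * s) := by
    rw [← neg_sub, ← neg_one_smul ℝ, fcoeff_smul, fcoeff_sub, neg_one_smul]
    exact ((D.bd_diff_u h2.1 (by linarith) hc.2.le).rho2_of_rho7 hα).neg.le (le_of_eq (by ring))
  have d3 := D.bd_second_diff_u hc h1 h2
  rw [← fcoeff_add, ← fcoeff_smul, ← fcoeff_sub] at d3
  have n1 := ((d1.rho_of_rho2 hα).one_of_rho hα).norm_L2_le
  have n2 := ((d2.rho_of_rho2 hα).one_of_rho hα).norm_L2_le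
  have n3 := ((d3.rho_of_rho2 hα).one_of_rho hα).norm_L2_le
  rw [← fcoeff_add, ← fcoeff_smul, ← fcoeff_sub]
  refine bd_of_norm_L2_le ((hΛ.norm_second_diff_dF_le D.smooth (D.ae_abs_u_le hcI) (D.ae_abs_u_le h1)
    (D.ae_abs_u_le h2) (by positivity) (d1.ae_abs_le hα) (d2.ae_abs_le hα)).trans ?_)
  calc _ ≤ Λ * (A * (2 * L * s ^ 2)) + Λ * (cS * (L * s)) * (A * (L * s) + A * (L * s)) := by
        gcongr
    _ = _ := by ring

/-- Only v is very regular, so u_tt is approximated by the quotient (v(c + σ³) − v(c))/σ³. At high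
frequencies the quotient is at most 2Lσ⁶/σ³, and the Taylor remainder in H^{α/2} is at most Lσ³. The
increment σ³ balances the two. -/
theorem bd_a_hi (H : MidPoint T h σ c) :
    Bd (rhoHi ℓ₁ ℓ₂ P.α σ) (fcoeff (a c)) (3 * L * σ ^ 3) := by
  have hσ := H.pos
  have hL := D.L_nonneg
  have hα := D.valid.hα
  have hx : c + σ ^ 3 ∈ Icc 0 T := by
    have h1 := H.c_mem
    -- The bound σ ≤ 1/2 gives σ³ ≤ σ²/2 = h, which keeps the evaluation point inside [0, T].
    have h2 : σ ^ 3 ≤ h := by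
      have := H.hh; have := H.small
      have e : σ ^ 3 = σ * σ ^ 2 := by ring
      rw [e]; nlinarith [sq_nonneg σ]
    exact ⟨by have := h1.1; positivity, by linarith [H.hi]⟩
  have h1 := Bd.taylor_one (f := fun t => fcoeff (v t)) (f' := fun t => fcoeff (a t))
    (f'' := fun t => fcoeff (j t)) (rho_nonneg hα) D.cont_v (fun t ht k => D.deriv_v ht k)
    (fun t ht k => D.deriv_a ht k) (fun t ht => D.bd_j ht) H.c_mem hx
  have h2 := ((D.bd_v hx).sub (D.bd_v (Ioo_subset_Icc_self H.c_mem))).hi hα (σ := σ)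
    hσ.le
  have h3 := (h2.smul (σ ^ 3)⁻¹).sub ((h1.mono (rhoHi_nonneg hα σ) (rhoHi_le hα σ)).smul (σ ^ 3)⁻¹)
  have e : (σ ^ 3)⁻¹ • (fcoeff (v (c + σ ^ 3)) - fcoeff (v c)) - (σ ^ 3)⁻¹ •
      (fcoeff (v (c + σ ^ 3)) - fcoeff (v c) - (c + σ ^ 3 - c) • fcoeff (a c)) = fcoeff (a c) := by
    rw [add_sub_cancel_left, ← smul_sub, sub_sub_cancel, smul_smul, inv_mul_cancel₀ (by positivity),
      one_smul]
  rw [e] at h3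
  refine h3.le (le_of_eq ?_)
  rw [abs_of_pos (by positivity)]
  field_simp
  ring

/-- By the equation, v + γ₁(-Δ)^{α/2}u has time derivative −(κ(-Δ)^{α/2}u + γ₂v + F'(u)). Second
differences of that are quadratic in L², because u_tt is bounded in H^α and u_ttt in H^{α/2}. -/
theorem exists_bd_defectV_one : ∃ C, 0 ≤ C ∧ ∀ h σ c : ℝ, MidPoint T h σ c →
    Bd (fun _ => 1) (defectV P u v h c) (C * h ^ 2) := by
  obtain ⟨C₁, hC₁, hdF⟩ := D.exists_bd_second_diff_dF
  obtain ⟨c₀, hc₀, hE⟩ := D.exists_energy_lower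
  have hL := D.L_nonneg
  have hα := D.valid.hα
  have hκ := D.valid.hκ
  have hγ₂ := D.valid.hγ₂
  obtain ⟨C₂, hC₂, hb⟩ := exists_b_bound (ℓ₁ := ℓ₁) (ℓ₂ := ℓ₂) D.smooth hα D.valid.hα' hL hc₀
  set C₃ := P.κ * (2 * L) + P.γ₂ * (2 * L) + C₁ with hC₃
  have hC₃0 : 0 ≤ C₃ := by positivity
  refine ⟨C₃ + P.κ * L + P.γ₂ * L + L * C₂, by positivity, fun h σ c H => ?_⟩
  have hh := H.h_pos
  have hcI := Ioo_subset_Icc_self H.c_mem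
  have key : Bd (fun _ => 1) ((fun k => fcoeff (v (c + h)) k + P.γ₁ * muMul ℓ₁ ℓ₂ P.α (fcoeff (u (c + h))) k)
      - (fun k => fcoeff (v (c - h)) k + P.γ₁ * muMul ℓ₁ ℓ₂ P.α (fcoeff (u (c - h))) k)
      - (2 * h) • (fun k => fcoeff (a c) k + P.γ₁ * muMul ℓ₁ ℓ₂ P.α (fcoeff (v c)) k))
      (C₃ * h ^ 2 * h) := by
    refine Bd.symm_diff (f := fun t k => fcoeff (v t) k + P.γ₁ * muMul ℓ₁ ℓ₂ P.α (fcoeff (u t)) k)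
      (f' := fun t k => fcoeff (a t) k + P.γ₁ * muMul ℓ₁ ℓ₂ P.α (fcoeff (v t)) k)
      (fun _ => zero_le_one) hh.le H.hi H.lo (fun k => ?_) (fun t ht k => ?_) (fun s hs => ?_)
    · exact (D.cont_v k).add ((D.cont_u k).const_mul _ |>.const_mul _)
    · exact (D.deriv_v ht k).fun_add (((D.deriv_u ht k).const_mul _).const_mul _)
    · have m1 := H.add_mem hs
      have m2 := H.sub_mem hs
      have m1' := Ioo_subset_Icc_self m1
      have m2' := Ioo_subset_Icc_self m2
      have b1 := (D.bd_second_diff_u H.c_mem m1' m2').muMul hα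
      have b2 := (D.bd_second_diff_v H.c_mem m1' m2').one_of_rho hα
      have b3 := hdF c s H.c_mem hs.1.le m1' m2'
      have b4 := ((b1.smul P.κ).add (b2.smul P.γ₂)).add b3
      have e : ((fun k => fcoeff (a (c + s)) k + P.γ₁ * muMul ℓ₁ ℓ₂ P.α (fcoeff (v (c + s))) k)
          + (fun k => fcoeff (a (c - s)) k + P.γ₁ * muMul ℓ₁ ℓ₂ P.α (fcoeff (v (c - s))) k)
          - (2 : ℝ) • (fun k => fcoeff (a c) k + P.γ₁ * muMul ℓ₁ ℓ₂ P.α (fcoeff (v c)) k))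
          = -(P.κ • muMul ℓ₁ ℓ₂ P.α (fcoeff (u (c + s)) + fcoeff (u (c - s)) - (2 : ℝ) • fcoeff (u c))
            + P.γ₂ • (fcoeff (v (c + s)) + fcoeff (v (c - s)) - (2 : ℝ) • fcoeff (v c))
            + (fcoeff (P.dF (u (c + s))) + fcoeff (P.dF (u (c - s)))
              - (2 : ℝ) • fcoeff (P.dF (u c)))) := by
        ext k
        simp only [Pi.add_apply, Pi.sub_apply, Pi.neg_apply, Pi.smul_apply, muMul, Complex.real_smul,
          Complex.ofReal_ofNat]
        linear_combination D.eqn_mode m1 k + D.eqn_mode m2 k - 2 * D.eqn_mode H.c_mem k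
      rw [e]
      refine b4.neg.le ?_
      rw [abs_of_pos hκ, abs_of_nonneg hγ₂]
      calc _ = C₃ * s ^ 2 := by rw [hC₃]; ring
        _ ≤ _ := mul_le_mul_of_nonneg_left (pow_le_pow_left₀ hs.1.le hs.2.le 2) hC₃0
  have b1 := (D.bd_second_diff_u H.c_mem H.right_mem H.left_mem).muMul hα
  have b2 := (D.bd_second_diff_v H.c_mem H.right_mem H.left_mem).one_of_rho hα
  have b3 := ((hb (u c) ⟨D.bd2_u hcI, hE c hcI⟩).1).one_of_rho hα
  have b4 := (((key.smul (1 / (2 * h))).add (b1.smul (P.κ / 2))).add (b2.smul (P.γ₂ / 2))).add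
    (b3.smul ((P.sav (u (c + h)) + P.sav (u (c - h))) / 2 - P.sav (u c)))
  -- The equation at time c, multiplied out with r b(u) = F'(u), is subtracted. What remains are one
  -- symmetric difference and three deviations of means from midpoint values.
  have e : defectV P u v h c = (1 / (2 * h)) •
      ((fun k => fcoeff (v (c + h)) k + P.γ₁ * muMul ℓ₁ ℓ₂ P.α (fcoeff (u (c + h))) k)
      - (fun k => fcoeff (v (c - h)) k + P.γ₁ * muMul ℓ₁ ℓ₂ P.α (fcoeff (u (c - h))) k)
      - (2 * h) • (fun k => fcoeff (a c) k + P.γ₁ * muMul ℓ₁ ℓ₂ P.α (fcoeff (v c)) k))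
      + (P.κ / 2) • muMul ℓ₁ ℓ₂ P.α (fcoeff (u (c + h)) + fcoeff (u (c - h)) - (2 : ℝ) • fcoeff (u c))
      + (P.γ₂ / 2) • (fcoeff (v (c + h)) + fcoeff (v (c - h)) - (2 : ℝ) • fcoeff (v c))
      + ((P.sav (u (c + h)) + P.sav (u (c - h))) / 2 - P.sav (u c)) • fcoeff (P.b (u c)) := by
    ext k
    have hb1 : ((1 / (2 * h) : ℝ) : ℂ) * ((2 * h : ℝ) : ℂ) = 1 := by
      rw [← Complex.ofReal_mul, one_div_mul_cancel (by positivity), Complex.ofReal_one]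
    have hb2 := congrArg (fun w => fcoeff w k) (D.sav_smul_b hcI)
    simp only [fcoeff_smul, Pi.smul_apply, Complex.real_smul] at hb2
    have hb3 : ((P.γ₁ / (2 * h) : ℝ) : ℂ) = P.γ₁ * ((1 / (2 * h) : ℝ) : ℂ) := by push_cast; ring
    have hq := D.eqn_mode H.c_mem k
    simp only [defectV, Pi.add_apply, Pi.sub_apply, Pi.smul_apply, muMul, Complex.real_smul,
      Complex.ofReal_ofNat, hb3, Complex.ofReal_sub, Complex.ofReal_div]
    simp only [Complex.ofReal_div] at hb1
    linear_combination hq + hb2 + (fcoeff (a c) k + P.γ₁ * (mu ℓ₁ ℓ₂ P.α k * fcoeff (v c) k)) * hb1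
  rw [e]
  refine b4.le ?_
  have hr := mul_le_mul_of_nonneg_right (D.abs_mean_sav_sub_le H) hC₂
  rw [abs_of_pos (by positivity : 0 < 1 / (2 * h)), abs_of_pos (by positivity : 0 < P.κ / 2),
    abs_of_nonneg (by positivity : 0 ≤ P.γ₂ / 2)]
  have e2 : 1 / (2 * h) * (C₃ * h ^ 2 * h) = C₃ * h ^ 2 / 2 := by field_simp
  have : 0 ≤ C₃ * h ^ 2 := by positivity
  rw [e2]
  nlinarith

/-- Below the cut-off the L² bound O(σ⁴) is multiplied by σ⁻¹. Above it no cancellation is used,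
because every term of the defect is O(σ³) on its own. -/
theorem exists_bd_defectV : ∃ C, 0 ≤ C ∧ ∀ h σ c : ℝ, MidPoint T h σ c →
    Bd (rho ℓ₁ ℓ₂ P.α) (defectV P u v h c) (C * σ ^ 3) := by
  obtain ⟨C₁, hC₁, h1⟩ := D.exists_bd_defectV_one
  obtain ⟨c₀, hc₀, hE⟩ := D.exists_energy_lower
  have hL := D.L_nonneg
  have hα := D.valid.hα
  have hκ := D.valid.hκ
  have hγ₁ := D.valid.hγ₁
  have hγ₂ := D.valid.hγ₂
  have hs := Real.sqrt_pos.2 hc₀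
  set C₂ := 3 * L + P.κ * L + P.γ₁ * L + P.γ₂ * L with hC₂
  have hC₂0 : 0 ≤ C₂ := by positivity
  set C₃ := 2 * L + P.γ₁ * L + P.κ * L + P.γ₂ * L + L / √c₀ * C₂ with hC₃
  have hC₃0 : 0 ≤ C₃ := by positivity
  refine ⟨C₁ + C₃, by positivity, fun h σ c H => ?_⟩
  have hh := H.h_pos
  have hσ := H.pos
  have hσ1 : σ ≤ 1 := by linarith [H.small]
  have hcI := Ioo_subset_Icc_self H.c_mem
  have p4 : σ ^ 4 ≤ σ ^ 3 := pow_le_pow_of_le_one hσ.le hσ1 (by norm_num)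
  have p6 : σ ^ 6 ≤ σ ^ 3 := pow_le_pow_of_le_one hσ.le hσ1 (by norm_num)
  -- Composition with F gives F'(u) no more than H^{α/2} regularity here. Its decay at high
  -- frequencies is taken from the equation instead.
  have hf : Bd (rhoHi ℓ₁ ℓ₂ P.α σ) (fcoeff (P.dF (u c))) (C₂ * σ ^ 3) := by
    have e : fcoeff (P.dF (u c)) = -(fcoeff (a c) + P.κ • muMul ℓ₁ ℓ₂ P.α (fcoeff (u c))
        + P.γ₁ • muMul ℓ₁ ℓ₂ P.α (fcoeff (v c)) + P.γ₂ • fcoeff (v c)) := by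
      ext k
      simp only [Pi.add_apply, Pi.neg_apply, Pi.smul_apply, muMul, Complex.real_smul]
      linear_combination D.eqn_mode H.c_mem k
    rw [e]
    refine ((((D.bd_a_hi H).add (((D.bd_u hcI).muMul_hi hα hσ.le).smul P.κ)).add
      (((D.bd_v hcI).muMul_hi hα hσ.le).smul P.γ₁)).add
      (((D.bd_v hcI).hi hα hσ.le).smul P.γ₂)).neg.le ?_
    rw [abs_of_pos hκ, abs_of_nonneg hγ₁, abs_of_nonneg hγ₂]
    calc _ ≤ 3 * L * σ ^ 3 + P.κ * (σ ^ 3 * L) + P.γ₁ * (σ ^ 3 * L) + P.γ₂ * (σ ^ 3 * L) := by gcongr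
      _ = C₂ * σ ^ 3 := by rw [hC₂]; ring
  have hbc : Bd (rhoHi ℓ₁ ℓ₂ P.α σ)
      (((P.sav (u (c + h)) + P.sav (u (c - h))) / 2) • fcoeff (P.b (u c))) (L / √c₀ * (C₂ * σ ^ 3)) := by
    have e : fcoeff (P.b (u c)) = (1 / √(P.E (u c))) • fcoeff (P.dF (u c)) := by
      rw [Model.b, fcoeff_smul]
    rw [e, smul_smul]
    refine (hf.smul _).le (mul_le_mul_of_nonneg_right ?_ (by positivity))
    rw [abs_mul, div_eq_mul_one_div L]
    refine mul_le_mul ?_ ?_ (abs_nonneg _) hL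
    · rw [abs_div, abs_two, div_le_iff₀ two_pos]
      refine (abs_add_le _ _).trans ?_
      linarith [D.abs_sav_le H.right_mem, D.abs_sav_le H.left_mem]
    · rw [abs_of_nonneg (by positivity)]
      exact one_div_le_one_div_of_le hs (Real.sqrt_le_sqrt (hE c hcI))
  have hhi : Bd (rhoHi ℓ₁ ℓ₂ P.α σ) (defectV P u v h c) (C₃ * σ ^ 3) := by
    have q1 := ((D.bd_v H.right_mem).sub (D.bd_v H.left_mem)).hi hα hσ.le
    have q2 := (D.bd_diff_u H.lo (by linarith) H.hi).muMul_hi hα hσ.le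
    have q3 := ((D.bd_u H.right_mem).add (D.bd_u H.left_mem)).muMul_hi hα hσ.le
    have q4 := ((D.bd_v H.right_mem).add (D.bd_v H.left_mem)).hi hα hσ.le
    refine (((((q1.smul (1 / (2 * h))).add (q2.smul (P.γ₁ / (2 * h)))).add (q3.smul (P.κ / 2))).add
      (q4.smul (P.γ₂ / 2))).add hbc).le ?_
    rw [abs_of_pos (by positivity : 0 < 1 / (2 * h)), abs_of_pos (by positivity : 0 < P.κ / 2),
      abs_of_nonneg (by positivity : 0 ≤ P.γ₂ / 2), abs_of_nonneg (by positivity : 0 ≤ P.γ₁ / (2 * h)),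
      H.hh]
    -- The division by τ = σ² takes back two of the six powers gained from H^{7α/2}.
    have e1 : 1 / σ ^ 2 * (σ ^ 6 * (L + L)) = σ ^ 4 * (2 * L) := by field_simp; ring
    have e2 : P.γ₁ / σ ^ 2 * (σ ^ 4 * (L * (c + h - (c - h)))) = σ ^ 4 * (P.γ₁ * L) := by
      have : c + h - (c - h) = σ ^ 2 := by rw [← H.hh]; ring
      rw [this]; field_simp
    rw [e1, e2]
    calc _ ≤ σ ^ 3 * (2 * L) + σ ^ 3 * (P.γ₁ * L) + P.κ / 2 * (σ ^ 3 * (L + L))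
          + P.γ₂ / 2 * (σ ^ 3 * (L + L)) + L / √c₀ * (C₂ * σ ^ 3) := by gcongr
      _ = C₃ * σ ^ 3 := by rw [hC₃]; ring
  refine ((h1 h σ c H).interp hhi (A := σ⁻¹) (B := 1) (by positivity) zero_le_one (rho_nonneg hα)
    (rho_le_add_rhoHi hσ)).le ?_
  have e : h = σ ^ 2 / 2 := by linarith [H.hh]
  have e2 : σ⁻¹ * (C₁ * h ^ 2) = C₁ * σ ^ 3 / 4 := by rw [e]; field_simp; ring
  have : 0 ≤ C₁ * σ ^ 3 := by positivity
  rw [e2]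
  linarith

/-- Since r_t = ½(b(u), v), the symmetric differences of r and of u match up to O(h³). The defect is
not divided by τ, and the weaker power σ⁵ = τσ³ puts it on a par with the other two. -/
theorem exists_abs_defectR_le : ∃ C, 0 ≤ C ∧ ∀ h σ c : ℝ, MidPoint T h σ c →
    |P.sav (u (c + h)) - P.sav (u (c - h)) - 1 / 2 * inner ℝ (P.b (u c)) (u (c + h) - u (c - h))|
      ≤ C * σ ^ 5 := by
  obtain ⟨c₀, hc₀, hE⟩ := D.exists_energy_lower
  have hL := D.L_nonneg
  have hα := D.valid.hα
  obtain ⟨C₂, hC₂, hb⟩ := exists_b_bound (ℓ₁ := ℓ₁) (ℓ₂ := ℓ₂) D.smooth hα D.valid.hα' hL hc₀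
  set A := √(ℓ₁ * ℓ₂) with hA
  have hA0 : 0 ≤ A := Real.sqrt_nonneg _
  set C₃ := 2 * L + A * C₂ * A * L with hC₃
  have hC₃0 : 0 ≤ C₃ := by positivity
  refine ⟨C₃, hC₃0, fun h σ c H => ?_⟩
  have hh := H.h_pos
  have hσ := H.pos
  have hσ1 : σ ≤ 1 := by linarith [H.small]
  have hcI := Ioo_subset_Icc_self H.c_mem
  have b1 := D.abs_symm_diff_sav_le H
  have b2 := (D.bd_symm_diff_u H).one_of_rho hα
  rw [← fcoeff_smul, ← fcoeff_sub, ← fcoeff_sub] at b2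
  have n2 := b2.norm_L2_le
  have n3 := (((hb (u c) ⟨D.bd2_u hcI, hE c hcI⟩).1).one_of_rho hα).norm_L2_le
  have h3 := abs_real_inner_le_norm (P.b (u c)) (u (c + h) - u (c - h) - (2 * h) • v c)
  have e : P.sav (u (c + h)) - P.sav (u (c - h)) - 1 / 2 * inner ℝ (P.b (u c)) (u (c + h) - u (c - h))
      = (P.sav (u (c + h)) - P.sav (u (c - h)) - 2 * h * iteratedDeriv 1 (fun s => P.sav (u s)) c)
        - 1 / 2 * inner ℝ (P.b (u c)) (u (c + h) - u (c - h) - (2 * h) • v c) := by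
    rw [D.deriv_sav_eq H.c_mem, inner_sub_right _ (u (c + h) - u (c - h)), inner_smul_right]
    ring
  rw [e]
  refine (abs_sub _ _).trans ?_
  rw [abs_mul, abs_of_pos (by norm_num : (0 : ℝ) < 1 / 2)]
  have h4 : |inner ℝ (P.b (u c)) (u (c + h) - u (c - h) - (2 * h) • v c)|
      ≤ (A * C₂) * (A * (2 * L * h ^ 2 * h)) :=
    h3.trans (mul_le_mul n3 n2 (norm_nonneg _) (by positivity))
  have h5 : h ^ 3 ≤ σ ^ 5 := by
    have e : h = σ ^ 2 / 2 := by linarith [H.hh]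
    have : σ ^ 6 ≤ σ ^ 5 := pow_le_pow_of_le_one hσ.le hσ1 (by norm_num)
    have : 0 ≤ σ ^ 6 := by positivity
    rw [e]; nlinarith
  calc _ ≤ 2 * L * h ^ 2 * h + 1 / 2 * ((A * C₂) * (A * (2 * L * h ^ 2 * h))) := by gcongr
    _ = C₃ * h ^ 3 := by rw [hC₃]; ring
    _ ≤ _ := mul_le_mul_of_nonneg_left h5 hC₃0

/-- The first order Taylor terms at t cancel, h − ½·2h = 0. The remainders at distances h and 2h add
up to h² + ½(2h)² = 3h². -/
theorem bd_extrapolation {t h : ℝ} (ht : t ∈ Ioo 0 T) (h1 : t + h ∈ Icc 0 T) (h2 : t - 2 * h ∈ Icc 0 T) :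
    Bd (rho2 ℓ₁ ℓ₂ P.α) (fcoeff (u (t + h) - (1 / 2 : ℝ) • ((3 : ℝ) • u t - u (t - 2 * h))))
      (3 * L * h ^ 2) := by
  have key : ∀ x ∈ Icc 0 T, Bd (rho2 ℓ₁ ℓ₂ P.α) (fcoeff (u x - u t - (x - t) • v t))
      (L * (x - t) ^ 2) := by
    intro x hx
    rw [fcoeff_sub, fcoeff_sub, fcoeff_smul]
    exact Bd.taylor_one (f := fun t => fcoeff (u t)) (f' := fun t => fcoeff (v t))
      (f'' := fun t => fcoeff (a t)) (rho2_nonneg P.α) D.cont_u (fun t ht k => D.deriv_u ht k)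
      (fun t ht k => D.deriv_v ht k) (fun t ht => D.bd_a ht) ht hx
  have e : u (t + h) - (1 / 2 : ℝ) • ((3 : ℝ) • u t - u (t - 2 * h))
      = (u (t + h) - u t - (t + h - t) • v t)
        + (1 / 2 : ℝ) • (u (t - 2 * h) - u t - (t - 2 * h - t) • v t) := by
    module
  rw [e, fcoeff_add, fcoeff_smul]
  refine ((key _ h1).add ((key _ h2).smul _)).le (le_of_eq ?_)
  rw [abs_of_pos (by norm_num : (0 : ℝ) < 1 / 2)]
  ring

end ExactData

end

/-! ### The energy inequality, mode by mode and summed -/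

section

variable {ℓ₁ ℓ₂ : ℝ} [Fact (0 < ℓ₁)] [Fact (0 < ℓ₂)] {P : Model}

/-- The first equation is tested with (1 + κ) times the mean of e, the second with the mean D of d.
The terms ±2κED cancel, so no constant grows with the frequency except in front of the defect p. The
damping −2gD² absorbs the cross term −2gDp at the price g p². -/
theorem modal_energy_step_real {e₀ e₁ d₀ d₁ p q n τ κ g γ : ℝ} (hτ : 0 ≤ τ) (hκ : 0 ≤ κ) (hg : 0 ≤ g)
    (hγ : 0 ≤ γ) (h1 : e₁ - e₀ = τ * ((d₁ + d₀) / 2 + p))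
    (h2 : d₁ - d₀ = τ * (-κ * ((e₁ + e₀) / 2) - (g + γ) * ((d₁ + d₀) / 2) + q - g * p - n)) :
    (1 + κ) * e₁ ^ 2 + d₁ ^ 2 ≤ (1 + κ) * e₀ ^ 2 + d₀ ^ 2
      + τ * (2 * (((1 + κ) * e₁ ^ 2 + d₁ ^ 2) + ((1 + κ) * e₀ ^ 2 + d₀ ^ 2))
        + (1 + κ + g) * p ^ 2 + q ^ 2 + n ^ 2) := by
  set E := (e₁ + e₀) / 2 with hE
  set D := (d₁ + d₀) / 2 with hD
  have k1 : e₁ ^ 2 - e₀ ^ 2 = τ * (2 * E * (D + p)) := by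
    have : e₁ ^ 2 - e₀ ^ 2 = (e₁ - e₀) * (2 * E) := by rw [hE]; ring
    rw [this, h1]; ring
  have k2 : d₁ ^ 2 - d₀ ^ 2 = τ * (2 * D * (-κ * E - (g + γ) * D + q - g * p - n)) := by
    have : d₁ ^ 2 - d₀ ^ 2 = (d₁ - d₀) * (2 * D) := by rw [hD]; ring
    rw [this, h2]; ring
  have b1 : 2 * E ^ 2 ≤ e₁ ^ 2 + e₀ ^ 2 := by rw [hE]; nlinarith [sq_nonneg (e₁ - e₀)]
  have b2 : 2 * D ^ 2 ≤ d₁ ^ 2 + d₀ ^ 2 := by rw [hD]; nlinarith [sq_nonneg (d₁ - d₀)]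
  have b3 : (1 + κ) * (2 * E ^ 2) ≤ (1 + κ) * (e₁ ^ 2 + e₀ ^ 2) :=
    mul_le_mul_of_nonneg_left b1 (by linarith)
  have key : (1 + κ) * (2 * E * (D + p)) + 2 * D * (-κ * E - (g + γ) * D + q - g * p - n)
      ≤ 2 * (((1 + κ) * e₁ ^ 2 + d₁ ^ 2) + ((1 + κ) * e₀ ^ 2 + d₀ ^ 2))
        + (1 + κ + g) * p ^ 2 + q ^ 2 + n ^ 2 := by
    have c1 : 0 ≤ (1 + κ) * (E - p) ^ 2 := by positivity
    have c2 : 0 ≤ g * (D + p) ^ 2 := by positivity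
    have c3 : 0 ≤ g * D ^ 2 := by positivity
    have c4 : 0 ≤ γ * D ^ 2 := by positivity
    have c5 : 0 ≤ κ * E ^ 2 := by positivity
    nlinarith [sq_nonneg (E - D), sq_nonneg (D - q), sq_nonneg (D + n), sq_nonneg D, sq_nonneg E]
  have := mul_le_mul_of_nonneg_left key hτ
  nlinarith

theorem modal_energy_step {e₀ e₁ d₀ d₁ p q n : ℂ} {τ κ g γ : ℝ} (hτ : 0 ≤ τ) (hκ : 0 ≤ κ) (hg : 0 ≤ g)
    (hγ : 0 ≤ γ) (h1 : e₁ - e₀ = τ * ((d₁ + d₀) / 2 + p))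
    (h2 : d₁ - d₀ = τ * (-κ * ((e₁ + e₀) / 2) - (g + γ) * ((d₁ + d₀) / 2) + q - g * p - n)) :
    (1 + κ) * ‖e₁‖ ^ 2 + ‖d₁‖ ^ 2 ≤ (1 + κ) * ‖e₀‖ ^ 2 + ‖d₀‖ ^ 2
      + τ * (2 * (((1 + κ) * ‖e₁‖ ^ 2 + ‖d₁‖ ^ 2) + ((1 + κ) * ‖e₀‖ ^ 2 + ‖d₀‖ ^ 2))
        + (1 + κ + g) * ‖p‖ ^ 2 + ‖q‖ ^ 2 + ‖n‖ ^ 2) := by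
  have hn : ∀ z : ℂ, ‖z‖ ^ 2 = z.re ^ 2 + z.im ^ 2 := fun z => by
    rw [Complex.sq_norm, Complex.normSq_apply]; ring
  have r1 := congrArg Complex.re h1
  have r2 := congrArg Complex.re h2
  have i1 := congrArg Complex.im h1
  have i2 := congrArg Complex.im h2
  simp at r1 r2 i1 i2
  have a1 := modal_energy_step_real (q := q.re) (n := n.re) hτ hκ hg hγ r1 (by rw [r2]; ring)
  have a2 := modal_energy_step_real (q := q.im) (n := n.im) hτ hκ hg hγ i1 (by rw [i2]; ring)
  simp only [hn]
  nlinarith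

/-- The quadratic part of the error functional. -/
def errQ (ℓ₁ ℓ₂ : ℝ) (P : Model) (e d : ℤ × ℤ → ℂ) : ℝ :=
  ∑' k, rho ℓ₁ ℓ₂ P.α k * ((1 + P.κ * mu ℓ₁ ℓ₂ P.α k) * ‖e k‖ ^ 2 + ‖d k‖ ^ 2)

theorem errQ_term_nonneg (hP : P.Valid) (e d : ℤ × ℤ → ℂ) (k : ℤ × ℤ) :
    0 ≤ rho ℓ₁ ℓ₂ P.α k * ((1 + P.κ * mu ℓ₁ ℓ₂ P.α k) * ‖e k‖ ^ 2 + ‖d k‖ ^ 2) := by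
  have h1 := rho_nonneg (ℓ₁ := ℓ₁) (ℓ₂ := ℓ₂) hP.hα k
  have h2 := mu_nonneg (ℓ₁ := ℓ₁) (ℓ₂ := ℓ₂) P.α k
  have h3 := hP.hκ
  positivity

theorem errQ_nonneg (hP : P.Valid) (e d : ℤ × ℤ → ℂ) : 0 ≤ errQ ℓ₁ ℓ₂ P e d :=
  tsum_nonneg fun k => errQ_term_nonneg hP e d k

theorem summable_errQ (hP : P.Valid) {e d : ℤ × ℤ → ℂ} {C C' : ℝ} (he : Bd (rho2 ℓ₁ ℓ₂ P.α) e C)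
    (hd : Bd (rho ℓ₁ ℓ₂ P.α) d C') : Summable fun k =>
      rho ℓ₁ ℓ₂ P.α k * ((1 + P.κ * mu ℓ₁ ℓ₂ P.α k) * ‖e k‖ ^ 2 + ‖d k‖ ^ 2) := by
  refine Summable.of_nonneg_of_le (errQ_term_nonneg hP e d) (fun k => ?_)
    ((he.summable.mul_left (1 + P.κ)).add hd.summable)
  have h1 := one_le_rho (ℓ₁ := ℓ₁) (ℓ₂ := ℓ₂) hP.hα k
  have h2 := mu_le_rho (ℓ₁ := ℓ₁) (ℓ₂ := ℓ₂) hP.hα k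
  have h3 := hP.hκ
  have h4 : rho ℓ₁ ℓ₂ P.α k * (1 + P.κ * mu ℓ₁ ℓ₂ P.α k) ≤ (1 + P.κ) * rho2 ℓ₁ ℓ₂ P.α k := by
    rw [rho2]; nlinarith [mul_le_mul_of_nonneg_left h2 (mul_nonneg h3.le (zero_le_one.trans h1))]
  have h5 := mul_le_mul_of_nonneg_right h4 (sq_nonneg ‖e k‖)
  rw [mul_add]
  linarith

theorem rho_le_symbol (hP : P.Valid) (k : ℤ × ℤ) :
    rho ℓ₁ ℓ₂ P.α k ≤ (1 + 1 / P.κ) * (1 + P.κ * mu ℓ₁ ℓ₂ P.α k) := by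
  have h3 := hP.hκ
  have h2 := mu_nonneg (ℓ₁ := ℓ₁) (ℓ₂ := ℓ₂) P.α k
  refine (rho_le_one_add_mu hP.hα hP.hα' k).trans ?_
  have e : (1 + 1 / P.κ) * (1 + P.κ * mu ℓ₁ ℓ₂ P.α k)
      = 1 + mu ℓ₁ ℓ₂ P.α k + (1 / P.κ + P.κ * mu ℓ₁ ℓ₂ P.α k) := by field_simp; ring
  rw [e]
  have : 0 ≤ 1 / P.κ + P.κ * mu ℓ₁ ℓ₂ P.α k := by positivity
  linarith

theorem bd_of_errQ (hP : P.Valid) {e d : ℤ × ℤ → ℂ} (hs : Summable fun k =>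
      rho ℓ₁ ℓ₂ P.α k * ((1 + P.κ * mu ℓ₁ ℓ₂ P.α k) * ‖e k‖ ^ 2 + ‖d k‖ ^ 2)) :
    Bd (rho2 ℓ₁ ℓ₂ P.α) e ((1 + 1 / P.κ) * √(errQ ℓ₁ ℓ₂ P e d)) ∧
      Bd (rho ℓ₁ ℓ₂ P.α) d (√(errQ ℓ₁ ℓ₂ P e d)) := by
  have h3 := hP.hκ
  have hQ := errQ_nonneg (ℓ₁ := ℓ₁) (ℓ₂ := ℓ₂) hP e d
  have hsum : ∀ S : Finset (ℤ × ℤ), ∑ k ∈ S,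
      rho ℓ₁ ℓ₂ P.α k * ((1 + P.κ * mu ℓ₁ ℓ₂ P.α k) * ‖e k‖ ^ 2 + ‖d k‖ ^ 2) ≤ errQ ℓ₁ ℓ₂ P e d :=
    fun S => hs.sum_le_tsum S fun k _ => errQ_term_nonneg hP e d k
  constructor
  · refine ⟨by positivity, rho2_nonneg P.α, fun S => ?_⟩
    rw [mul_pow, Real.sq_sqrt hQ]
    refine le_trans ?_ (mul_le_mul_of_nonneg_left (hsum S) (sq_nonneg _))
    rw [Finset.mul_sum]
    refine Finset.sum_le_sum fun k _ => ?_
    have h1 := rho_nonneg (ℓ₁ := ℓ₁) (ℓ₂ := ℓ₂) hP.hα k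
    have h2 := mu_nonneg (ℓ₁ := ℓ₁) (ℓ₂ := ℓ₂) P.α k
    have h4 := mul_le_mul_of_nonneg_left (rho_le_symbol (ℓ₁ := ℓ₁) (ℓ₂ := ℓ₂) hP k) h1
    have hA : 1 ≤ 1 + 1 / P.κ := by have : 0 < 1 / P.κ := by positivity
                                    linarith
    have h5 : rho2 ℓ₁ ℓ₂ P.α k ≤ (1 + 1 / P.κ) ^ 2 * (rho ℓ₁ ℓ₂ P.α k * (1 + P.κ * mu ℓ₁ ℓ₂ P.α k)) := by
      have h6 : 0 ≤ rho ℓ₁ ℓ₂ P.α k * (1 + P.κ * mu ℓ₁ ℓ₂ P.α k) := by positivity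
      have h7 : (1 + 1 / P.κ) ≤ (1 + 1 / P.κ) ^ 2 := by nlinarith
      have h8 := mul_le_mul_of_nonneg_right h7 h6
      rw [rho2, sq]
      linarith
    have h9 := mul_le_mul_of_nonneg_right h5 (sq_nonneg ‖e k‖)
    have h10 : 0 ≤ (1 + 1 / P.κ) ^ 2 * (rho ℓ₁ ℓ₂ P.α k * ‖d k‖ ^ 2) := by positivity
    nlinarith
  · refine ⟨by positivity, rho_nonneg hP.hα, fun S => ?_⟩
    rw [Real.sq_sqrt hQ]
    refine le_trans (Finset.sum_le_sum fun k _ => ?_) (hsum S)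
    have h1 := rho_nonneg (ℓ₁ := ℓ₁) (ℓ₂ := ℓ₂) hP.hα k
    have h2 := mu_nonneg (ℓ₁ := ℓ₁) (ℓ₂ := ℓ₂) P.α k
    have : 0 ≤ (1 + P.κ * mu ℓ₁ ℓ₂ P.α k) * ‖e k‖ ^ 2 := by positivity
    exact mul_le_mul_of_nonneg_left (by linarith) h1

theorem errQ_step (hP : P.Valid) {e₀ e₁ d₀ d₁ p q n : ℤ × ℤ → ℂ} {τ B₁ B₂ B₃ : ℝ} (hτ : 0 ≤ τ)
    (hs₀ : Summable fun k =>
      rho ℓ₁ ℓ₂ P.α k * ((1 + P.κ * mu ℓ₁ ℓ₂ P.α k) * ‖e₀ k‖ ^ 2 + ‖d₀ k‖ ^ 2))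
    (hs₁ : Summable fun k =>
      rho ℓ₁ ℓ₂ P.α k * ((1 + P.κ * mu ℓ₁ ℓ₂ P.α k) * ‖e₁ k‖ ^ 2 + ‖d₁ k‖ ^ 2))
    (hp : Bd (rho2 ℓ₁ ℓ₂ P.α) p B₁) (hq : Bd (rho ℓ₁ ℓ₂ P.α) q B₂) (hn : Bd (rho ℓ₁ ℓ₂ P.α) n B₃)
    (h1 : ∀ k, e₁ k - e₀ k = τ * ((d₁ k + d₀ k) / 2 + p k))
    (h2 : ∀ k, d₁ k - d₀ k = τ * (-((P.κ * mu ℓ₁ ℓ₂ P.α k : ℝ) : ℂ) * ((e₁ k + e₀ k) / 2)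
      - (((P.γ₁ * mu ℓ₁ ℓ₂ P.α k : ℝ) : ℂ) + (P.γ₂ : ℂ)) * ((d₁ k + d₀ k) / 2) + q k
      - ((P.γ₁ * mu ℓ₁ ℓ₂ P.α k : ℝ) : ℂ) * p k - n k)) :
    errQ ℓ₁ ℓ₂ P e₁ d₁ ≤ errQ ℓ₁ ℓ₂ P e₀ d₀ + τ * (2 * (errQ ℓ₁ ℓ₂ P e₁ d₁ + errQ ℓ₁ ℓ₂ P e₀ d₀)
      + (1 + P.κ + P.γ₁) * B₁ ^ 2 + B₂ ^ 2 + B₃ ^ 2) := by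
  refine hs₁.tsum_le_of_sum_le fun S => ?_
  have s0 := hs₀.sum_le_tsum S fun k _ => errQ_term_nonneg hP e₀ d₀ k
  have s1 := hs₁.sum_le_tsum S fun k _ => errQ_term_nonneg hP e₁ d₁ k
  have hκ := hP.hκ
  have hγ₁ := hP.hγ₁
  have hmode : ∀ k, rho ℓ₁ ℓ₂ P.α k * ((1 + P.κ * mu ℓ₁ ℓ₂ P.α k) * ‖e₁ k‖ ^ 2 + ‖d₁ k‖ ^ 2)
      ≤ rho ℓ₁ ℓ₂ P.α k * ((1 + P.κ * mu ℓ₁ ℓ₂ P.α k) * ‖e₀ k‖ ^ 2 + ‖d₀ k‖ ^ 2)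
        + τ * (2 * (rho ℓ₁ ℓ₂ P.α k * ((1 + P.κ * mu ℓ₁ ℓ₂ P.α k) * ‖e₁ k‖ ^ 2 + ‖d₁ k‖ ^ 2)
          + rho ℓ₁ ℓ₂ P.α k * ((1 + P.κ * mu ℓ₁ ℓ₂ P.α k) * ‖e₀ k‖ ^ 2 + ‖d₀ k‖ ^ 2))
          + (1 + P.κ + P.γ₁) * (rho2 ℓ₁ ℓ₂ P.α k * ‖p k‖ ^ 2) + rho ℓ₁ ℓ₂ P.α k * ‖q k‖ ^ 2
          + rho ℓ₁ ℓ₂ P.α k * ‖n k‖ ^ 2) := by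
    intro k
    have hr1 := one_le_rho (ℓ₁ := ℓ₁) (ℓ₂ := ℓ₂) hP.hα k
    have hr := rho_nonneg (ℓ₁ := ℓ₁) (ℓ₂ := ℓ₂) hP.hα k
    have hm := mu_nonneg (ℓ₁ := ℓ₁) (ℓ₂ := ℓ₂) P.α k
    have hmr := mu_le_rho (ℓ₁ := ℓ₁) (ℓ₂ := ℓ₂) hP.hα k
    have h3 := modal_energy_step hτ (mul_nonneg hκ.le hm) (mul_nonneg hγ₁ hm) hP.hγ₂ (h1 k) (h2 k)
    have h4 := mul_le_mul_of_nonneg_left h3 hr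
    -- The defect of the first equation carries an additional factor `mu`, and so it has to be small
    -- in H^α and not only in H^{α/2}.
    have h5 : rho ℓ₁ ℓ₂ P.α k * (1 + P.κ * mu ℓ₁ ℓ₂ P.α k + P.γ₁ * mu ℓ₁ ℓ₂ P.α k)
        ≤ (1 + P.κ + P.γ₁) * rho2 ℓ₁ ℓ₂ P.α k := by
      have e : (1 + P.κ + P.γ₁) * rho2 ℓ₁ ℓ₂ P.α k
          = rho ℓ₁ ℓ₂ P.α k * (rho ℓ₁ ℓ₂ P.α k + P.κ * rho ℓ₁ ℓ₂ P.α k + P.γ₁ * rho ℓ₁ ℓ₂ P.α k) := by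
        rw [rho2]; ring
      rw [e]
      gcongr
    have h6 := mul_le_mul_of_nonneg_left (mul_le_mul_of_nonneg_right h5 (sq_nonneg ‖p k‖)) hτ
    refine h4.trans ?_
    rw [mul_add, add_assoc, add_assoc]
    linarith
  calc _ ≤ _ := Finset.sum_le_sum fun k _ => hmode k
    _ = (∑ k ∈ S, rho ℓ₁ ℓ₂ P.α k * ((1 + P.κ * mu ℓ₁ ℓ₂ P.α k) * ‖e₀ k‖ ^ 2 + ‖d₀ k‖ ^ 2))
        + τ * (2 * ((∑ k ∈ S, rho ℓ₁ ℓ₂ P.α k * ((1 + P.κ * mu ℓ₁ ℓ₂ P.α k) * ‖e₁ k‖ ^ 2 + ‖d₁ k‖ ^ 2))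
          + ∑ k ∈ S, rho ℓ₁ ℓ₂ P.α k * ((1 + P.κ * mu ℓ₁ ℓ₂ P.α k) * ‖e₀ k‖ ^ 2 + ‖d₀ k‖ ^ 2))
          + (1 + P.κ + P.γ₁) * (∑ k ∈ S, rho2 ℓ₁ ℓ₂ P.α k * ‖p k‖ ^ 2)
          + (∑ k ∈ S, rho ℓ₁ ℓ₂ P.α k * ‖q k‖ ^ 2) + ∑ k ∈ S, rho ℓ₁ ℓ₂ P.α k * ‖n k‖ ^ 2) := by
      simp only [Finset.sum_add_distrib, ← Finset.mul_sum]
    _ ≤ _ := by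
      have hA : 0 ≤ 1 + P.κ + P.γ₁ := by positivity
      have t1 := hp.2.2 S
      have t2 := hq.2.2 S
      have t3 := hn.2.2 S
      unfold errQ
      gcongr

end

/-! ### Error equations and the one-step estimate -/

section

variable {ℓ₁ ℓ₂ : ℝ} [Fact (0 < ℓ₁)] [Fact (0 < ℓ₂)] {P : Model}
variable {T m L : ℝ} {φ₀ φ₁ : L2per ℓ₁ ℓ₂} {u v a j : ℝ → L2per ℓ₁ ℓ₂}

theorem error_mode_u {h σ c : ℝ} (H : MidPoint T h σ c) {U V U' V' : L2per ℓ₁ ℓ₂}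
    (hU : U' = U + σ ^ 2 • ((1 / 2 : ℝ) • (V' + V))) (k : ℤ × ℤ) :
    fcoeff (u (c + h) - U') k - fcoeff (u (c - h) - U) k
      = ((σ ^ 2 : ℝ) : ℂ) * ((fcoeff (v (c + h) - V') k + fcoeff (v (c - h) - V) k) / 2
        + defectU u v h c k) := by
  have hσ : (σ : ℂ) ≠ 0 := by exact_mod_cast H.pos.ne'
  have e : h = σ ^ 2 / 2 := by linarith [H.hh]
  subst hU
  rw [defectU]
  simp only [fcoeff_add, fcoeff_sub, fcoeff_smul, Pi.add_apply, Pi.sub_apply, Pi.smul_apply,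
    Complex.real_smul]
  have e2 : ((1 / (2 * h) : ℝ) : ℂ) = 1 / (σ : ℂ) ^ 2 := by rw [H.hh]; push_cast; rfl
  rw [e2]
  push_cast
  field_simp
  ring

/-- In the scheme the mean velocity equals the difference quotient of U exactly. For the exact
solution the two differ by `defectU`, which is why γ₁ mu times `defectU` appears next to `defectV`.
-/
theorem error_mode_v (hP : P.Valid) {h σ c : ℝ} (H : MidPoint T h σ c) {U V U' V' b : L2per ℓ₁ ℓ₂}
    {R R' : ℝ} (hmU : MemH P.α U) (hmU' : MemH P.α U')
    (hU : U' = U + σ ^ 2 • ((1 / 2 : ℝ) • (V' + V)))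
    (hS : StepEq P h U V b R ((1 / 2 : ℝ) • (V' + V)) ((R' + R) / 2)) (k : ℤ × ℤ) :
    fcoeff (v (c + h) - V') k - fcoeff (v (c - h) - V) k
      = ((σ ^ 2 : ℝ) : ℂ) * (-((P.κ * mu ℓ₁ ℓ₂ P.α k : ℝ) : ℂ)
          * ((fcoeff (u (c + h) - U') k + fcoeff (u (c - h) - U) k) / 2)
      - (((P.γ₁ * mu ℓ₁ ℓ₂ P.α k : ℝ) : ℂ) + (P.γ₂ : ℂ))
          * ((fcoeff (v (c + h) - V') k + fcoeff (v (c - h) - V) k) / 2) + defectV P u v h c k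
      - ((P.γ₁ * mu ℓ₁ ℓ₂ P.α k : ℝ) : ℂ) * defectU u v h c k
      - (((P.sav (u (c + h)) + P.sav (u (c - h))) / 2) • fcoeff (P.b (u c))
          - ((R' + R) / 2) • fcoeff b) k) := by
  have hσ : (σ : ℂ) ≠ 0 := by exact_mod_cast H.pos.ne'
  have e : h = σ ^ 2 / 2 := by linarith [H.hh]
  have e3 : U + h • ((1 / 2 : ℝ) • (V' + V)) = (1 / 2 : ℝ) • (U' + U) := by
    rw [hU, e]; module
  have h1 := congrArg (fun w => fcoeff w k) hS.eqn
  simp only [e3, fcoeff_add, fcoeff_sub, fcoeff_smul, Pi.add_apply, Pi.sub_apply, Pi.smul_apply,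
    Complex.real_smul, fcoeff_zero, Pi.zero_apply, fcoeff_fracLap hP.hα ((hmU'.add hmU).smul _),
    fcoeff_fracLap hP.hα hS.mem] at h1
  rw [defectU, defectV]
  simp only [muMul, fcoeff_sub, Pi.add_apply, Pi.sub_apply, Pi.smul_apply,
    Complex.real_smul]
  have e2 : ((1 / (2 * h) : ℝ) : ℂ) = 1 / (σ : ℂ) ^ 2 := by rw [H.hh]; push_cast; rfl
  have e4 : ((P.γ₁ / (2 * h) : ℝ) : ℂ) = P.γ₁ / (σ : ℂ) ^ 2 := by rw [H.hh]; push_cast; rfl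
  have e5 : ((1 / h : ℝ) : ℂ) = 2 / (σ : ℂ) ^ 2 := by rw [e]; push_cast; field_simp
  rw [e5] at h1
  rw [e2, e4]
  push_cast at h1 ⊢
  have h6 : (1 / 2 * (fcoeff V' k + fcoeff V k) - fcoeff V k) = (fcoeff V' k - fcoeff V k) / 2 := by
    ring
  rw [h6] at h1
  have h7 : fcoeff V' k - fcoeff V k = (σ : ℂ) ^ 2 * (2 / (σ : ℂ) ^ 2 * ((fcoeff V' k - fcoeff V k) / 2)) := by
    field_simp
  have h8 : 2 / (σ : ℂ) ^ 2 * ((fcoeff V' k - fcoeff V k) / 2) =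
    -((P.κ : ℂ) * ((mu ℓ₁ ℓ₂ P.α k : ℂ) * (1 / 2 * (fcoeff U' k + fcoeff U k)))
      + P.γ₁ * ((mu ℓ₁ ℓ₂ P.α k : ℂ) * (1 / 2 * (fcoeff V' k + fcoeff V k)))
      + P.γ₂ * (1 / 2 * (fcoeff V' k + fcoeff V k)) + ((R' : ℂ) + R) / 2 * fcoeff b k) := by
    linear_combination h1
  rw [h8] at h7
  have h9 : fcoeff (v (c + h)) k - fcoeff V' k - (fcoeff (v (c - h)) k - fcoeff V k)
    = fcoeff (v (c + h)) k - fcoeff (v (c - h)) k - (fcoeff V' k - fcoeff V k) := by ring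
  rw [h9, h7]
  field_simp
  ring

/-- The energy of the error at time `t`. -/
def err (P : Model) (u v : ℝ → L2per ℓ₁ ℓ₂) (t : ℝ) (U V : L2per ℓ₁ ℓ₂) (R : ℝ) : ℝ :=
  errQ ℓ₁ ℓ₂ P (fcoeff (u t - U)) (fcoeff (v t - V)) + (P.sav (u t) - R) ^ 2

theorem err_nonneg (hP : P.Valid) (t : ℝ) (U V : L2per ℓ₁ ℓ₂) (R : ℝ) : 0 ≤ err P u v t U V R :=
  add_nonneg (errQ_nonneg hP _ _) (sq_nonneg _)

theorem summable_err (hP : P.Valid) {w z U V : L2per ℓ₁ ℓ₂} (hw : MemH P.α w) (hz : MemH P.α z)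
    (hU : MemH P.α U) (hV : MemH P.α V) : Summable fun k => rho ℓ₁ ℓ₂ P.α k *
      ((1 + P.κ * mu ℓ₁ ℓ₂ P.α k) * ‖fcoeff (w - U) k‖ ^ 2 + ‖fcoeff (z - V) k‖ ^ 2) := by
  obtain ⟨C, hC⟩ := (hw.sub hU).exists_bd
  obtain ⟨C', hC'⟩ := (hz.sub hV).exists_bd
  exact summable_errQ hP hC (hC'.rho_of_rho2 hP.hα)

theorem sq_le_of_abs_sub_le {x y s g : ℝ} (hs : 0 ≤ s) (h : |y - x| ≤ s * g) :
    y ^ 2 ≤ x ^ 2 + s * (y ^ 2 + x ^ 2 + g ^ 2) := by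
  have h1 : y ^ 2 - x ^ 2 = (y - x) * (y + x) := by ring
  have h2 : (y - x) * (y + x) ≤ s * g * |y + x| :=
    (le_abs_self _).trans (by rw [abs_mul]; exact mul_le_mul_of_nonneg_right h (abs_nonneg _))
  have h3 : g * |y + x| ≤ y ^ 2 + x ^ 2 + g ^ 2 := by
    have h4 : |y + x| ^ 2 = (y + x) ^ 2 := sq_abs _
    nlinarith [sq_nonneg (g - |y + x|), sq_nonneg (y - x), sq_nonneg g]
  have h5 := mul_le_mul_of_nonneg_left h3 hs
  linarith

theorem sq_sum_four_le (x y z w : ℝ) :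
    (x + y + z + w) ^ 2 ≤ 4 * (x ^ 2 + y ^ 2 + z ^ 2 + w ^ 2) := by
  nlinarith [sq_nonneg (x - y), sq_nonneg (x - z), sq_nonneg (x - w), sq_nonneg (y - z),
    sq_nonneg (y - w), sq_nonneg (z - w)]

theorem sq_add_mul_abs_le (p x y q : ℝ) :
    (p + |(x + y) / 2| * q) ^ 2 ≤ 2 * p ^ 2 + q ^ 2 * (x ^ 2 + y ^ 2) := by
  have h1 : 2 * |(x + y) / 2| ^ 2 ≤ x ^ 2 + y ^ 2 := by
    rw [sq_abs]; nlinarith [sq_nonneg (x - y)]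
  have h2 := mul_le_mul_of_nonneg_left h1 (sq_nonneg q)
  have h3 := two_mul_le_add_sq p (|(x + y) / 2| * q)
  rw [mul_pow] at h3
  rw [add_sq, mul_pow]
  linarith

/-- Change of the error of the scalar variable over one step. -/
theorem error_sav_eq {h σ c : ℝ} (H : MidPoint T h σ c) {U V U' V' b : L2per ℓ₁ ℓ₂} {R R' : ℝ}
    (hU : U' = U + σ ^ 2 • ((1 / 2 : ℝ) • (V' + V)))
    (hS : StepEq P h U V b R ((1 / 2 : ℝ) • (V' + V)) ((R' + R) / 2)) :
    (P.sav (u (c + h)) - R') - (P.sav (u (c - h)) - R)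
      = (P.sav (u (c + h)) - P.sav (u (c - h)) - 1 / 2 * inner ℝ (P.b (u c)) (u (c + h) - u (c - h)))
        + 1 / 2 * inner ℝ (P.b (u c) - b) (u (c + h) - u (c - h))
        + 1 / 2 * inner ℝ b ((u (c + h) - U') - (u (c - h) - U)) := by
  have h1 := hS.eqr
  have h2 : U' - U = (2 * h) • ((1 / 2 : ℝ) • (V' + V)) := by rw [hU, H.hh]; module
  have h3 : R' - R = 1 / 2 * inner ℝ b (U' - U) := by rw [h2, inner_smul_right]; linarith
  have h4 : (u (c + h) - U') - (u (c - h) - U) = (u (c + h) - u (c - h)) - (U' - U) := by abel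
  rw [h4, inner_sub_left, inner_sub_right b (u (c + h) - u (c - h)) (U' - U)]
  linarith

namespace ExactData

variable (D : ExactData P T m L φ₀ φ₁ u v a j)
include D

-- `W` is any admissible approximation of u at the midpoint, with error D' in H^α. This covers the
-- half-step predictor and the extrapolation alike. The squared defects give σ⁶ = τ³ and the
-- nonlinear term gives D'² plus the scalar error, all multiplied by σ² = τ.
set_option maxHeartbeats 1000000 in
theorem exists_step_bound {M c₀ : ℝ} (hM : 0 ≤ M) (hc₀ : 0 < c₀) : ∃ C, 0 ≤ C ∧ ∀ h σ c : ℝ,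
    MidPoint T h σ c → ∀ (U V U' V' W : L2per ℓ₁ ℓ₂) (R R' : ℝ), MemH P.α U → MemH P.α V →
    MemH P.α U' → MemH P.α V' → U' = U + σ ^ 2 • ((1 / 2 : ℝ) • (V' + V)) →
    StepEq P h U V (P.b W) R ((1 / 2 : ℝ) • (V' + V)) ((R' + R) / 2) →
    Admissible P M c₀ W → Admissible P M c₀ (u c) →
    ∀ D', Bd (rho2 ℓ₁ ℓ₂ P.α) (fcoeff (u c - W)) D' →
    err P u v (c + h) U' V' R' ≤ err P u v (c - h) U V R + C * σ ^ 2 *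
      (err P u v (c + h) U' V' R' + err P u v (c - h) U V R + D' ^ 2 + σ ^ 6) := by
  have hP := D.valid
  have hL := D.L_nonneg
  obtain ⟨Cb, hCb, hb⟩ := exists_b_bound (ℓ₁ := ℓ₁) (ℓ₂ := ℓ₂) D.smooth hP.hα hP.hα' hM hc₀
  obtain ⟨Cv, hCv, hdV⟩ := D.exists_bd_defectV
  obtain ⟨Cr, hCr, hdR⟩ := D.exists_abs_defectR_le
  set A := √(ℓ₁ * ℓ₂) with hA
  have hA0 : 0 ≤ A := Real.sqrt_nonneg _
  set G := Cr + A * A * Cb * (1 + 4 * L) with hG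
  have hκ := hP.hκ
  have hγ₁ := hP.hγ₁
  have hG0 : 0 ≤ G := by positivity
  refine ⟨2 + (1 + P.κ + P.γ₁) * (3 * L) ^ 2 + Cv ^ 2 + 2 * (L * Cb) ^ 2 + Cb ^ 2 + 1 + 4 * G ^ 2,
    by positivity, fun h σ c H U V U' V' W R R' mU mV mU' mV' hU hS aW au D' hD' => ?_⟩
  have hσ := H.pos
  have hD0 := hD'.1
  have s₀ := summable_err hP (D.sol.mem_u _ H.left_mem) (D.sol.mem_v _ H.left_mem) mU mV
  have s₁ := summable_err hP (D.sol.mem_u _ H.right_mem) (D.sol.mem_v _ H.right_mem) mU' mV'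
  obtain ⟨bW, -⟩ := hb W aW
  obtain ⟨bu, hbu⟩ := hb (u c) au
  have bd := hbu W aW D' hD'
  set r₁ := P.sav (u (c + h)) with hr₁
  set r₀ := P.sav (u (c - h)) with hr₀
  set Q₁ := errQ ℓ₁ ℓ₂ P (fcoeff (u (c + h) - U')) (fcoeff (v (c + h) - V')) with hQ₁
  set Q₀ := errQ ℓ₁ ℓ₂ P (fcoeff (u (c - h) - U)) (fcoeff (v (c - h) - V)) with hQ₀
  have hQ₁n : 0 ≤ Q₁ := errQ_nonneg hP _ _
  have hQ₀n : 0 ≤ Q₀ := errQ_nonneg hP _ _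
  have a₁ := D.abs_sav_le H.right_mem
  have a₀ := D.abs_sav_le H.left_mem
  have hmean : |(r₁ + r₀) / 2| ≤ L := by
    rw [abs_le] at a₁ a₀ ⊢; constructor <;> linarith
  -- the nonlinear term
  have hn : Bd (rho ℓ₁ ℓ₂ P.α) (((r₁ + r₀) / 2) • fcoeff (P.b (u c)) - ((R' + R) / 2) • fcoeff (P.b W))
      (L * (Cb * D') + |((r₁ - R') + (r₀ - R)) / 2| * Cb) := by
    have e : ((r₁ + r₀) / 2) • fcoeff (P.b (u c)) - ((R' + R) / 2) • fcoeff (P.b W)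
        = ((r₁ + r₀) / 2) • fcoeff (P.b (u c) - P.b W)
          + (((r₁ - R') + (r₀ - R)) / 2) • fcoeff (P.b W) := by
      rw [fcoeff_sub]; module
    rw [e]
    exact ((bd.smul _).le (mul_le_mul_of_nonneg_right hmean (by positivity))).add (bW.smul _)
  have hstep := errQ_step hP (sq_nonneg σ) s₀ s₁ (D.bd_defectU H) (hdV h σ c H) hn
    (error_mode_u H hU) (error_mode_v hP H mU mU' hU hS)
  -- the scalar variable
  have hr : |(r₁ - R') - (r₀ - R)| ≤ σ ^ 2 * (G * (σ ^ 3 + D' + √Q₁ + √Q₀)) := by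
    rw [error_sav_eq H hU hS]
    have t1 := hdR h σ c H
    have n1 := (bd.one_of_rho hP.hα).norm_L2_le
    have n2 := (bW.one_of_rho hP.hα).norm_L2_le
    have n3 : ‖u (c + h) - u (c - h)‖ ≤ A * (L * σ ^ 2) := by
      have := D.bd_diff_u H.lo (by linarith [H.h_pos]) H.hi
      rw [← fcoeff_sub] at this
      refine ((((this.rho2_of_rho7 hP.hα).rho_of_rho2 hP.hα).one_of_rho hP.hα).norm_L2_le).trans
        (le_of_eq ?_)
      rw [← H.hh]; ring
    -- The increment of e_u is not estimated by the triangle inequality. The first error equation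
    -- shows that it is τ times the mean of e_v plus the defect, which supplies the factor σ² needed
    -- for the scalar error.
    have n4 : ‖(u (c + h) - U') - (u (c - h) - U)‖
        ≤ A * (σ ^ 2 * (1 / 2 * (√Q₁ + √Q₀) + 3 * L * σ ^ 3)) := by
      have b1 := (bd_of_errQ hP s₁).2
      have b0 := (bd_of_errQ hP s₀).2
      have b2 := (((b1.add b0).smul (1 / 2)).add ((D.bd_defectU H).rho_of_rho2 hP.hα)).smul (σ ^ 2)
      rw [abs_of_nonneg (sq_nonneg σ), abs_of_pos (by norm_num : (0 : ℝ) < 1 / 2)] at b2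
      refine Bd.norm_L2_le ((b2.one_of_rho hP.hα).of_le zero_le_one (fun _ => zero_le_one)
        (fun k => ?_) |>.le (one_mul _).le)
      rw [one_pow, one_mul, one_mul, one_mul, fcoeff_sub, Pi.sub_apply, error_mode_u H hU k]
      refine le_of_eq (congrArg (fun z : ℂ => ‖z‖ ^ 2) ?_)
      simp only [Pi.add_apply, Pi.smul_apply, Complex.real_smul]
      push_cast
      ring
    have i1 := (abs_real_inner_le_norm (P.b (u c) - P.b W) (u (c + h) - u (c - h))).trans
      (mul_le_mul n1 n3 (norm_nonneg _) (by positivity))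
    have i2 := (abs_real_inner_le_norm (P.b W) ((u (c + h) - U') - (u (c - h) - U))).trans
      (mul_le_mul n2 n4 (norm_nonneg _) (by positivity))
    have q1 := Real.sqrt_nonneg Q₁
    have q0 := Real.sqrt_nonneg Q₀
    refine (abs_add_three _ _ _).trans ?_
    rw [abs_mul, abs_mul, abs_of_pos (by norm_num : (0 : ℝ) < 1 / 2)]
    refine (add_le_add_three t1 (mul_le_mul_of_nonneg_left i1 (by norm_num))
      (mul_le_mul_of_nonneg_left i2 (by norm_num))).trans ?_
    rw [hG, ← hA]
    have k1 : 0 ≤ A * A * Cb := by positivity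
    have e : σ ^ 2 * ((Cr + A * A * Cb * (1 + 4 * L)) * (σ ^ 3 + D' + √Q₁ + √Q₀))
        - (Cr * σ ^ 5 + 1 / 2 * (A * (Cb * D') * (A * (L * σ ^ 2)))
          + 1 / 2 * (A * Cb * (A * (σ ^ 2 * (1 / 2 * (√Q₁ + √Q₀) + 3 * L * σ ^ 3)))))
        = σ ^ 2 * (Cr * (D' + √Q₁ + √Q₀) + A * A * Cb * ((1 + 5 / 2 * L) * σ ^ 3
          + (1 + 7 / 2 * L) * D' + (3 / 4 + 4 * L) * (√Q₁ + √Q₀))) := by ring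
    have e2 : 0 ≤ σ ^ 2 * (Cr * (D' + √Q₁ + √Q₀) + A * A * Cb * ((1 + 5 / 2 * L) * σ ^ 3
          + (1 + 7 / 2 * L) * D' + (3 / 4 + 4 * L) * (√Q₁ + √Q₀))) := by positivity
    linarith
  have hr2 := sq_le_of_abs_sub_le (sq_nonneg σ) hr
  have hg : (G * (σ ^ 3 + D' + √Q₁ + √Q₀)) ^ 2 ≤ 4 * G ^ 2 * (σ ^ 6 + D' ^ 2 + Q₁ + Q₀) := by
    have := sq_sum_four_le (σ ^ 3) D' (√Q₁) (√Q₀)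
    rw [Real.sq_sqrt hQ₁n, Real.sq_sqrt hQ₀n] at this
    have h2 := mul_le_mul_of_nonneg_left this (sq_nonneg G)
    rw [mul_pow]
    refine h2.trans (le_of_eq (by ring))
  have hn2 : (L * (Cb * D') + |((r₁ - R') + (r₀ - R)) / 2| * Cb) ^ 2
      ≤ 2 * (L * Cb) ^ 2 * D' ^ 2 + Cb ^ 2 * ((r₁ - R') ^ 2 + (r₀ - R) ^ 2) := by
    refine (sq_add_mul_abs_le _ _ _ _).trans (le_of_eq ?_)
    ring
  have e₁ : err P u v (c + h) U' V' R' = Q₁ + (r₁ - R') ^ 2 := rfl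
  have e₀ : err P u v (c - h) U V R = Q₀ + (r₀ - R) ^ 2 := rfl
  rw [e₁, e₀]
  set x₁ := (r₁ - R') ^ 2 with hx₁
  set x₀ := (r₀ - R) ^ 2 with hx₀
  have hx₁n : 0 ≤ x₁ := sq_nonneg _
  have hx₀n : 0 ≤ x₀ := sq_nonneg _
  have key : 2 * (Q₁ + Q₀) + (1 + P.κ + P.γ₁) * (3 * L * σ ^ 3) ^ 2 + (Cv * σ ^ 3) ^ 2
        + (L * (Cb * D') + |((r₁ - R') + (r₀ - R)) / 2| * Cb) ^ 2
        + (x₁ + x₀ + (G * (σ ^ 3 + D' + √Q₁ + √Q₀)) ^ 2)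
      ≤ (2 + (1 + P.κ + P.γ₁) * (3 * L) ^ 2 + Cv ^ 2 + 2 * (L * Cb) ^ 2 + Cb ^ 2 + 1 + 4 * G ^ 2)
        * (Q₁ + x₁ + (Q₀ + x₀) + D' ^ 2 + σ ^ 6) := by
    refine (add_le_add (add_le_add le_rfl hn2) (add_le_add le_rfl hg)).trans ?_
    set K₁ := (1 + P.κ + P.γ₁) * (3 * L) ^ 2 with hK₁
    have hK₁n : 0 ≤ K₁ := by positivity
    set K₂ := 2 * (L * Cb) ^ 2 with hK₂
    have hK₂n : 0 ≤ K₂ := by positivity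
    have e1 : (1 + P.κ + P.γ₁) * (3 * L * σ ^ 3) ^ 2 = K₁ * σ ^ 6 := by rw [hK₁]; ring
    rw [e1, ← sub_nonneg]
    have e2 : 0 ≤ (2 * (x₁ + x₀ + D' ^ 2 + σ ^ 6) + K₁ * (Q₁ + x₁ + (Q₀ + x₀) + D' ^ 2)
      + Cv ^ 2 * (Q₁ + x₁ + (Q₀ + x₀) + D' ^ 2) + K₂ * (Q₁ + x₁ + (Q₀ + x₀) + σ ^ 6)
      + Cb ^ 2 * (Q₁ + Q₀ + D' ^ 2 + σ ^ 6) + (Q₁ + Q₀ + D' ^ 2 + σ ^ 6)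
      + 4 * G ^ 2 * (x₁ + x₀)) := by positivity
    refine e2.trans (le_of_eq (by ring))
  have key2 := mul_le_mul_of_nonneg_left key (sq_nonneg σ)
  calc Q₁ + x₁ ≤ Q₀ + x₀ + σ ^ 2 * (2 * (Q₁ + Q₀) + (1 + P.κ + P.γ₁) * (3 * L * σ ^ 3) ^ 2
        + (Cv * σ ^ 3) ^ 2 + (L * (Cb * D') + |((r₁ - R') + (r₀ - R)) / 2| * Cb) ^ 2
        + (x₁ + x₀ + (G * (σ ^ 3 + D' + √Q₁ + √Q₀)) ^ 2)) := by
        rw [mul_add (σ ^ 2) _ (x₁ + x₀ + _)]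
        linarith
    _ ≤ _ := by rw [mul_comm _ (σ ^ 2), mul_assoc]; linarith

end ExactData

end

/-! ### The first half step -/

section

variable {ℓ₁ ℓ₂ : ℝ} [Fact (0 < ℓ₁)] [Fact (0 < ℓ₂)] {P : Model}
variable {T m L : ℝ} {φ₀ φ₁ : L2per ℓ₁ ℓ₂} {u v a j : ℝ → L2per ℓ₁ ℓ₂}

theorem sq_mul_rho_le_stepSymbol (hP : P.Valid) {h : ℝ} (hh : 0 < h) (h1 : h ≤ 1) (k : ℤ × ℤ) :
    h ^ 2 * rho ℓ₁ ℓ₂ P.α k ≤ (1 + 1 / P.κ) * stepSymbol ℓ₁ ℓ₂ P h k ^ 2 := by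
  have hκ := hP.hκ
  have hm := mu_nonneg (ℓ₁ := ℓ₁) (ℓ₂ := ℓ₂) P.α k
  have e : (1 + 1 / P.κ) * (1 + h ^ 2 * P.κ * mu ℓ₁ ℓ₂ P.α k)
      = 1 + h ^ 2 * mu ℓ₁ ℓ₂ P.α k + (1 / P.κ + h ^ 2 * P.κ * mu ℓ₁ ℓ₂ P.α k) := by field_simp; ring
  have hS := stepSymbol_ge (ℓ₁ := ℓ₁) (ℓ₂ := ℓ₂) hP hh k
  have hS1 := one_le_stepSymbol (ℓ₁ := ℓ₁) (ℓ₂ := ℓ₂) hP hh k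
  have hh2 : h ^ 2 ≤ 1 := pow_le_one₀ hh.le h1
  have a0 : 0 ≤ 1 + 1 / P.κ := by positivity
  calc h ^ 2 * rho ℓ₁ ℓ₂ P.α k ≤ h ^ 2 * (1 + mu ℓ₁ ℓ₂ P.α k) :=
        mul_le_mul_of_nonneg_left (rho_le_one_add_mu hP.hα hP.hα' k) (sq_nonneg h)
    _ ≤ (1 + 1 / P.κ) * (1 + h ^ 2 * P.κ * mu ℓ₁ ℓ₂ P.α k) := by
      have : 0 ≤ 1 / P.κ + h ^ 2 * P.κ * mu ℓ₁ ℓ₂ P.α k := by positivity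
      rw [e, mul_add, mul_one]
      linarith
    _ ≤ (1 + 1 / P.κ) * stepSymbol ℓ₁ ℓ₂ P h k ^ 2 := by
      refine mul_le_mul_of_nonneg_left ?_ a0
      nlinarith

/-- An implicit step starting from regular data moves the velocity by a bounded amount in `H^α`
and by `O(h)` in `L²`. -/
theorem StepEq.bd_sub (hP : P.Valid) {h : ℝ} (hh : 0 < h) (h1 : h ≤ 1) {U V b X : L2per ℓ₁ ℓ₂}
    {R Rt B Cb : ℝ} (hU : Bd (rho7 ℓ₁ ℓ₂ P.α) (fcoeff U) B) (hV : Bd (rho7 ℓ₁ ℓ₂ P.α) (fcoeff V) B)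
    (hb : Bd (rho ℓ₁ ℓ₂ P.α) (fcoeff b) Cb) (hS : StepEq P h U V b R X Rt) :
    Bd (rho2 ℓ₁ ℓ₂ P.α) (fcoeff (X - V))
        ((1 + 1 / P.κ) * ((P.γ₂ + P.γ₁ + 2 * P.κ) * B + |Rt| * Cb)) ∧
      Bd (fun _ => 1) (fcoeff (X - V)) (h * ((P.γ₂ + P.γ₁ + 2 * P.κ) * B + |Rt| * Cb)) := by
  have hκ := hP.hκ
  have hγ₁ := hP.hγ₁
  have hγ₂ := hP.hγ₂
  have hB := hU.1
  have hα := hP.hα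
  set g : ℤ × ℤ → ℂ := P.γ₂ • fcoeff V + (P.γ₁ + h * P.κ) • muMul ℓ₁ ℓ₂ P.α (fcoeff V)
    + P.κ • muMul ℓ₁ ℓ₂ P.α (fcoeff U) + Rt • fcoeff b with hg
  have bg : Bd (rho ℓ₁ ℓ₂ P.α) g ((P.γ₂ + P.γ₁ + 2 * P.κ) * B + |Rt| * Cb) := by
    refine ((((((hV.rho2_of_rho7 hα).rho_of_rho2 hα).smul _).add ((hV.muMul_rho hα).smul _)).add
      ((hU.muMul_rho hα).smul _)).add (hb.smul _)).le ?_
    rw [abs_of_nonneg hγ₂, abs_of_nonneg hκ.le, abs_of_nonneg (by positivity : 0 ≤ P.γ₁ + h * P.κ)]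
    have : h * P.κ * B ≤ 1 * P.κ * B := by gcongr
    linarith
  -- Here g gathers the right-hand sides formed from the initial data and is bounded in H^{α/2}.
  -- Inverting the symbol gains α/2 further derivatives at the cost of one factor h, since h² rho is
  -- at most a multiple of the squared symbol. In L² the factor h is kept.
  have hmode : ∀ k, (stepSymbol ℓ₁ ℓ₂ P h k : ℂ) * fcoeff (X - V) k = -(h : ℂ) * g k := by
    intro k
    have h2 := (stepEq_mode hP hh (hU.rho2_of_rho7 hα).memH hS.mem).1 hS.eqn k
    rw [fcoeff_sub, Pi.sub_apply, mul_sub, h2, hg]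
    simp only [fcoeff_sub, fcoeff_smul, Pi.add_apply, Pi.sub_apply, Pi.smul_apply, muMul,
      Complex.real_smul, fcoeff_fracLap hα (hU.rho2_of_rho7 hα).memH, stepSymbol]
    push_cast
    ring
  have hnorm : ∀ k, stepSymbol ℓ₁ ℓ₂ P h k ^ 2 * ‖fcoeff (X - V) k‖ ^ 2 = h ^ 2 * ‖g k‖ ^ 2 := by
    intro k
    have := congrArg (fun z : ℂ => ‖z‖ ^ 2) (hmode k)
    simpa [mul_pow, norm_mul] using this
  constructor
  · refine bg.of_le (by positivity) (rho2_nonneg P.α) fun k => ?_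
    have hr := rho_nonneg (ℓ₁ := ℓ₁) (ℓ₂ := ℓ₂) hα k
    have hS1 := one_le_stepSymbol (ℓ₁ := ℓ₁) (ℓ₂ := ℓ₂) hP hh k
    have h3 := sq_mul_rho_le_stepSymbol (ℓ₁ := ℓ₁) (ℓ₂ := ℓ₂) hP hh h1 k
    have hA : 1 ≤ 1 + 1 / P.κ := by
      have : 0 < 1 / P.κ := by positivity
      linarith
    refine le_of_mul_le_mul_left ?_ (pow_pos (zero_lt_one.trans_le hS1) 2)
    calc stepSymbol ℓ₁ ℓ₂ P h k ^ 2 * (rho2 ℓ₁ ℓ₂ P.α k * ‖fcoeff (X - V) k‖ ^ 2)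
        = rho ℓ₁ ℓ₂ P.α k ^ 2 * (stepSymbol ℓ₁ ℓ₂ P h k ^ 2 * ‖fcoeff (X - V) k‖ ^ 2) := by
          rw [rho2]; ring
      _ = (h ^ 2 * rho ℓ₁ ℓ₂ P.α k) * (rho ℓ₁ ℓ₂ P.α k * ‖g k‖ ^ 2) := by rw [hnorm]; ring
      _ ≤ ((1 + 1 / P.κ) * stepSymbol ℓ₁ ℓ₂ P h k ^ 2) * (rho ℓ₁ ℓ₂ P.α k * ‖g k‖ ^ 2) := by gcongr
      _ ≤ ((1 + 1 / P.κ) ^ 2 * stepSymbol ℓ₁ ℓ₂ P h k ^ 2) * (rho ℓ₁ ℓ₂ P.α k * ‖g k‖ ^ 2) := by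
          gcongr
          nlinarith
      _ = _ := by ring
  · refine (bg.one_of_rho hα).of_le hh.le (fun _ => zero_le_one) fun k => ?_
    have hS1 := one_le_stepSymbol (ℓ₁ := ℓ₁) (ℓ₂ := ℓ₂) hP hh k
    rw [one_mul, one_mul, ← hnorm]
    exact le_mul_of_one_le_left (sq_nonneg _) (one_le_pow₀ hS1)

namespace ExactData

variable (D : ExactData P T m L φ₀ φ₁ u v a j)
include D

/-- A bounded velocity predictor in H^α makes the position predictor O(τ) accurate in H^α, which is
enough for the first full step. -/
theorem exists_bd_first_velocity : ∃ C, 0 ≤ C ∧ ∃ h₀, 0 < h₀ ∧ ∀ (h : ℝ) (X : L2per ℓ₁ ℓ₂) (Rt : ℝ),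
    0 < h → h ≤ h₀ → StepEq P h (u 0) (v 0) (P.b (u 0)) (P.sav (u 0)) X Rt →
    Bd (rho2 ℓ₁ ℓ₂ P.α) (fcoeff X) C := by
  have hP := D.valid
  have hL := D.L_nonneg
  have hκ := hP.hκ
  have hγ₁ := hP.hγ₁
  have hγ₂ := hP.hγ₂
  have h0 : (0 : ℝ) ∈ Icc 0 T := left_mem_Icc.2 D.hT.le
  obtain ⟨Cb, hCb, hb⟩ := exists_b_bound (ℓ₁ := ℓ₁) (ℓ₂ := ℓ₂) D.smooth hP.hα hP.hα' hL
    (D.energy 0 h0)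
  obtain ⟨bb, -⟩ := hb (u 0) ⟨D.bd2_u h0, le_rfl⟩
  set A := √(ℓ₁ * ℓ₂) with hA
  have hA0 : 0 ≤ A := Real.sqrt_nonneg _
  set G₀ := (P.γ₂ + P.γ₁ + 2 * P.κ) * L with hG₀
  have hG₀n : 0 ≤ G₀ := by positivity
  set Rm := 2 * (L + A ^ 2 * Cb * (L + G₀)) with hRm
  have hRmn : 0 ≤ Rm := by positivity
  refine ⟨L + (1 + 1 / P.κ) * (G₀ + Rm * Cb), by positivity, 1 / (1 + A ^ 2 * Cb ^ 2), by positivity,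
    fun h X Rt hh hle hS => ?_⟩
  have hle2 : h * (1 + A ^ 2 * Cb ^ 2) ≤ 1 := (le_div_iff₀ (by positivity)).1 hle
  have hle1 : h ≤ 1 := by
    have : 0 ≤ h * (A ^ 2 * Cb ^ 2) := by positivity
    linarith
  obtain ⟨b1, b2⟩ := hS.bd_sub hP hh hle1 (D.bd_u h0) (D.bd_v h0) bb
  have eX : fcoeff X = fcoeff (v 0) + fcoeff (X - v 0) := by rw [fcoeff_sub]; abel
  have hv2 := (D.bd_v h0).rho2_of_rho7 hP.hα
  have nX : ‖X‖ ≤ A * (L + h * (G₀ + |Rt| * Cb)) := by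
    refine Bd.norm_L2_le ?_
    rw [eX]
    exact ((hv2.rho_of_rho2 hP.hα).one_of_rho hP.hα).add b2
  have nb := (bb.one_of_rho hP.hα).norm_L2_le
  have hRt : |Rt| ≤ Rm := by
    have i1 := (abs_real_inner_le_norm (P.b (u 0)) X).trans
      (mul_le_mul nb nX (norm_nonneg _) (by positivity))
    -- The scalar also occurs on the right, because X depends on it. The choice of h₀ makes its
    -- coefficient at most 1/2, so it is absorbed, and this is the source of the factor 2 in `Rm`.
    have i2 : |Rt| ≤ L + h / 2 * (A * Cb * (A * (L + h * (G₀ + |Rt| * Cb)))) := by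
      rw [hS.eqr]
      refine (abs_add_le _ _).trans (add_le_add (D.abs_sav_le h0) ?_)
      rw [abs_mul, abs_of_pos (by positivity : 0 < h / 2), ← hS.eqr]
      exact mul_le_mul_of_nonneg_left i1 (by positivity)
    have hx := abs_nonneg Rt
    have i3 : h * (A ^ 2 * Cb ^ 2) ≤ 1 := by linarith
    have i4 : h * (h * (A ^ 2 * Cb ^ 2)) * |Rt| ≤ 1 * |Rt| := by
      refine mul_le_mul_of_nonneg_right ?_ hx
      exact mul_le_one₀ hle1 (by positivity) i3
    have i5 : h * (A ^ 2 * Cb * (L + h * G₀)) ≤ 1 * (A ^ 2 * Cb * (L + 1 * G₀)) := by gcongr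
    have i6 : 0 ≤ A ^ 2 * Cb * (L + G₀) := by positivity
    have e : L + h / 2 * (A * Cb * (A * (L + h * (G₀ + |Rt| * Cb))))
        = L + 1 / 2 * (h * (A ^ 2 * Cb * (L + h * G₀))) + 1 / 2 * (h * (h * (A ^ 2 * Cb ^ 2)) * |Rt|) := by
      ring
    rw [e] at i2
    rw [hRm]
    linarith
  rw [eX]
  refine (hv2.add b1).le ?_
  gcongr

end ExactData

end

/-! ### Discrete Gronwall inequality with bootstrap -/

section

/-- The bounds have the form (a − 1)t so that adding the source t to one of them leaves at most a t.
After the implicit term is moved to the left, the claim reduces to 3sa(1 − 2s) + 2s ≥ 0. -/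
theorem gronwall_step {s t a x y z : ℝ} (hs : 0 ≤ s) (hs' : s ≤ 1 / 2) (ht : 0 ≤ t) (ha : 0 ≤ a)
    (hx : x ≤ (a - 1) * t) (hy : y ≤ (a - 1) * t) (hz : z ≤ x + s * (z + x + y + t)) :
    z ≤ (a * (1 + 6 * s) - 1) * t := by
  have h1 := mul_le_mul_of_nonneg_left hx (by linarith : 0 ≤ 1 + s)
  have h2 := mul_le_mul_of_nonneg_left hy hs
  have h3 : 0 ≤ (3 * (s * a) * (1 - 2 * s) + 2 * s) * t := by
    have : 0 ≤ 1 - 2 * s := by linarith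
    positivity
  have h4 : (1 - s) * z ≤ (1 - s) * ((a * (1 + 6 * s) - 1) * t) := by linarith
  exact le_of_mul_le_mul_left h4 (by linarith)

/-- A two-step discrete Gronwall inequality whose hypothesis is available only while the
sequence is small. -/
theorem exists_gronwall_bootstrap {C ε T : ℝ} (hC : 0 ≤ C) (hε : 0 < ε) (hT : 0 ≤ T) :
    ∃ C', 0 ≤ C' ∧ ∃ τ₀, 0 < τ₀ ∧ τ₀ ≤ 1 / 4 ∧ ∀ (K : ℕ) (τ : ℝ), 0 < τ → τ < τ₀ → K * τ = T →
      ∀ E : ℕ → ℝ, (∀ n, 0 ≤ E n) → E 0 = 0 → (0 < K → E 1 ≤ C * τ * (E 1 + τ ^ 2)) →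
      (∀ n, 1 ≤ n → n < K → C * (τ ^ 3 + E n + E (n - 1)) ≤ ε →
        E (n + 1) ≤ E n + C * τ * (E (n + 1) + E n + E (n - 1) + τ ^ 3)) →
      (∀ n ≤ K, E n ≤ C' * τ ^ 3) ∧
        ∀ n ≤ K, ∀ i ≤ K, C * (τ ^ 3 + E n + E i) ≤ ε := by
  -- The first step gives E 1 ≤ 2Cτ³ = (B − 1)τ³, and each later step multiplies by at most 1 + 6Cτ,
  -- whose K-th power is at most exp(6CT).
  set B := 1 + 2 * C with hB
  set C' := B * Real.exp (6 * C * T) with hC'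
  have hB1 : 1 ≤ B := by linarith
  have hB0 : 0 < B := by linarith
  have hC'0 : 0 ≤ C' := by positivity
  refine ⟨C', hC'0, min (1 / 4) (min (1 / (2 * C + 1)) (ε / (C * (1 + 2 * C') + 1))), by positivity,
    min_le_left _ _, fun K τ hτ hlt hK E hE hE0 hE1 hstep => ?_⟩
  obtain ⟨l1, l2⟩ := lt_min_iff.1 hlt
  obtain ⟨l2, l3⟩ := lt_min_iff.1 l2
  rw [lt_div_iff₀ (by positivity)] at l2 l3
  have hs : C * τ ≤ 1 / 2 := by linarith
  have hs0 : 0 ≤ C * τ := by positivity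
  have ht0 : 0 ≤ τ ^ 3 := by positivity
  have ht1 : τ ^ 3 ≤ τ := pow_le_of_le_one hτ.le (by linarith) (by norm_num)
  set q := 1 + 6 * (C * τ) with hq
  have hq1 : 1 ≤ q := by linarith
  have hpow : ∀ n ≤ K, B * q ^ n ≤ C' := by
    intro n hn
    refine mul_le_mul_of_nonneg_left ?_ hB0.le
    calc q ^ n ≤ q ^ K := pow_le_pow_right₀ hq1 hn
      _ ≤ Real.exp (6 * (C * τ)) ^ K := by
        refine pow_le_pow_left₀ (by linarith) ?_ K
        rw [hq, add_comm]; exact Real.add_one_le_exp _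
      _ = Real.exp (6 * C * T) := by rw [← Real.exp_nat_mul, ← hK]; congr 1; ring
  -- The bootstrap: the claimed bound itself implies the smallness under which the recursion is
  -- available, because the last term in the choice of τ₀ gives C(1 + 2C')τ ≤ ε.
  have hsmall : ∀ x y, x ≤ C' * τ ^ 3 → y ≤ C' * τ ^ 3 → C * (τ ^ 3 + x + y) ≤ ε := by
    intro x y hx hy
    have h1 : C * (τ ^ 3 + x + y) ≤ C * ((1 + 2 * C') * τ ^ 3) :=
      mul_le_mul_of_nonneg_left (by linarith) hC
    have h2 : C * (1 + 2 * C') * τ ^ 3 ≤ C * (1 + 2 * C') * τ :=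
      mul_le_mul_of_nonneg_left ht1 (by positivity)
    linarith
  have hmain : ∀ n, n + 1 ≤ K → E n ≤ (B * q ^ n - 1) * τ ^ 3 ∧
      E (n + 1) ≤ (B * q ^ (n + 1) - 1) * τ ^ 3 := by
    intro n
    induction n with
    | zero =>
      intro hn
      constructor
      · rw [hE0, pow_zero, mul_one]; exact mul_nonneg (by linarith) ht0
      · have h1 := hE1 hn
        have h2 : C * τ * E 1 ≤ 1 / 2 * E 1 := mul_le_mul_of_nonneg_right hs (hE 1)
        have h3 : B * 1 ≤ B * q ^ (0 + 1) := mul_le_mul_of_nonneg_left (one_le_pow₀ hq1) hB0.le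
        have h4 : E 1 ≤ 2 * C * τ ^ 3 := by
          have e : C * τ * (E 1 + τ ^ 2) = C * τ * E 1 + C * τ ^ 3 := by ring
          rw [e] at h1; linarith
        refine h4.trans (mul_le_mul_of_nonneg_right ?_ ht0)
        linarith
    | succ n ih =>
      intro hn
      obtain ⟨i1, i2⟩ := ih (by omega)
      refine ⟨i2, ?_⟩
      have b1 : E n ≤ (B * q ^ (n + 1) - 1) * τ ^ 3 := by
        refine i1.trans (mul_le_mul_of_nonneg_right ?_ ht0)
        have := mul_le_mul_of_nonneg_left (pow_le_pow_right₀ hq1 (n.le_add_right 1)) hB0.le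
        linarith
      have hle : (B * q ^ (n + 1) - 1) * τ ^ 3 ≤ C' * τ ^ 3 :=
        mul_le_mul_of_nonneg_right (by linarith [hpow (n + 1) (by omega)]) ht0
      have h1 := hstep (n + 1) (by omega) (by omega) (hsmall _ _ (i2.trans hle) (b1.trans hle))
      have h2 := gronwall_step hs0 hs ht0 (by positivity) i2 b1 h1
      rw [mul_assoc, ← hq, ← pow_succ] at h2
      exact h2
  have hfin : ∀ n ≤ K, E n ≤ C' * τ ^ 3 := by
    intro n hn
    rcases n with _ | n
    · rw [hE0]; positivity
    · exact (hmain n hn).2.trans (mul_le_mul_of_nonneg_right (by linarith [hpow (n + 1) hn]) ht0)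
  exact ⟨hfin, fun n hn i hi => hsmall _ _ (hfin n hn) (hfin i hi)⟩

end

/-! ### Closing the error estimate -/

section

variable {ℓ₁ ℓ₂ : ℝ} [Fact (0 < ℓ₁)] [Fact (0 < ℓ₂)] {P : Model}
variable {T m L : ℝ} {φ₀ φ₁ : L2per ℓ₁ ℓ₂} {u v a j : ℝ → L2per ℓ₁ ℓ₂}

namespace ExactData

variable (D : ExactData P T m L φ₀ φ₁ u v a j)
include D

theorem exists_admissible_nhds : ∃ c₀ δ, 0 < c₀ ∧ 0 < δ ∧ ∀ t ∈ Icc 0 T, ∀ W : L2per ℓ₁ ℓ₂,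
    Bd (rho2 ℓ₁ ℓ₂ P.α) (fcoeff (u t - W)) δ → Admissible P (L + 1) c₀ W := by
  have hL := D.L_nonneg
  obtain ⟨c₀, hc₀, hE⟩ := D.exists_energy_lower
  obtain ⟨C, hC, h⟩ := exists_dF_bound (ℓ₁ := ℓ₁) (ℓ₂ := ℓ₂) D.smooth D.valid.hα D.valid.hα'
    (by linarith : 0 ≤ L + 1)
  -- The radius is at most 1, so W stays in the H^α ball of radius L + 1, and small enough that the
  -- energy drops by at most half of its minimum along the solution.
  refine ⟨c₀ / 2, min 1 (c₀ / 2 / (C + 1)), by positivity, by positivity, fun t ht W hW => ?_⟩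
  have bW : Bd (rho2 ℓ₁ ℓ₂ P.α) (fcoeff W) (L + 1) := by
    have e : fcoeff W = fcoeff (u t) - fcoeff (u t - W) := by rw [fcoeff_sub]; abel
    rw [e]
    exact ((D.bd2_u ht).sub hW).le (add_le_add le_rfl (min_le_left _ _))
  refine ⟨bW, ?_⟩
  have h1 := ((h (u t) ((D.bd2_u ht).le (by linarith))).2 W bW _ hW).2
  have h2 : C * min 1 (c₀ / 2 / (C + 1)) ≤ c₀ / 2 := by
    refine (mul_le_mul_of_nonneg_left (min_le_right _ _) hC).trans ?_
    rw [mul_div_assoc', div_le_iff₀ (by positivity)]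
    nlinarith
  have h3 := hE t ht
  have h4 := (abs_le.1 (h1.trans h2)).2
  linarith

theorem admissible_self {c₀ δ : ℝ} (hδ : 0 < δ) {t : ℝ} (ht : t ∈ Icc 0 T)
    (h : ∀ W : L2per ℓ₁ ℓ₂, Bd (rho2 ℓ₁ ℓ₂ P.α) (fcoeff (u t - W)) δ → Admissible P (L + 1) c₀ W) :
    Admissible P (L + 1) c₀ (u t) :=
  h _ (by rw [sub_self, fcoeff_zero]; exact (Bd.zero (rho2_nonneg P.α)).le hδ.le)

theorem bd_err {τ : ℝ} {K n : ℕ} {S : Discrete ℓ₁ ℓ₂} (hS : IsScheme P φ₀ φ₁ τ K S) (hn : n ≤ K)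
    (ht : n * τ ∈ Icc 0 T) :
    Bd (rho2 ℓ₁ ℓ₂ P.α) (fcoeff (u (n * τ) - S.U n))
        ((1 + 1 / P.κ) * √(err P u v (n * τ) (S.U n) (S.V n) (S.R n))) ∧
      Bd (rho ℓ₁ ℓ₂ P.α) (fcoeff (v (n * τ) - S.V n))
        (√(err P u v (n * τ) (S.U n) (S.V n) (S.R n))) := by
  have hκ := D.valid.hκ
  obtain ⟨h1, h2⟩ := bd_of_errQ D.valid
    (summable_err D.valid (D.sol.mem_u _ ht) (D.sol.mem_v _ ht) (hS.mem_U n hn) (hS.mem_V n hn))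
  have h3 := Real.sqrt_le_sqrt (le_add_of_nonneg_right (sq_nonneg (P.sav (u (n * τ)) - S.R n)) :
    errQ ℓ₁ ℓ₂ P (fcoeff (u (n * τ) - S.U n)) (fcoeff (v (n * τ) - S.V n)) ≤ _)
  exact ⟨h1.le (mul_le_mul_of_nonneg_left h3 (by positivity)), h2.le h3⟩

/-- The distance from the extrapolated value to the solution at the midpoint. -/
theorem bd_midpoint_error {τ : ℝ} (hτ : 0 < τ) {K n : ℕ} (hK : K * τ = T) {S : Discrete ℓ₁ ℓ₂}
    (hS : IsScheme P φ₀ φ₁ τ K S) (hn : n + 1 < K) :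
    Bd (rho2 ℓ₁ ℓ₂ P.α) (fcoeff (u ((n + 1 : ℕ) * τ + τ / 2) - S.Ut (n + 1)))
      (L * τ ^ 2 + 3 / 2 * (1 + 1 / P.κ)
          * √(err P u v ((n + 1 : ℕ) * τ) (S.U (n + 1)) (S.V (n + 1)) (S.R (n + 1)))
        + 1 / 2 * (1 + 1 / P.κ) * √(err P u v (n * τ) (S.U n) (S.V n) (S.R n))) := by
  have hL := D.L_nonneg
  have h0 : (0 : ℝ) ≤ n * τ := by positivity
  have h1 : ((n + 1 : ℕ) : ℝ) * τ = n * τ + τ := by push_cast; ring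
  have h2 : n * τ + τ + τ ≤ T := by
    have : ((n + 2 : ℕ) : ℝ) ≤ K := by exact_mod_cast hn
    have := mul_le_mul_of_nonneg_right this hτ.le
    rw [hK] at this
    push_cast at this
    linarith
  have b0 := (D.bd_err hS (n := n) (by omega) ⟨h0, by linarith⟩).1
  have b1 := (D.bd_err hS (n := n + 1) (by omega) (by rw [h1]; exact ⟨by linarith, by linarith⟩)).1
  have b2 := D.bd_extrapolation (t := (n + 1 : ℕ) * τ) (h := τ / 2)
    (by rw [h1]; exact ⟨by linarith, by linarith⟩) (by rw [h1]; exact ⟨by linarith, by linarith⟩)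
    (by rw [h1]; exact ⟨by linarith, by linarith⟩)
  have e1 : ((n + 1 : ℕ) : ℝ) * τ - 2 * (τ / 2) = n * τ := by rw [h1]; ring
  rw [e1] at b2
  have e2 : u ((n + 1 : ℕ) * τ + τ / 2) - S.Ut (n + 1)
      = (u ((n + 1 : ℕ) * τ + τ / 2) - (1 / 2 : ℝ) • ((3 : ℝ) • u ((n + 1 : ℕ) * τ) - u (n * τ)))
        + (3 / 2 : ℝ) • (u ((n + 1 : ℕ) * τ) - S.U (n + 1)) - (1 / 2 : ℝ) • (u (n * τ) - S.U n) := by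
    rw [Discrete.Ut, if_neg (Nat.succ_ne_zero n), Nat.add_sub_cancel]
    module
  rw [e2, fcoeff_sub, fcoeff_add, fcoeff_smul, fcoeff_smul]
  refine ((b2.add (b1.smul _)).sub (b0.smul _)).le ?_
  rw [abs_of_pos (by norm_num), abs_of_pos (by norm_num)]
  have : 3 * L * (τ / 2) ^ 2 ≤ L * τ ^ 2 := by nlinarith [mul_nonneg hL (sq_nonneg τ)]
  linarith

-- The Gronwall threshold is ε = δ², with δ the radius of the admissible neighbourhood of the
-- trajectory. Smallness of two consecutive errors then makes the next step estimate applicable and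
-- also gives E(Ũ) > 0.
set_option maxHeartbeats 400000 in
theorem exists_err_bound : ∃ C, 0 ≤ C ∧ ∃ τ₁, 0 < τ₁ ∧ τ₁ ≤ 1 / 4 ∧ ∀ (K : ℕ) (τ : ℝ), 0 < τ →
    τ < τ₁ → K * τ = T → ∀ S : Discrete ℓ₁ ℓ₂, IsScheme P φ₀ φ₁ τ K S →
    (∀ n < K, 0 < P.E (S.Ut n)) ∧
      ∀ n ≤ K, err P u v (n * τ) (S.U n) (S.V n) (S.R n) ≤ C * τ ^ 3 := by
  have hP := D.valid
  have hκ := hP.hκ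
  have hL := D.L_nonneg
  obtain ⟨c₀, δ, hc₀, hδ, hadm⟩ := D.exists_admissible_nhds
  obtain ⟨C₁, hC₁, hstep⟩ := D.exists_step_bound (by linarith : 0 ≤ L + 1) hc₀
  obtain ⟨Cv, hCv, h₀, hh₀, hfirst⟩ := D.exists_bd_first_velocity
  set A := 1 + 1 / P.κ with hA
  have hA0 : 0 < A := by positivity
  set C₂ := 3 * (L ^ 2 + 3 * A ^ 2) with hC₂
  have hC₂0 : 0 ≤ C₂ := by positivity
  -- The three summands serve, in order, the first step, the later steps, and the bound of the
  -- squared midpoint error by δ².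
  set C := C₁ * ((L + Cv) ^ 2 + 1) + C₁ * (1 + C₂) + C₂ with hC
  have hC0 : 0 ≤ C := by positivity
  obtain ⟨C', hC', τ₀, hτ₀, hτ₀1, hgr⟩ := exists_gronwall_bootstrap hC0 (pow_pos hδ 2) D.hT.le
  -- The bound 2h₀ makes the half step τ/2 admissible for the first velocity bound, and the last
  -- entry keeps the first predictor within distance δ of u(τ/2).
  refine ⟨C', hC', min τ₀ (min (2 * h₀) (δ / (L + Cv + 1))), by positivity, (min_le_left _ _).trans hτ₀1,
    fun K τ hτ hlt hK S hS => ?_⟩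
  obtain ⟨l1, l2⟩ := lt_min_iff.1 hlt
  obtain ⟨l2, l3⟩ := lt_min_iff.1 l2
  rw [lt_div_iff₀ (by positivity)] at l3
  have hmid : ∀ n < K, MidPoint T (τ / 2) (√τ) (n * τ + τ / 2) := by
    intro n hn
    have h2 : n * τ + τ ≤ T := by
      have : ((n + 1 : ℕ) : ℝ) ≤ K := by exact_mod_cast hn
      have := mul_le_mul_of_nonneg_right this hτ.le
      rw [hK] at this
      push_cast at this
      linarith
    have h0 : (0 : ℝ) ≤ n * τ := by positivity
    refine ⟨Real.sqrt_pos.2 hτ, ?_, ?_, by linarith, by linarith⟩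
    · rw [Real.sqrt_le_left (by norm_num)]; linarith
    · rw [Real.sq_sqrt hτ.le]; ring
  set E : ℕ → ℝ := fun n => err P u v (n * τ) (S.U n) (S.V n) (S.R n) with hEdef
  have hE : ∀ n, 0 ≤ E n := fun n => err_nonneg hP _ _ _ _
  have hone : ∀ n < K, ∀ D', D' ≤ δ →
      Bd (rho2 ℓ₁ ℓ₂ P.α) (fcoeff (u (n * τ + τ / 2) - S.Ut n)) D' →
      E (n + 1) ≤ E n + C₁ * τ * (E (n + 1) + E n + D' ^ 2 + τ ^ 3) := by
    intro n hn D' hD hD'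
    have H := hmid n hn
    have hc := Ioo_subset_Icc_self H.c_mem
    obtain ⟨s1, s2⟩ := hS.step hτ hn
    have hs := hstep _ _ _ H (S.U n) (S.V n) (S.U (n + 1)) (S.V (n + 1)) (S.Ut n) (S.R n) (S.R (n + 1))
      (hS.mem_U n hn.le) (hS.mem_V n hn.le) (hS.mem_U _ hn) (hS.mem_V _ hn)
      (by rw [Real.sq_sqrt hτ.le]; exact s1) s2 (hadm _ hc _ (hD'.le hD))
      (D.admissible_self hδ hc (hadm _ hc)) D' hD'
    have e1 : n * τ + τ / 2 + τ / 2 = ((n + 1 : ℕ) : ℝ) * τ := by push_cast; ring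
    have e2 : n * τ + τ / 2 - τ / 2 = n * τ := by ring
    have e3 : √τ ^ 6 = τ ^ 3 := by rw [show √τ ^ 6 = (√τ ^ 2) ^ 3 by ring, Real.sq_sqrt hτ.le]
    rw [e1, e2, e3, Real.sq_sqrt hτ.le] at hs
    exact hs
  have hstart : 0 < K → Bd (rho2 ℓ₁ ℓ₂ P.α) (fcoeff (u ((0 : ℕ) * τ + τ / 2) - S.Ut 0))
      ((L + Cv) * τ) := by
    intro hK0
    have H := hmid 0 hK0
    obtain ⟨s1, s2⟩ := hS.half hτ
    rw [hS.init_U, hS.init_V, hS.init_R, ← D.sol.init_u, ← D.sol.init_v] at s2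
    have b1 := hfirst _ _ _ (by positivity) (by linarith) s2
    have hT2 : τ / 2 ≤ T := by have := H.c_mem.2; push_cast at this; linarith
    have b2 := (D.bd_diff_u le_rfl (by positivity : 0 ≤ τ / 2) hT2).rho2_of_rho7 hP.hα
    have e : fcoeff (u ((0 : ℕ) * τ + τ / 2) - S.Ut 0)
        = (fcoeff (u (τ / 2)) - fcoeff (u 0)) - (τ / 2) • fcoeff S.Vh := by
      rw [Discrete.Ut, if_pos rfl, s1, hS.init_U, D.sol.init_u, ← fcoeff_sub, ← fcoeff_smul, ← fcoeff_sub]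
      congr 1
      rw [Nat.cast_zero, zero_mul, zero_add]
      abel
    rw [e]
    refine (b2.sub (b1.smul _)).le ?_
    rw [abs_of_pos (by positivity)]
    linarith only [mul_nonneg hL hτ.le, mul_nonneg hCv hτ.le]
  have hstart_le : (L + Cv) * τ ≤ δ := by linarith only [l3, hτ]
  have hmidE : ∀ n, 1 ≤ n → n < K → ∃ D', 0 ≤ D' ∧ D' ^ 2 ≤ C₂ * (τ ^ 3 + E n + E (n - 1)) ∧
      Bd (rho2 ℓ₁ ℓ₂ P.α) (fcoeff (u (n * τ + τ / 2) - S.Ut n)) D' := by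
    intro n hn1 hn
    obtain ⟨n, rfl⟩ : ∃ i, n = i + 1 := ⟨n - 1, by omega⟩
    have hb := D.bd_midpoint_error hτ hK hS hn
    refine ⟨_, hb.1, ?_, hb⟩
    rw [Nat.add_sub_cancel]
    have q1 := Real.sq_sqrt (hE (n + 1))
    have q0 := Real.sq_sqrt (hE n)
    change (L * τ ^ 2 + 3 / 2 * A * √(E (n + 1)) + 1 / 2 * A * √(E n)) ^ 2 ≤ _
    have h3 : ∀ x y z : ℝ, (x + y + z) ^ 2 ≤ 3 * (x ^ 2 + y ^ 2 + z ^ 2) := fun x y z => by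
      nlinarith [sq_nonneg (x - y), sq_nonneg (x - z), sq_nonneg (y - z)]
    refine (h3 _ _ _).trans ?_
    rw [mul_pow (3 / 2 * A), mul_pow (1 / 2 * A), q1, q0, hC₂]
    have h4 : (L * τ ^ 2) ^ 2 ≤ L ^ 2 * τ ^ 3 := by
      have : τ ^ 4 ≤ τ ^ 3 := pow_le_pow_of_le_one hτ.le (by linarith) (by norm_num)
      have := mul_le_mul_of_nonneg_left this (sq_nonneg L)
      refine le_trans (le_of_eq (by ring)) this
    have p1 : 0 ≤ A ^ 2 * E (n + 1) := mul_nonneg (sq_nonneg A) (hE _)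
    have p0 : 0 ≤ A ^ 2 * E n := mul_nonneg (sq_nonneg A) (hE _)
    have p2 : 0 ≤ L ^ 2 * E (n + 1) := mul_nonneg (sq_nonneg L) (hE _)
    have p3 : 0 ≤ L ^ 2 * E n := mul_nonneg (sq_nonneg L) (hE _)
    have p4 : 0 ≤ A ^ 2 * τ ^ 3 := by positivity
    linarith only [h4, p1, p0, p2, p3, p4]
  have hsmall : ∀ n, 1 ≤ n → n < K → C * (τ ^ 3 + E n + E (n - 1)) ≤ δ ^ 2 → ∃ D', D' ≤ δ ∧
      D' ^ 2 ≤ C₂ * (τ ^ 3 + E n + E (n - 1)) ∧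
      Bd (rho2 ℓ₁ ℓ₂ P.α) (fcoeff (u (n * τ + τ / 2) - S.Ut n)) D' := by
    intro n hn1 hn hsm
    obtain ⟨D', d0, d1, d2⟩ := hmidE n hn1 hn
    refine ⟨D', ?_, d1, d2⟩
    have hx : 0 ≤ τ ^ 3 + E n + E (n - 1) := by have := hE n; have := hE (n - 1); positivity
    have : C₂ ≤ C := by
      have : 0 ≤ C₁ * ((L + Cv) ^ 2 + 1) + C₁ * (1 + C₂) := by positivity
      linarith
    have := mul_le_mul_of_nonneg_right this hx
    exact abs_le_of_sq_le_sq' (by linarith) hδ.le |>.2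
  have h0 : E 0 = 0 := by
    simp only [hEdef, err, hS.init_U, hS.init_V, hS.init_R, Nat.cast_zero, zero_mul, D.sol.init_u,
      D.sol.init_v, sub_self, fcoeff_zero, errQ]
    simp
  -- The predictor error (L + Cv)τ enters squared and multiplied by τ, so a first order predictor
  -- does not spoil the rate.
  have hE1 : 0 < K → E 1 ≤ C * τ * (E 1 + τ ^ 2) := by
    intro hK0
    have h1 := hone 0 hK0 _ hstart_le (hstart hK0)
    rw [h0, zero_add, add_zero, zero_add] at h1
    have ht : τ ^ 3 ≤ τ ^ 2 := pow_le_pow_of_le_one hτ.le (by linarith) (by norm_num)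
    have e1 := hE 1
    have h2 : E 1 + ((L + Cv) * τ) ^ 2 + τ ^ 3 ≤ ((L + Cv) ^ 2 + 1) * (E 1 + τ ^ 2) := by
      have h5 : 0 ≤ (L + Cv) ^ 2 * E 1 := by positivity
      have e : ((L + Cv) ^ 2 + 1) * (E 1 + τ ^ 2)
          = E 1 + ((L + Cv) * τ) ^ 2 + τ ^ 2 + (L + Cv) ^ 2 * E 1 := by ring
      rw [e]
      linarith only [h5, ht]
    have h3 : C₁ * ((L + Cv) ^ 2 + 1) ≤ C := by
      have : 0 ≤ C₁ * (1 + C₂) + C₂ := by positivity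
      linarith
    calc E 1 ≤ C₁ * τ * (E 1 + ((L + Cv) * τ) ^ 2 + τ ^ 3) := h1
      _ ≤ C₁ * τ * (((L + Cv) ^ 2 + 1) * (E 1 + τ ^ 2)) := by gcongr
      _ = C₁ * ((L + Cv) ^ 2 + 1) * τ * (E 1 + τ ^ 2) := by ring
      _ ≤ _ := by gcongr
  have hrec : ∀ n, 1 ≤ n → n < K → C * (τ ^ 3 + E n + E (n - 1)) ≤ δ ^ 2 →
      E (n + 1) ≤ E n + C * τ * (E (n + 1) + E n + E (n - 1) + τ ^ 3) := by
    intro n hn1 hn hsm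
    obtain ⟨D', d0, d1, d2⟩ := hsmall n hn1 hn hsm
    have h1 := hone n hn D' d0 d2
    have q1 := hE (n + 1)
    have q2 := hE n
    have q3 := hE (n - 1)
    have h3 : C₁ * (1 + C₂) ≤ C := by
      have : 0 ≤ C₁ * ((L + Cv) ^ 2 + 1) + C₂ := by positivity
      linarith
    refine h1.trans (add_le_add le_rfl ?_)
    calc C₁ * τ * (E (n + 1) + E n + D' ^ 2 + τ ^ 3)
        ≤ C₁ * τ * ((1 + C₂) * (E (n + 1) + E n + E (n - 1) + τ ^ 3)) := by
          refine mul_le_mul_of_nonneg_left ?_ (by positivity)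
          have : 0 ≤ C₂ * E (n + 1) := by positivity
          linarith
      _ = C₁ * (1 + C₂) * τ * (E (n + 1) + E n + E (n - 1) + τ ^ 3) := by ring
      _ ≤ _ := by gcongr
  obtain ⟨g1, g2⟩ := hgr K τ hτ l1 hK E hE h0 hE1 hrec
  -- Positivity of the energy is recovered after the fact: the final error bounds put every
  -- extrapolated state in the admissible neighbourhood.
  refine ⟨fun n hn => ?_, g1⟩
  have hc := Ioo_subset_Icc_self (hmid n hn).c_mem
  rcases Nat.eq_zero_or_pos n with rfl | hn1
  · exact hc₀.trans_le (hadm _ hc _ ((hstart hn).le hstart_le)).energy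
  · obtain ⟨D', d0, d1, d2⟩ := hsmall n hn1 hn (g2 n hn.le (n - 1) (by omega))
    exact hc₀.trans_le (hadm _ hc _ (d2.le d0)).energy

end ExactData

end

/-! ### From the error functional to the stated norms -/

section

variable {ℓ₁ ℓ₂ : ℝ} [Fact (0 < ℓ₁)] [Fact (0 < ℓ₂)] {P : Model}
variable {T m L : ℝ} {φ₀ φ₁ : L2per ℓ₁ ℓ₂} {u v a j : ℝ → L2per ℓ₁ ℓ₂}

theorem hSemi_sq_le {s C : ℝ} {ω : ℤ × ℤ → ℝ} {w : L2per ℓ₁ ℓ₂} (h : Bd ω (fcoeff w) C)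
    (hω : ∀ k, freqSq ℓ₁ ℓ₂ k ^ s ≤ ω k) : hSemi s w ^ 2 ≤ C ^ 2 := by
  have h0 : ∀ k, 0 ≤ freqSq ℓ₁ ℓ₂ k ^ s := fun k => Real.rpow_nonneg (freqSq_nonneg k) s
  rw [hSemi, Real.sq_sqrt (tsum_nonneg fun k => mul_nonneg (h0 k) (sq_nonneg _))]
  exact (h.mono h0 hω).tsum_le

theorem Bd.hSemi_half_sq_le {α C : ℝ} (hα : 1 < α) {w : L2per ℓ₁ ℓ₂}
    (h : Bd (rho ℓ₁ ℓ₂ α) (fcoeff w) C) : hSemi (α / 2) w ^ 2 ≤ C ^ 2 :=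
  hSemi_sq_le h (mu_le_rho hα)

theorem Bd.hSemi_sq_le {α C : ℝ} (hα : 1 < α) {w : L2per ℓ₁ ℓ₂}
    (h : Bd (rho2 ℓ₁ ℓ₂ α) (fcoeff w) C) : hSemi α w ^ 2 ≤ C ^ 2 :=
  SAVWave.hSemi_sq_le h fun k => by
    have e : freqSq ℓ₁ ℓ₂ k ^ α = mu ℓ₁ ℓ₂ α k ^ 2 := by
      rw [mu, ← Real.rpow_natCast, ← Real.rpow_mul (freqSq_nonneg k)]
      norm_num
    rw [e]
    exact pow_le_pow_left₀ (mu_nonneg _ _) (mu_le_rho hα k) 2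

theorem Bd.norm_sq_le {α C : ℝ} (hα : 1 < α) {w : L2per ℓ₁ ℓ₂}
    (h : Bd (rho ℓ₁ ℓ₂ α) (fcoeff w) C) : ‖w‖ ^ 2 ≤ ℓ₁ * ℓ₂ * C ^ 2 := by
  have h1 := pow_le_pow_left₀ (norm_nonneg w) (h.one_of_rho hα).norm_L2_le 2
  rwa [mul_pow, Real.sq_sqrt (area_pos ℓ₁ ℓ₂).le] at h1

theorem Bd.eLpNorm_le {α C : ℝ} (hα : 1 < α) {w : L2per ℓ₁ ℓ₂}
    (h : Bd (rho2 ℓ₁ ℓ₂ α) (fcoeff w) C) :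
    eLpNorm w ∞ volume ≤ ENNReal.ofReal (sobolevConst ℓ₁ ℓ₂ α * C) := by
  rw [eLpNorm_exponent_top]
  exact eLpNormEssSup_le_of_ae_bound (h.ae_abs_le hα)

namespace ExactData

variable (D : ExactData P T m L φ₀ φ₁ u v a j)
include D

theorem error_sum_le {τ C : ℝ} {K n : ℕ} {S : Discrete ℓ₁ ℓ₂} (hS : IsScheme P φ₀ φ₁ τ K S)
    (hn : n ≤ K) (ht : n * τ ∈ Icc 0 T) (hE : err P u v (n * τ) (S.U n) (S.V n) (S.R n) ≤ C) :
    ‖u (n * τ) - S.U n‖ ^ 2 + P.κ * hSemi (P.α / 2) (u (n * τ) - S.U n) ^ 2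
        + P.κ * hSemi P.α (u (n * τ) - S.U n) ^ 2 + ‖v (n * τ) - S.V n‖ ^ 2
        + hSemi (P.α / 2) (v (n * τ) - S.V n) ^ 2 + (P.sav (u (n * τ)) - S.R n) ^ 2
      ≤ ((ℓ₁ * ℓ₂ + 2 * P.κ) * (1 + 1 / P.κ) ^ 2 + ℓ₁ * ℓ₂ + 2) * C := by
  have hα := D.valid.hα
  have hκ := D.valid.hκ
  have hA := area_pos ℓ₁ ℓ₂
  obtain ⟨b1, b2⟩ := D.bd_err hS hn ht
  have hQ := Real.sq_sqrt (err_nonneg (u := u) (v := v) D.valid (n * τ) (S.U n) (S.V n) (S.R n))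
  have n1 := (b1.rho_of_rho2 hα).norm_sq_le hα
  have n2 := mul_le_mul_of_nonneg_left ((b1.rho_of_rho2 hα).hSemi_half_sq_le hα) hκ.le
  have n3 := mul_le_mul_of_nonneg_left (b1.hSemi_sq_le hα) hκ.le
  have n4 := b2.norm_sq_le hα
  have n5 := b2.hSemi_half_sq_le hα
  have n6 : (P.sav (u (n * τ)) - S.R n) ^ 2 ≤ err P u v (n * τ) (S.U n) (S.V n) (S.R n) :=
    le_add_of_nonneg_left (errQ_nonneg D.valid _ _)
  rw [mul_pow, hQ] at n1 n2 n3
  rw [hQ] at n4 n5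
  refine le_trans ?_ (mul_le_mul_of_nonneg_left hE (by positivity))
  linarith

theorem eLpNorm_scheme_le {τ C : ℝ} {K n : ℕ} {S : Discrete ℓ₁ ℓ₂} (hS : IsScheme P φ₀ φ₁ τ K S)
    (hn : n ≤ K) (ht : n * τ ∈ Icc 0 T) (hE : err P u v (n * τ) (S.U n) (S.V n) (S.R n) ≤ C) :
    eLpNorm (S.U n) ∞ volume
      ≤ ENNReal.ofReal (sobolevConst ℓ₁ ℓ₂ P.α * (L + (1 + 1 / P.κ) * √C)) := by
  have hκ := D.valid.hκ
  refine Bd.eLpNorm_le D.valid.hα ?_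
  have e : fcoeff (S.U n) = fcoeff (u (n * τ)) - fcoeff (u (n * τ) - S.U n) := by
    rw [fcoeff_sub]; abel
  rw [e]
  exact (D.bd2_u ht).sub ((D.bd_err hS hn ht).1.le
    (mul_le_mul_of_nonneg_left (Real.sqrt_le_sqrt hE) (by positivity)))

end ExactData

end

end SAVWave

end

theorem mainTheorem3
    (ℓ₁ ℓ₂ : ℝ) [Fact (0 < ℓ₁)] [Fact (0 < ℓ₂)]
    (P : SAVWave.Model)
    (hα : 1 < P.α) (hα' : P.α ≤ 2) (hκ : 0 < P.κ) (hγ₁ : 0 ≤ P.γ₁) (hγ₂ : 0 ≤ P.γ₂)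
    (hF : ContDiff ℝ 3 P.F) (hF_nonneg : ∀ x, 0 ≤ P.F x)
    (T m L : ℝ) (hT : 0 < T) (hm : 7 * P.α / 2 ≤ m)
    (φ₀ φ₁ : SAVWave.L2per ℓ₁ ℓ₂) (u v a j : ℝ → SAVWave.L2per ℓ₁ ℓ₂)
    (hsol : SAVWave.IsSolution P T φ₀ φ₁ u v a j)
    (hE : ∀ t ∈ Set.Icc 0 T, 0 < P.E (u t))
    (hreg : SAVWave.RegularityBound P T m L φ₀ u v a j) :
    ∃ τ₁ > 0, ∃ C > 0, ∃ M > 0, ∀ K : ℕ, 0 < K → ∀ τ : ℝ, τ = T / K → τ < τ₁ →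
      ∃ S : SAVWave.Discrete ℓ₁ ℓ₂,
        SAVWave.IsScheme P φ₀ φ₁ τ K S ∧
        (∀ S' : SAVWave.Discrete ℓ₁ ℓ₂,
          SAVWave.IsScheme P φ₀ φ₁ τ K S' → SAVWave.Discrete.Agree K S' S) ∧
        (∀ n < K, 0 < P.E (S.Ut n)) ∧
        (∀ n ≤ K,
          ‖u (n * τ) - S.U n‖ ^ 2
            + P.κ * SAVWave.hSemi (P.α / 2) (u (n * τ) - S.U n) ^ 2
            + P.κ * SAVWave.hSemi P.α (u (n * τ) - S.U n) ^ 2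
            + ‖v (n * τ) - S.V n‖ ^ 2
            + SAVWave.hSemi (P.α / 2) (v (n * τ) - S.V n) ^ 2
            + (P.sav (u (n * τ)) - S.R n) ^ 2 ≤ C * τ ^ 3) ∧
        (∀ n ≤ K, eLpNorm (S.U n) ∞ volume ≤ ENNReal.ofReal M) := by
  have D : SAVWave.ExactData P T m L φ₀ φ₁ u v a j :=
    ⟨⟨hα, hα', hκ, hγ₁, hγ₂⟩, hF, hT, hm, hsol, hE, hreg⟩
  have hL := D.L_nonneg
  have hA := SAVWave.area_pos ℓ₁ ℓ₂
  have hs := SAVWave.sobolevConst_nonneg ℓ₁ ℓ₂ P.α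
  obtain ⟨C, hC, τ₁, hτ₁, hτ₁', hmain⟩ := D.exists_err_bound
  refine ⟨τ₁, hτ₁,
    -- `C` may vanish, so 1 is added here, and likewise in the L^∞ bound, to obtain strictly
    -- positive constants.
    ((ℓ₁ * ℓ₂ + 2 * P.κ) * (1 + 1 / P.κ) ^ 2 + ℓ₁ * ℓ₂ + 2) * (C + 1), by positivity,
    SAVWave.sobolevConst ℓ₁ ℓ₂ P.α * (L + (1 + 1 / P.κ) * √C) + 1, by positivity,
    fun K hK τ hτ hlt => ?_⟩
  have hK' : (0 : ℝ) < K := by exact_mod_cast hK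
  have hτ0 : 0 < τ := by rw [hτ]; positivity
  have hKτ : K * τ = T := by rw [hτ]; field_simp
  have h0 : (0 : ℝ) ∈ Set.Icc 0 T := Set.left_mem_Icc.2 hT.le
  obtain ⟨S, hS⟩ := SAVWave.exists_isScheme D.valid hτ0 K (hsol.init_u ▸ hsol.mem_u 0 h0)
    (hsol.init_v ▸ hsol.mem_v 0 h0)
  obtain ⟨hpos, herr⟩ := hmain K τ hτ0 hlt hKτ S hS
  have ht : ∀ n ≤ K, (n : ℝ) * τ ∈ Set.Icc 0 T := fun n hn => ⟨by positivity, by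
    rw [← hKτ]
    exact mul_le_mul_of_nonneg_right (by exact_mod_cast hn) hτ0.le⟩
  have hτ3 : τ ^ 3 ≤ 1 := pow_le_one₀ hτ0.le (by linarith)
  refine ⟨S, hS, fun S' hS' => hS'.agree D.valid hτ0 hS, hpos, fun n hn => ?_, fun n hn => ?_⟩
  · rw [mul_assoc]
    exact D.error_sum_le hS hn (ht n hn)
      ((herr n hn).trans (mul_le_mul_of_nonneg_right (by linarith) (by positivity)))
  · refine (D.eLpNorm_scheme_le hS hn (ht n hn)
      ((herr n hn).trans (mul_le_of_le_one_right hC hτ3))).trans (ENNReal.ofReal_le_ofReal ?_)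
    linarith
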